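/- Graphs and digraphs are finite, without loops and without parallel or anti-parallel arcs. An acyclic $2$-colouring of a digraph $D$ is a map $c:V(D)\to\{1,2\}$ such that neither of the subdigraphs induced by $c^{-1}(1)$ and $c^{-1}(2)$ contains a directed cycle. A planar triangulation is a maximal planar graph on at least three vertices; its facial triangles are the triangles that bound a face in a crossing-free embedding of it in the sphere (this embedding is combinatorially unique up to reflection, and all its faces are bounded by triangles). A set of vertices is monochromatic if all its vertices receive the same colour. The following four statements are equivalent: (i) Every planar digraph has an acyclic $2$-colouring. (ii) Every orientation of a planar triangulation admits an acyclic $2$-colouring without monochromatic facial triangles. (iii) For any planar triangulation $T$, any facial triangle $a_1a_2a_3$ of $T$ and any non-monochromatic pre-colouring $p:\{a_1,a_2,a_3\}\to\{1,2\}$, every orientation $\vec T$ of $T$ admits an acyclic $2$-colouring $c:V(\vec T)\to\{1,2\}$ without monochromatic facial triangles such that $c(a_i)=p(a_i)$ for $i\in\{1,2,3\}$. (iv) For any planar triangulation $T$, any triangle $a_1a_2a_3$ of $T$ and any non-monochromatic pre-colouring $p:\{a_1,a_2,a_3\}\to\{1,2\}$, every orientation $\vec T$ of $T$ admits an acyclic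 $2$-colouring $c:V(\vec T)\to\{1,2\}$ without monochromatic triangles such that $c(a_i)=p(a_i)$ for $i\in\{1,2,3\}$. -/

import Mathlib

universe u

namespace PlanarDichromatic

/-! ### Digraphs, orientations, acyclic colourings -/

/-- The digraphs considered are loopless and have no anti-parallel arcs (parallel arcs are
excluded by the type `Digraph V`). The choice `u = v` gives looplessness. -/
def IsSimpleDigraph {V : Type u} (D : Digraph V) : Prop :=
  ∀ u v : V, D.Adj u v → ¬ D.Adj v u

/-- `D` is an orientation of the graph `G`: every edge of `G` carries exactly one of its two
directions in `D`, and `D` has no other arcs. -/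
def IsOrientation {V : Type u} (D : Digraph V) (G : SimpleGraph V) : Prop :=
  IsSimpleDigraph D ∧ D.toSimpleGraphInclusive = G

/-- The vertex set `X` is acyclic in `D`: the induced subdigraph `D[X]` contains no directed
cycle, i.e. no vertex is reached from itself by a directed walk of positive length in `D[X]`. -/
def IsAcyclicSet {V : Type u} (D : Digraph V) (X : Set V) : Prop :=
  ∀ x : V, ¬ Relation.TransGen (fun u v : V => u ∈ X ∧ v ∈ X ∧ D.Adj u v) x x

/-- An acyclic colouring with `k` colours: all colour classes are acyclic. -/
def IsAcyclicColouring {V : Type u} {k : ℕ} (D : Digraph V) (c : V → Fin k) : Prop :=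
  ∀ i : Fin k, IsAcyclicSet D (c ⁻¹' {i})

/-- `x`, `y`, `z` are the three vertices of a triangle of `G`. -/
def IsTriangle {V : Type u} (G : SimpleGraph V) (x y z : V) : Prop :=
  G.Adj x y ∧ G.Adj y z ∧ G.Adj z x

/-! ### Crossing-free embeddings

An embedding of a finite graph in the sphere is recorded combinatorially, by the cyclic order
in which the edges leave each vertex. -/

/-- A rotation system of `G`: a permutation of the darts (edges with a direction) of `G` that
permutes, for every vertex `v`, the darts leaving `v` in a single cycle. -/
structure RotationSystem {V : Type u} (G : SimpleGraph V) where
  /-- the next dart around the vertex that the given dart leaves -/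
  rot : Equiv.Perm G.Dart
  fst_rot : ∀ d : G.Dart, (rot d).fst = d.fst
  sameCycle_rot : ∀ d e : G.Dart, d.fst = e.fst → rot.SameCycle d e

namespace RotationSystem

variable {V : Type u} {G : SimpleGraph V}

/-- Face tracing: walk along the dart `d = (u, v)`, then leave `v` by the dart that follows
`(v, u)` in the rotation at `v`. -/
def faceNext (R : RotationSystem G) : Equiv.Perm G.Dart :=
  (SimpleGraph.Dart.symm_involutive (G := G)).toPerm.trans R.rot

/-- The facial walks of positive length: the orbits of face tracing on the darts. -/
def Face (R : RotationSystem G) : Type u :=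
  Quotient (Equiv.Perm.SameCycle.setoid R.faceNext)

/-- The number of facial walks. An isolated vertex is a component with one facial walk, which
has length zero and so is not an orbit of darts. -/
noncomputable def numFacialWalks (R : RotationSystem G) : ℕ :=
  Nat.card R.Face + Nat.card {v : V // ∀ w : V, ¬ G.Adj v w}

/-- The rotation system describes a crossing-free embedding: every connected component of `G`
is embedded in a sphere. For one component this says that (vertices) - (edges) + (facial walks)
equals `2`. This number is at most `2` for every component under every rotation system, so it
equals `2` for all components exactly when the sum over the components is twice their number. -/
def IsPlanar (R : RotationSystem G) : Prop :=
  Nat.card V + R.numFacialWalks = Nat.card G.edgeSet + 2 * Nat.card G.ConnectedComponent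

/-- Face tracing runs through a closed walk `a → b → c → a`. -/
def BoundsFace (R : RotationSystem G) (a b c : V) : Prop :=
  ∃ (hab : G.Adj a b) (hbc : G.Adj b c) (hca : G.Adj c a),
    R.faceNext ⟨(a, b), hab⟩ = ⟨(b, c), hbc⟩ ∧
    R.faceNext ⟨(b, c), hbc⟩ = ⟨(c, a), hca⟩ ∧
    R.faceNext ⟨(c, a), hca⟩ = ⟨(a, b), hab⟩

/-- `a`, `b`, `c`, in whatever order, are the vertices of a triangle that bounds a face. -/
def IsFacialTriangle (R : RotationSystem G) (a b c : V) : Prop :=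
  R.BoundsFace a b c ∨ R.BoundsFace a c b

end RotationSystem

/-- A finite graph is planar if it has a crossing-free embedding. -/
def IsPlanarGraph {V : Type u} (G : SimpleGraph V) : Prop :=
  ∃ R : RotationSystem G, R.IsPlanar

/-- A planar triangulation: a maximal planar graph on at least three vertices. Maximality is
that no edge can be added between its vertices while keeping the graph planar. -/
def IsPlanarTriangulation {V : Type u} (T : SimpleGraph V) : Prop :=
  3 ≤ Nat.card V ∧ Maximal IsPlanarGraph T

end PlanarDichromatic

/-!
The proof rests on homology modulo two. By Euler's formula, a rotation system describes a
crossing-free embedding if and only if every cycle modulo two of the graph is the boundary of a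
set of faces (`RotationSystem.isPlanar_iff_isExact`). In this form planarity is easy to handle: a
set of faces is a function on the darts that is constant under face tracing, and one only has to
say how such functions behave when a graph is changed. This gives the planarity of subgraphs
(`IsPlanarGraph.of_injective`), the insertion of an edge inside a face or between two components,
and the gluing of two planar graphs along an edge (`IsPlanarGraph.sup_of_edge`). It also replaces
the Jordan curve theorem for triangles: a triangle bounds a set of faces, and the vertices off the
triangle lie on one or the other side of it.

Two vertices of a common face of a planar triangulation are adjacent, and therefore all faces are
triangles (`IsPlanarTriangulation.next_next`); so the triangulations are the planar graphs with `3
n - 6` edges. A triangle that bounds no face separates the triangulation, and by counting edges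
both sides are triangulations again (`IsPlanarTriangulation.exists_separation`,
`IsTriangleSeparation.isPlanarTriangulation`).

That each of the four statements implies the one before it is then immediate: facial triangles are
triangles, every triangulation has a facial triangle, and every planar graph on at least three
vertices is a spanning subgraph of a triangulation. The way back leads from planar digraphs to the
extension of pre-colourings of facial triangles (`PlanarColouring.facialExtension`), and from
there to the extension of pre-colourings of all triangles (`FacialExtension.triangleExtension`).

Suppose that every planar digraph has an acyclic 2-colouring, and let an orientation of a
triangulation `T` be given. Inside every face one completes an octahedron, with three new
vertices, oriented such that a monochromatic face would force the three new vertices, which form a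
directed triangle, to have the other colour. So all acyclic 2-colourings of the larger planar
digraph are without monochromatic facial triangles on `T` (`not_monochromatic_of_gadget`). If all
of them had different colours at the ends of some arc `pq`, then three copies of the digraph,
glued such that the copies of `pq` form a directed triangle, would be a planar digraph without an
acyclic 2-colouring, since a triangle has no proper 2-colouring. Hence the ends of any given arc
may be required to have the same colour (`PlanarColouring.exists_eq`). Up to exchange of the
colours, a non-monochromatic pre-colouring of a facial triangle only prescribes which two of its
vertices have the same colour, so it extends.

Suppose that pre-colourings of facial triangles extend. If all triangles of `T` are facial, then
nothing is left to show. Otherwise `T` is cut along a separating triangle, and the two sides are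
coloured by induction, first the one that contains the pre-coloured triangle, then the other one,
with the colours on the separating triangle prescribed. A monochromatic directed cycle of the
whole could be rerouted into one of the sides, since any two vertices of the separating triangle
are joined by an arc (`reroute_walk`).
-/

namespace PlanarDichromatic

/-! ### Rotation systems as successor maps on neighbours -/

instance finite_dart {V : Type u} [Finite V] (G : SimpleGraph V) : Finite G.Dart :=
  Finite.of_injective _ SimpleGraph.Dart.toProd_injective

namespace RotationSystem

variable {V : Type u} {G : SimpleGraph V}

open Classical in
/-- The neighbour of `v` that follows the neighbour `w` in the rotation at `v`; the junk value `w`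
is used if `w` is not a neighbour. -/
noncomputable def next (R : RotationSystem G) (v w : V) : V :=
  if h : G.Adj v w then (R.rot ⟨(v, w), h⟩).snd else w

theorem adj_next (R : RotationSystem G) {v w : V} (h : G.Adj v w) : G.Adj v (R.next v w) := by
  have h1 := (R.rot ⟨(v, w), h⟩).adj
  have h2 : (R.rot ⟨(v, w), h⟩).fst = v := R.fst_rot ⟨(v, w), h⟩
  rw [h2] at h1
  simpa [next, h] using h1

theorem rot_mk (R : RotationSystem G) {v w : V} (h : G.Adj v w) :
    R.rot ⟨(v, w), h⟩ = ⟨(v, R.next v w), R.adj_next h⟩ := by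
  apply SimpleGraph.Dart.ext
  apply Prod.ext
  · exact R.fst_rot ⟨(v, w), h⟩
  · simp [next, h]

theorem faceNext_mk (R : RotationSystem G) {u v : V} (h : G.Adj u v) :
    R.faceNext ⟨(u, v), h⟩ = ⟨(v, R.next v u), R.adj_next h.symm⟩ := by
  have : R.faceNext ⟨(u, v), h⟩ = R.rot ⟨(v, u), h.symm⟩ := rfl
  rw [this, rot_mk]

theorem next_injective (R : RotationSystem G) {v w w' : V} (h : G.Adj v w) (h' : G.Adj v w')
    (e : R.next v w = R.next v w') : w = w' := by
  have h1 : R.rot ⟨(v, w), h⟩ = R.rot ⟨(v, w'), h'⟩ := by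
    rw [rot_mk, rot_mk]; simp [e]
  have h2 := R.rot.injective h1
  simpa using h2

theorem adj_next_iterate (R : RotationSystem G) {v w : V} (h : G.Adj v w) (k : ℕ) :
    G.Adj v ((R.next v)^[k] w) := by
  induction k with
  | zero => exact h
  | succ k ih => rw [Function.iterate_succ_apply']; exact R.adj_next ih

theorem exists_iterate_next [Finite V] (R : RotationSystem G) {v w w' : V} (h : G.Adj v w)
    (h' : G.Adj v w') : ∃ k : ℕ, (R.next v)^[k] w = w' := by
  obtain ⟨k, hk⟩ := (R.sameCycle_rot ⟨(v, w), h⟩ ⟨(v, w'), h'⟩ rfl).exists_nat_pow_eq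
  refine ⟨k, ?_⟩
  have key : ∀ k : ℕ, (R.rot ^ k) ⟨(v, w), h⟩
      = ⟨(v, (R.next v)^[k] w), R.adj_next_iterate h k⟩ := by
    intro k
    induction k with
    | zero => rfl
    | succ k ih =>
      rw [pow_succ', Equiv.Perm.mul_apply, ih, rot_mk]
      simp [Function.iterate_succ_apply', -Function.iterate_succ]
  rw [key] at hk
  simpa using hk

theorem reaches_next [Finite V] (R : RotationSystem G) {v w w' : V} (h : G.Adj v w)
    (h' : G.Adj v w') : Relation.ReflTransGen (fun a b => b = R.next v a) w w' := by
  obtain ⟨k, rfl⟩ := R.exists_iterate_next h h'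
  clear h'
  induction k with
  | zero => exact .refl
  | succ k ih => exact ih.tail (Function.iterate_succ_apply' _ _ _)

/-- A successor map on the neighbours that runs through all neighbours of each vertex comes from
a rotation system: by finiteness, transitivity already makes it bijective. -/
theorem exists_of_next [Finite V] (nx : V → V → V)
    (hadj : ∀ v w, G.Adj v w → G.Adj v (nx v w))
    (hreach : ∀ v w w', G.Adj v w → G.Adj v w' →
      Relation.ReflTransGen (fun a b => b = nx v a) w w') :
    ∃ R : RotationSystem G, ∀ v w, G.Adj v w → R.next v w = nx v w := by
  classical
  let g : G.Dart → G.Dart := fun d => ⟨(d.fst, nx d.fst d.snd), hadj _ _ d.adj⟩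
  have hpres : ∀ v a b, G.Adj v a → Relation.ReflTransGen (fun a b => b = nx v a) a b →
      G.Adj v b := by
    intro v a b ha hab
    induction hab with
    | refl => exact ha
    | tail _ h ih => rw [h]; exact hadj _ _ ih
  have hsurj : Function.Surjective g := by
    rintro ⟨⟨v, w⟩, h⟩
    have h0 : G.Adj v w := h
    have h1 := hreach v (nx v w) w (hadj _ _ h0) h0
    rcases Relation.ReflTransGen.cases_tail h1 with h2 | ⟨c, hc, hcw⟩
    · exact ⟨⟨(v, w), h⟩, by simp [g, ← h2]⟩
    · exact ⟨⟨(v, c), hpres _ _ _ (hadj _ _ h0) hc⟩, by simp [g, ← hcw]⟩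
  have hbij : Function.Bijective g := ⟨Finite.injective_iff_surjective.mpr hsurj, hsurj⟩
  let σ : Equiv.Perm G.Dart := Equiv.ofBijective g hbij
  have hσ : ∀ d, σ d = g d := fun d => rfl
  refine ⟨⟨σ, fun d => rfl, ?_⟩, ?_⟩
  · rintro ⟨⟨v, w⟩, h⟩ ⟨⟨v', w'⟩, h'⟩ e
    obtain rfl : v = v' := e
    have h0 : G.Adj v w := h
    have h1 := hreach v w w' h0 h'
    induction h1 with
    | refl => exact Equiv.Perm.SameCycle.refl _ _
    | tail hab hb ih =>
      rename_i b c
      have hvb : G.Adj v b := hpres _ _ _ h0 hab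
      have h2 := ih hvb
      have h3 : σ ⟨(v, b), hvb⟩ = ⟨(v, c), h'⟩ := by
        rw [hσ]; simp [g, ← hb]
      rw [← h3]
      exact (Equiv.Perm.sameCycle_apply_right).mpr h2
  · intro v w h
    simp [next, h, hσ, g]

end RotationSystem

/-! ### Planarity as vanishing of homology modulo two -/

/-- `z` is a cycle modulo two: a symmetric function on the edges of `G` whose values sum to zero
around every vertex. -/
structure IsEvenCycle {V : Type u} [Fintype V] (G : SimpleGraph V) (z : V → V → ZMod 2) : Prop where
  symm : ∀ v w, z v w = z w v
  supp : ∀ v w, ¬ G.Adj v w → z v w = 0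
  sum : ∀ v, ∑ w, z v w = 0

namespace RotationSystem

variable {V : Type u} {G : SimpleGraph V}

/-- `f`, a function of the darts, is constant on the facial walks: the dart that face tracing
takes after `(w, v)` is `(v, R.next v w)`. -/
def IsFaceFunction (R : RotationSystem G) (f : V → V → ZMod 2) : Prop :=
  ∀ v w, G.Adj v w → f v (R.next v w) = f w v

/-- Every cycle modulo two is the boundary of a set of faces. -/
def IsExact [Fintype V] (R : RotationSystem G) : Prop :=
  ∀ z, IsEvenCycle G z → ∃ f, R.IsFaceFunction f ∧ ∀ v w, G.Adj v w → f v w + f w v = z v w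

end RotationSystem

open scoped Matrix

section Incidence

variable {V : Type u} [Fintype V] (G : SimpleGraph V)

open Classical in
/-- The vertex-edge incidence matrix modulo two. -/
noncomputable def incidence : Matrix V G.edgeSet (ZMod 2) :=
  fun v e => if v ∈ e.1 then 1 else 0

instance finite_edgeSet : Finite G.edgeSet := Subtype.finite

noncomputable instance fintype_edgeSet : Fintype G.edgeSet := Fintype.ofFinite _

theorem finrank_range_funLeft {X Y : Type*} [Finite X] [Finite Y] (q : X → Y)
    (hq : Function.Surjective q) :
    Module.finrank (ZMod 2) (LinearMap.range (LinearMap.funLeft (ZMod 2) (ZMod 2) q))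
      = Nat.card Y := by
  classical
  cases nonempty_fintype Y
  rw [LinearMap.finrank_range_of_inj
    (LinearMap.funLeft_injective_of_surjective (ZMod 2) (ZMod 2) q hq),
    Module.finrank_fintype_fun_eq_card, Nat.card_eq_fintype_card]

variable {G} in
theorem incidence_transpose_mulVec (h : V → ZMod 2) {a b : V} (hab : G.Adj a b) :
    ((incidence G)ᵀ *ᵥ h) ⟨s(a, b), hab⟩ = h a + h b := by
  classical
  have hne : a ≠ b := hab.ne
  simp only [Matrix.mulVec, dotProduct, Matrix.transpose_apply, incidence, Sym2.mem_iff,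
    ite_mul, one_mul, zero_mul]
  rw [Finset.sum_ite, Finset.sum_const_zero, add_zero]
  have : (Finset.univ.filter fun x => x = a ∨ x = b) = {a, b} := by ext; simp
  rw [this, Finset.sum_pair hne]

theorem ker_incidence_transpose :
    LinearMap.ker (incidence G)ᵀ.mulVecLin =
      LinearMap.range (LinearMap.funLeft (ZMod 2) (ZMod 2) G.connectedComponentMk) := by
  ext h
  rw [LinearMap.mem_ker, LinearMap.mem_range, Matrix.mulVecLin_apply]
  constructor
  · intro h0
    have hadj : ∀ a b, G.Adj a b → h a = h b := by
      intro a b hab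
      have := congrFun h0 ⟨s(a, b), hab⟩
      rw [incidence_transpose_mulVec] at this
      exact CharTwo.add_eq_zero.mp this
    refine ⟨SimpleGraph.ConnectedComponent.lift h ?_, ?_⟩
    · intro v w p _
      induction p with
      | nil => rfl
      | cons hab _ ih =>
        rename_i hp
        exact (hadj _ _ hab).trans (ih hp.of_cons)
    · rfl
  · rintro ⟨g, rfl⟩
    ext ⟨e, he⟩
    induction e with | _ a b =>
    rw [incidence_transpose_mulVec _ he]
    have : G.connectedComponentMk a = G.connectedComponentMk b :=
      SimpleGraph.ConnectedComponent.sound (SimpleGraph.Adj.reachable he)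
    simp [LinearMap.funLeft_apply, this, CharTwo.add_self_eq_zero]

theorem finrank_ker_incidence :
    Module.finrank (ZMod 2) (LinearMap.ker (incidence G).mulVecLin) + Nat.card V
      = Nat.card G.edgeSet + Nat.card G.ConnectedComponent := by
  classical
  have h1 := LinearMap.finrank_range_add_finrank_ker (incidence G).mulVecLin
  have h2 := LinearMap.finrank_range_add_finrank_ker (incidence G)ᵀ.mulVecLin
  have h3 : (incidence G)ᵀ.rank = (incidence G).rank := Matrix.rank_transpose _
  rw [ker_incidence_transpose, finrank_range_funLeft] at h2
  · rw [Module.finrank_fintype_fun_eq_card] at h1 h2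
    unfold Matrix.rank at h3
    rw [Nat.card_eq_fintype_card, Nat.card_eq_fintype_card]
    omega
  · intro c
    induction c using SimpleGraph.ConnectedComponent.ind with | _ v => exact ⟨v, rfl⟩

open Classical in
variable {G} in
theorem sum_dart_fst (v : V) (g : G.Dart → ZMod 2) [Fintype G.Dart] :
    ∑ d : G.Dart with d.fst = v, g d
      = ∑ w, if h : G.Adj v w then g ⟨(v, w), h⟩ else 0 := by
  rw [Finset.sum_dite, Finset.sum_const_zero, add_zero]
  refine Finset.sum_bij' (fun d hd => ⟨d.snd, by
      have := d.adj; simp only [Finset.mem_filter, Finset.mem_univ, true_and] at hd ⊢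
      rwa [← hd]⟩) (fun w hw => ⟨(v, w.1), (Finset.mem_filter.mp w.2).2⟩) ?_ ?_ ?_ ?_ ?_
  · intro d hd; simp
  · intro w hw; simp
  · rintro ⟨⟨a, b⟩, hab⟩ hd; simp at hd; subst hd; rfl
  · intro w hw; rfl
  · rintro ⟨⟨a, b⟩, hab⟩ hd; simp at hd; subst hd; rfl

open Classical in
variable {G} in
theorem incidence_mulVec (z : G.edgeSet → ZMod 2) (v : V) :
    ((incidence G) *ᵥ z) v = ∑ w, if h : G.Adj v w then z ⟨s(v, w), h⟩ else 0 := by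
  simp only [Matrix.mulVec, dotProduct, incidence, ite_mul, one_mul, zero_mul]
  rw [Finset.sum_dite, Finset.sum_const_zero, add_zero, Finset.sum_ite, Finset.sum_const_zero,
    add_zero]
  symm
  refine Finset.sum_bij (fun w _ => ⟨s(v, w.1), (Finset.mem_filter.mp w.2).2⟩) ?_ ?_ ?_ ?_
  · intro w hw; simp
  · intro w hw w' hw' e
    exact Subtype.ext (Sym2.congr_right.mp (congrArg Subtype.val e))
  · rintro ⟨e, he⟩ hv
    simp only [Finset.mem_filter, Finset.mem_univ, true_and] at hv
    obtain ⟨w, rfl⟩ := hv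
    exact ⟨⟨w, by simpa using he⟩, by simp, rfl⟩
  · intro w hw; rfl

end Incidence

namespace RotationSystem

variable {V : Type u} {G : SimpleGraph V}

/-- The facial walk that uses a dart. -/
def faceOf (R : RotationSystem G) (d : G.Dart) : R.Face :=
  Quotient.mk (Equiv.Perm.SameCycle.setoid R.faceNext) d

theorem faceOf_eq_iff (R : RotationSystem G) (d e : G.Dart) :
    R.faceOf d = R.faceOf e ↔ R.faceNext.SameCycle d e :=
  Quotient.eq (r := Equiv.Perm.SameCycle.setoid R.faceNext)

theorem faceOf_surjective (R : RotationSystem G) : Function.Surjective R.faceOf :=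
  Quotient.mk_surjective

theorem faceOf_faceNext (R : RotationSystem G) (d : G.Dart) :
    R.faceOf (R.faceNext d) = R.faceOf d :=
  (R.faceOf_eq_iff _ _).mpr (Equiv.Perm.sameCycle_apply_left.mpr (Equiv.Perm.SameCycle.refl _ _))

theorem faceNext_symm (R : RotationSystem G) (d : G.Dart) : R.faceNext d.symm = R.rot d := by
  change R.rot d.symm.symm = _
  rw [SimpleGraph.Dart.symm_symm]

instance finite_face [Finite V] (R : RotationSystem G) : Finite R.Face :=
  Finite.of_surjective _ R.faceOf_surjective

/-- A function that is invariant under face tracing is a function of the faces. -/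
theorem exists_comp_faceOf (R : RotationSystem G) {X : Type*} (f : G.Dart → X)
    (hf : ∀ d, f (R.faceNext d) = f d) : ∃ g : R.Face → X, ∀ d, g (R.faceOf d) = f d := by
  refine ⟨Quotient.lift f ?_, fun d => rfl⟩
  rintro a b ⟨i, hi⟩
  have key : ∀ i : ℤ, ∀ a, f ((R.faceNext ^ i) a) = f a := by
    intro i
    induction i with
    | zero => intro a; simp
    | succ n ih => intro a; rw [zpow_add_one, Equiv.Perm.mul_apply, ih, hf]
    | pred n ih =>
      intro a
      rw [zpow_sub_one, Equiv.Perm.mul_apply, ih]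
      rw [← hf (R.faceNext⁻¹ a)]
      simp
  rw [← hi, key]

theorem exists_dart_edge (e : G.edgeSet) : ∃ d : G.Dart, d.edge = e.1 := by
  obtain ⟨e, he⟩ := e
  induction e with | _ a b => exact ⟨⟨(a, b), he⟩, rfl⟩

/-- The boundary map modulo two, from sets of faces to sets of edges. The dart chosen on an edge
does not matter, see `boundary_apply`. -/
noncomputable def boundary (R : RotationSystem G) :
    (R.Face → ZMod 2) →ₗ[ZMod 2] (G.edgeSet → ZMod 2) :=
  LinearMap.funLeft (ZMod 2) (ZMod 2) (fun e => R.faceOf (exists_dart_edge e).choose) +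
    LinearMap.funLeft (ZMod 2) (ZMod 2) (fun e => R.faceOf (exists_dart_edge e).choose.symm)

theorem boundary_apply (R : RotationSystem G) (f : R.Face → ZMod 2) (d : G.Dart) :
    R.boundary f ⟨d.edge, d.edge_mem⟩ = f (R.faceOf d) + f (R.faceOf d.symm) := by
  have h := (exists_dart_edge (⟨d.edge, d.edge_mem⟩ : G.edgeSet)).choose_spec
  rcases (SimpleGraph.dart_edge_eq_iff _ _).mp h with h | h
  · simp [boundary, LinearMap.funLeft_apply, h]
  · simp [boundary, LinearMap.funLeft_apply, h, add_comm]

/-- The components of `G` that have an edge. -/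
abbrev EdgeComponent (G : SimpleGraph V) : Type u :=
  Set.range fun d : G.Dart => G.connectedComponentMk d.fst

theorem card_edgeComponent [Finite V] :
    Nat.card (EdgeComponent G) + Nat.card {v : V // ∀ w : V, ¬ G.Adj v w}
      = Nat.card G.ConnectedComponent := by
  classical
  have h1 : Nat.card {v : V // ∀ w : V, ¬ G.Adj v w}
      = Nat.card ((Set.range fun d : G.Dart => G.connectedComponentMk d.fst)ᶜ :
          Set G.ConnectedComponent) := by
    refine Nat.card_congr (Equiv.ofBijective (fun v => ⟨G.connectedComponentMk v.1, ?_⟩) ⟨?_, ?_⟩)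
    · rintro ⟨d, hd⟩
      obtain ⟨v, hv⟩ := v
      obtain ⟨⟨a, b⟩, hab⟩ := d
      obtain ⟨p⟩ := SimpleGraph.ConnectedComponent.exact hd.symm
      cases p with
      | nil => exact hv _ hab
      | cons h _ => exact hv _ h
    · rintro ⟨v, hv⟩ ⟨w, hw⟩ e
      obtain ⟨p⟩ := SimpleGraph.ConnectedComponent.exact (congrArg Subtype.val e)
      cases p with
      | nil => rfl
      | cons h _ => exact (hv _ h).elim
    · rintro ⟨c, hc⟩
      induction c using SimpleGraph.ConnectedComponent.ind with | _ v =>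
      exact ⟨⟨v, fun w h => hc ⟨⟨(v, w), h⟩, rfl⟩⟩, rfl⟩
  rw [h1, Nat.card_coe_set_eq, Nat.card_coe_set_eq, Set.ncard_add_ncard_compl]

/-- A face meets only one component. -/
theorem exists_edgeComponent_of_face (R : RotationSystem G) :
    ∃ q : R.Face → EdgeComponent G,
      ∀ d, q (R.faceOf d) = ⟨G.connectedComponentMk d.fst, d, rfl⟩ := by
  refine R.exists_comp_faceOf
    (fun d => (⟨G.connectedComponentMk d.fst, d, rfl⟩ : EdgeComponent G)) ?_
  rintro ⟨⟨a, b⟩, h⟩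
  rw [faceNext_mk]
  exact Subtype.ext (SimpleGraph.ConnectedComponent.sound (SimpleGraph.Adj.reachable h.symm))

/-- A set of faces without boundary is a union of components: whether it contains the face of a
dart does not change when the dart is reversed or rotated. -/
theorem ker_boundary [Finite V] (R : RotationSystem G) (q : R.Face → EdgeComponent G)
    (hq : ∀ d, q (R.faceOf d) = ⟨G.connectedComponentMk d.fst, d, rfl⟩) :
    LinearMap.ker R.boundary = LinearMap.range (LinearMap.funLeft (ZMod 2) (ZMod 2) q) := by
  ext f
  rw [LinearMap.mem_ker, LinearMap.mem_range]
  constructor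
  · intro h0
    have hsymm : ∀ d, f (R.faceOf d.symm) = f (R.faceOf d) := by
      intro d
      have := congrFun h0 ⟨d.edge, d.edge_mem⟩
      rw [boundary_apply] at this
      exact (CharTwo.add_eq_zero.mp this).symm
    have hrot : ∀ d, f (R.faceOf (R.rot d)) = f (R.faceOf d) := by
      intro d
      rw [← faceNext_symm, faceOf_faceNext, hsymm]
    have hfst : ∀ d e : G.Dart, d.fst = e.fst → f (R.faceOf d) = f (R.faceOf e) := by
      intro d e hde
      obtain ⟨k, hk⟩ := (R.sameCycle_rot d e hde).exists_nat_pow_eq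
      rw [← hk]
      clear hk
      induction k with
      | zero => rfl
      | succ k ih => rw [pow_succ', Equiv.Perm.mul_apply, hrot, ih]
    have hwalk : ∀ a b : V, ∀ p : G.Walk a b, ∀ d e : G.Dart, d.fst = a → e.fst = b →
        f (R.faceOf d) = f (R.faceOf e) := by
      intro a b p
      induction p with
      | nil => intro d e hd he; exact hfst d e (hd.trans he.symm)
      | cons h p ih =>
        rename_i x y z
        intro d e hd he
        rw [← ih (⟨(x, y), h⟩ : G.Dart).symm e rfl he, hsymm]
        exact hfst _ _ hd
    refine ⟨fun c => f (R.faceOf c.2.choose), ?_⟩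
    funext F
    obtain ⟨d, rfl⟩ := R.faceOf_surjective F
    rw [LinearMap.funLeft_apply, hq]
    have hc := (⟨d, rfl⟩ : ∃ e : G.Dart, (fun d : G.Dart => G.connectedComponentMk d.fst) e
      = G.connectedComponentMk d.fst).choose_spec
    obtain ⟨p⟩ := SimpleGraph.ConnectedComponent.exact hc
    exact hwalk _ _ p _ _ rfl rfl
  · rintro ⟨g, rfl⟩
    funext ⟨e, he⟩
    induction e with | _ a b =>
    have := R.boundary_apply (LinearMap.funLeft (ZMod 2) (ZMod 2) q g) ⟨(a, b), he⟩
    refine this.trans ?_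
    rw [LinearMap.funLeft_apply, LinearMap.funLeft_apply, hq, hq]
    have : (⟨G.connectedComponentMk a, ⟨(a, b), he⟩, rfl⟩ : EdgeComponent G)
        = ⟨G.connectedComponentMk b, (⟨(a, b), he⟩ : G.Dart).symm, rfl⟩ :=
      Subtype.ext (SimpleGraph.ConnectedComponent.sound (SimpleGraph.Adj.reachable he))
    exact (congrArg (fun x => g x + _) this).trans (CharTwo.add_self_eq_zero _)

theorem finrank_ker_boundary [Finite V] (R : RotationSystem G) :
    Module.finrank (ZMod 2) (LinearMap.ker R.boundary) = Nat.card (EdgeComponent G) := by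
  obtain ⟨q, hq⟩ := R.exists_edgeComponent_of_face
  rw [R.ker_boundary q hq, finrank_range_funLeft]
  rintro ⟨_, d, rfl⟩
  exact ⟨R.faceOf d, hq d⟩

/-- The boundary of a set of faces is a cycle. -/
theorem incidence_mulVec_boundary [Fintype V] (R : RotationSystem G) (f : R.Face → ZMod 2) :
    incidence G *ᵥ R.boundary f = 0 := by
  classical
  let _ : Fintype G.Dart := Fintype.ofFinite _
  funext v
  have h1 := sum_dart_fst v (fun d : G.Dart => R.boundary f ⟨d.edge, d.edge_mem⟩)
  rw [incidence_mulVec]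
  refine h1.symm.trans ?_
  simp only [boundary_apply]
  rw [Finset.sum_add_distrib]
  have h2 : ∑ d : G.Dart with d.fst = v, f (R.faceOf d.symm)
      = ∑ d : G.Dart with d.fst = v, f (R.faceOf d) := by
    refine Finset.sum_equiv R.rot (fun d => by simp [R.fst_rot]) (fun d _ => ?_)
    rw [← R.faceNext_symm, R.faceOf_faceNext]
  rw [h2]
  exact CharTwo.add_self_eq_zero _

/-- Euler's formula says that the boundaries of sets of faces and the cycles have the same
dimension. -/
theorem isPlanar_iff_range_boundary [Fintype V] (R : RotationSystem G) :
    R.IsPlanar ↔ LinearMap.range R.boundary = LinearMap.ker (incidence G).mulVecLin := by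
  classical
  have hle : LinearMap.range R.boundary ≤ LinearMap.ker (incidence G).mulVecLin := by
    rintro _ ⟨f, rfl⟩
    exact R.incidence_mulVec_boundary f
  have h1 := finrank_ker_incidence G
  have h2 := R.finrank_ker_boundary
  have h3 := card_edgeComponent (G := G)
  cases nonempty_fintype R.Face
  have h4 := LinearMap.finrank_range_add_finrank_ker R.boundary
  rw [Module.finrank_fintype_fun_eq_card, ← Nat.card_eq_fintype_card, h2] at h4
  have h5 : R.IsPlanar ↔ Module.finrank (ZMod 2) (LinearMap.range R.boundary)
      = Module.finrank (ZMod 2) (LinearMap.ker (incidence G).mulVecLin) := by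
    unfold IsPlanar numFacialWalks
    omega
  rw [h5]
  exact ⟨fun h => Submodule.eq_of_le_of_finrank_eq hle h, fun h => by rw [h]⟩

/-- A rotation system describes a crossing-free embedding if and only if every cycle modulo two
bounds a set of faces. -/
theorem isPlanar_iff_isExact [Fintype V] (R : RotationSystem G) : R.IsPlanar ↔ R.IsExact := by
  classical
  rw [isPlanar_iff_range_boundary]
  constructor
  · intro h z hz
    let y : G.edgeSet → ZMod 2 := fun e => Sym2.lift ⟨z, hz.symm⟩ e.1
    have hy : y ∈ LinearMap.ker (incidence G).mulVecLin := by
      rw [LinearMap.mem_ker, Matrix.mulVecLin_apply]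
      funext v
      rw [incidence_mulVec]
      refine Eq.trans (Finset.sum_congr rfl fun w _ => ?_) (hz.sum v)
      by_cases hvw : G.Adj v w
      · simp [hvw, y]
      · simp [hvw, hz.supp]
    rw [← h] at hy
    obtain ⟨f, hf⟩ := hy
    refine ⟨fun v w => if hvw : G.Adj v w then f (R.faceOf ⟨(v, w), hvw⟩) else 0, ?_, ?_⟩
    · intro v w hvw
      simp only [R.adj_next hvw, hvw.symm, dite_true]
      rw [← R.faceOf_faceNext ⟨(w, v), hvw.symm⟩, faceNext_mk]
    · intro v w hvw
      simp only [hvw, hvw.symm, dite_true]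
      have := R.boundary_apply f ⟨(v, w), hvw⟩
      rw [hf] at this
      exact this.symm
  · intro h
    refine le_antisymm ?_ ?_
    · rintro _ ⟨f, rfl⟩
      exact R.incidence_mulVec_boundary f
    · intro y hy
      rw [LinearMap.mem_ker, Matrix.mulVecLin_apply] at hy
      obtain ⟨f, hf, hfy⟩ := h (fun v w => if hvw : G.Adj v w then y ⟨s(v, w), hvw⟩ else 0)
        { symm := by
            intro v w
            by_cases hvw : G.Adj v w
            · simp only [hvw, hvw.symm, dite_true, Sym2.eq_swap]
            · have : ¬ G.Adj w v := fun h => hvw h.symm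
              simp only [hvw, this, dite_false]
          supp := by intro v w hvw; simp only [hvw, dite_false]
          sum := by
            intro v
            rw [← incidence_mulVec, hy]; rfl }
      obtain ⟨g, hg⟩ := R.exists_comp_faceOf (fun d => f d.fst d.snd) (by
        rintro ⟨⟨v, w⟩, hvw⟩
        rw [faceNext_mk]
        exact hf w v hvw.symm)
      refine ⟨g, ?_⟩
      funext ⟨e, he⟩
      induction e with | _ a b =>
      have he' : G.Adj a b := he
      have h1 := R.boundary_apply g ⟨(a, b), he⟩
      refine h1.trans ?_
      rw [hg, hg]
      have h2 := hfy a b he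
      simp only [he', dite_true] at h2
      exact h2

end RotationSystem

/-! ### Planarity of subgraphs and of graphs with further vertices -/

section Transfer

theorem isPlanarGraph_iff {V : Type u} [Fintype V] {G : SimpleGraph V} :
    IsPlanarGraph G ↔ ∃ R : RotationSystem G, R.IsExact :=
  exists_congr fun R => R.isPlanar_iff_isExact

variable {V W : Type u} [Finite V] [Finite W]

/-- A graph that embeds in a planar graph is planar. The rotation at a vertex skips the darts that
are lost. If a cycle of the subgraph is the boundary of a set of faces of the large graph, then
this set does not separate the faces that merge when edges off the cycle are lost. -/
theorem IsPlanarGraph.of_injective {G : SimpleGraph V} (hG : IsPlanarGraph G) {G' : SimpleGraph W}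
    (ι : W → V) (hι : Function.Injective ι) (hadj : ∀ a b, G'.Adj a b → G.Adj (ι a) (ι b)) :
    IsPlanarGraph G' := by
  classical
  cases nonempty_fintype V
  cases nonempty_fintype W
  obtain ⟨R, hR⟩ := isPlanarGraph_iff.mp hG
  let P : W → W → ℕ → Prop := fun a b k => ∃ c, G'.Adj a c ∧ (R.next (ι a))^[k + 1] (ι b) = ι c
  have hP : ∀ a b, G'.Adj a b → ∃ k, P a b k := by
    intro a b hab
    obtain ⟨k, hk⟩ := R.exists_iterate_next (R.adj_next (hadj _ _ hab)) (hadj _ _ hab)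
    exact ⟨k, b, hab, hk⟩
  let nx : W → W → W := fun a b =>
    if h : ∃ k, P a b k then (Nat.find_spec h).choose else b
  have hnx : ∀ a b, G'.Adj a b → ∃ m, G'.Adj a (nx a b) ∧
      (R.next (ι a))^[m + 1] (ι b) = ι (nx a b) ∧ ∀ j < m, ¬ P a b j := by
    intro a b hab
    have h := hP a b hab
    have h1 := (Nat.find_spec h).choose_spec
    refine ⟨Nat.find h, ?_, ?_, fun j hj => Nat.find_min h hj⟩
    · simp only [nx, h, dite_true]; exact h1.1
    · simp only [nx, h, dite_true]; exact h1.2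
  obtain ⟨R', hR'⟩ := RotationSystem.exists_of_next (G := G') nx
    (fun a b hab => (hnx a b hab).choose_spec.1) (by
      have key : ∀ k : ℕ, ∀ a b c, G'.Adj a b → G'.Adj a c → (R.next (ι a))^[k] (ι b) = ι c →
          Relation.ReflTransGen (fun x y => y = nx a x) b c := by
        intro k
        induction k using Nat.strong_induction_on with
        | _ k ih =>
          intro a b c hab hac hk
          rcases k with _ | k
          · obtain rfl : b = c := hι hk
            exact .refl
          · obtain ⟨m, h1, h2, h3⟩ := hnx a b hab
            have hmk : m ≤ k := by
              by_contra hlt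
              exact h3 k (by omega) ⟨c, hac, hk⟩
            refine Relation.ReflTransGen.head rfl (ih (k - m) (by omega) a _ c h1 hac ?_)
            have e : k - m + (m + 1) = k + 1 := by omega
            rw [← h2, ← Function.iterate_add_apply, e, hk]
      intro a b c hab hac
      obtain ⟨k, hk⟩ := R.exists_iterate_next (hadj _ _ hab) (hadj _ _ hac)
      exact key k a b c hab hac hk)
  refine isPlanarGraph_iff.mpr ⟨R', ?_⟩
  intro z hz
  have hιι : Function.Injective (Prod.map ι ι) := hι.prodMap hι
  let y : V → V → ZMod 2 := fun v w =>
    Function.extend (Prod.map ι ι) (fun p => z p.1 p.2) (fun _ => 0) (v, w)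
  have hy : ∀ a b, y (ι a) (ι b) = z a b := fun a b => hιι.extend_apply _ _ (a, b)
  have hy0 : ∀ v w, (¬ ∃ p, Prod.map ι ι p = (v, w)) → y v w = 0 := fun v w h =>
    Function.extend_apply' _ _ _ h
  have hcyc : IsEvenCycle G y :=
    { symm := by
        intro v w
        by_cases h : ∃ p, Prod.map ι ι p = (v, w)
        · obtain ⟨⟨a, b⟩, h⟩ := h
          obtain ⟨rfl, rfl⟩ : ι a = v ∧ ι b = w := by simpa using h
          rw [hy, hy, hz.symm]
        · rw [hy0 _ _ h, hy0]
          rintro ⟨⟨a, b⟩, h'⟩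
          obtain ⟨rfl, rfl⟩ : ι a = w ∧ ι b = v := by simpa using h'
          exact h ⟨(b, a), rfl⟩
      supp := by
        intro v w hvw
        by_cases h : ∃ p, Prod.map ι ι p = (v, w)
        · obtain ⟨⟨a, b⟩, h⟩ := h
          obtain ⟨rfl, rfl⟩ : ι a = v ∧ ι b = w := by simpa using h
          rw [hy]
          exact hz.supp _ _ fun h => hvw (hadj _ _ h)
        · exact hy0 _ _ h
      sum := by
        intro v
        by_cases h : ∃ a, ι a = v
        · obtain ⟨a, rfl⟩ := h
          rw [← hz.sum a]
          symm
          refine Fintype.sum_of_injective ι hι _ _ ?_ ?_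
          · intro w hw
            refine hy0 _ _ ?_
            rintro ⟨⟨c, b⟩, h⟩
            exact hw ⟨b, congrArg Prod.snd h⟩
          · intro b; exact (hy a b).symm
        · refine Finset.sum_eq_zero fun w _ => hy0 _ _ ?_
          rintro ⟨⟨a, b⟩, h'⟩
          exact h ⟨a, congrArg Prod.fst h'⟩ }
  obtain ⟨f, hf, hfy⟩ := hR y hcyc
  refine ⟨fun a b => f (ι a) (ι b), ?_, ?_⟩
  · intro a b hab
    change f (ι a) (ι (R'.next a b)) = f (ι b) (ι a)
    rw [hR' a b hab]
    obtain ⟨m, -, h2, h3⟩ := hnx a b hab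
    rw [← h2]
    have key : ∀ j ≤ m, f (ι a) ((R.next (ι a))^[j + 1] (ι b)) = f (ι b) (ι a) := by
      intro j
      induction j with
      | zero => intro _; exact hf _ _ (hadj _ _ hab)
      | succ j ih =>
        intro hj
        have hx := R.adj_next_iterate (hadj _ _ hab) (j + 1)
        rw [Function.iterate_succ_apply', hf _ _ hx, ← ih (by omega)]
        have h0 : y (ι a) ((R.next (ι a))^[j + 1] (ι b)) = 0 := by
          by_cases h : ∃ c, ι c = (R.next (ι a))^[j + 1] (ι b)
          · obtain ⟨c, hc⟩ := h
            rw [← hc, hy]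
            exact hz.supp _ _ fun hac => h3 j (by omega) ⟨c, hac, hc.symm⟩
          · refine hy0 _ _ ?_
            rintro ⟨⟨c, b⟩, h'⟩
            exact h ⟨b, congrArg Prod.snd h'⟩
        have h4 := hfy _ _ hx
        rw [h0] at h4
        exact (CharTwo.add_eq_zero.mp h4).symm
    exact key m le_rfl
  · intro a b hab
    rw [← hy]
    exact hfy _ _ (hadj _ _ hab)

theorem IsPlanarGraph.mono {G G' : SimpleGraph V} (hG : IsPlanarGraph G) (h : G' ≤ G) :
    IsPlanarGraph G' :=
  hG.of_injective id Function.injective_id fun _ _ hab => h hab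

/-- Further isolated vertices do not matter for planarity. -/
theorem IsPlanarGraph.map {G : SimpleGraph W} (hG : IsPlanarGraph G) (ι : W ↪ V) :
    IsPlanarGraph (G.map ι) := by
  classical
  cases nonempty_fintype V
  cases nonempty_fintype W
  obtain ⟨R, hR⟩ := isPlanarGraph_iff.mp hG
  have hιι : Function.Injective (Prod.map ι ι) := ι.injective.prodMap ι.injective
  let nx : V → V → V := fun v w =>
    Function.extend (Prod.map ι ι) (fun p => ι (R.next p.1 p.2)) (fun p => p.2) (v, w)
  have hnx : ∀ a b, nx (ι a) (ι b) = ι (R.next a b) := fun a b => hιι.extend_apply _ _ (a, b)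
  have hadj : ∀ a b, (G.map ι).Adj (ι a) (ι b) ↔ G.Adj a b := fun a b =>
    SimpleGraph.map_adj_apply
  obtain ⟨R', hR'⟩ := RotationSystem.exists_of_next (G := G.map ι) nx (by
      intro v w hvw
      obtain ⟨-, a, b, hab, rfl, rfl⟩ := hvw
      rw [hnx, hadj]
      exact R.adj_next hab) (by
      intro v w w' h h'
      obtain ⟨-, a, b, hab, rfl, rfl⟩ := h
      obtain ⟨-, a', c, hac, e, rfl⟩ := h'
      obtain rfl := ι.injective e
      exact (R.reaches_next hab hac).lift ι fun x y hxy => by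
        change ι y = nx _ (ι x)
        rw [hnx, hxy])
  refine isPlanarGraph_iff.mpr ⟨R', ?_⟩
  intro z hz
  obtain ⟨f, hf, hfz⟩ := hR (fun a b => z (ι a) (ι b))
    { symm := fun a b => hz.symm _ _
      supp := fun a b hab => hz.supp _ _ fun h => hab ((hadj _ _).mp h)
      sum := by
        intro a
        rw [← hz.sum (ι a)]
        refine Fintype.sum_of_injective ι ι.injective _ _ ?_ fun b => rfl
        intro w hw
        refine hz.supp _ _ ?_
        rintro ⟨-, a', b, hab, -, rfl⟩
        exact hw ⟨b, rfl⟩ }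
  let f' : V → V → ZMod 2 := fun v w =>
    Function.extend (Prod.map ι ι) (fun p => f p.1 p.2) (fun _ => 0) (v, w)
  have hf' : ∀ a b, f' (ι a) (ι b) = f a b := fun a b => hιι.extend_apply _ _ (a, b)
  refine ⟨f', ?_, ?_⟩
  · intro v w hvw
    rw [hR' _ _ hvw]
    obtain ⟨-, a, b, hab, rfl, rfl⟩ := hvw
    rw [hnx, hf', hf']
    exact hf a b hab
  · rintro v w ⟨-, a, b, hab, rfl, rfl⟩
    rw [hf', hf']
    exact hfz a b hab

end Transfer

/-! ### Insertion of an edge -/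

/-- A cycle of a permutation that runs through two points `x` and `y` falls into two arcs; `S` is
the arc that begins at `x` and ends just before `y`. -/
theorem exists_arc {X : Type*} [Finite X] (φ : Equiv.Perm X) {x y : X} (h : φ.SameCycle x y)
    (hne : x ≠ y) : ∃ S : Set X, x ∈ S ∧ y ∉ S ∧ (∀ w, φ w = x → w ∉ S) ∧
      (∀ w, φ w = y → w ∈ S) ∧ ∀ w, φ w ≠ x → φ w ≠ y → (φ w ∈ S ↔ w ∈ S) := by
  classical
  have hex : ∃ k : ℕ, (φ ^ k) x = y := by
    obtain ⟨k, hk⟩ := h.exists_nat_pow_eq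
    exact ⟨k, hk⟩
  let k := Nat.find hex
  have hk : (φ ^ k) x = y := Nat.find_spec hex
  have hmin : ∀ j < k, (φ ^ j) x ≠ y := fun j hj => Nat.find_min hex hj
  have hk0 : k ≠ 0 := by
    intro h0
    rw [h0] at hk
    exact hne hk
  have hs : ∀ j, (φ ^ (j + 1)) x = φ ((φ ^ j) x) := fun j => by
    rw [pow_succ', Equiv.Perm.mul_apply]
  refine ⟨{w | ∃ i < k, (φ ^ i) x = w}, ⟨0, by omega, rfl⟩, ?_, ?_, ?_, ?_⟩
  · rintro ⟨i, hi, e⟩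
    exact hmin i hi e
  · rintro w hw ⟨i, hi, rfl⟩
    rw [← hs] at hw
    rcases Nat.lt_or_ge (i + 1) k with h1 | h1
    · refine hmin (k - (i + 1)) (by omega) ?_
      have : k = (k - (i + 1)) + (i + 1) := by omega
      rw [← hk]
      conv_rhs => rw [this, pow_add, Equiv.Perm.mul_apply, hw]
    · have : i + 1 = k := by omega
      rw [this, hk] at hw
      exact hne hw.symm
  · intro w hw
    refine ⟨k - 1, by omega, φ.injective ?_⟩
    rw [← hs, hw, ← hk]
    congr 2
    omega
  · intro w hwx hwy
    constructor
    · rintro ⟨i, hi, e⟩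
      rcases i with _ | i
      · exact (hwx e.symm).elim
      · rw [hs] at e
        exact ⟨i, by omega, φ.injective e⟩
    · rintro ⟨i, hi, rfl⟩
      refine ⟨i + 1, ?_, hs i⟩
      by_contra h1
      have : i + 1 = k := by omega
      rw [← hs, this] at hwy
      exact hwy hk

/-- Insertion of a new element `v` after `p` into a cyclic order given by its successor map. -/
theorem reaches_insert {V : Type u} [DecidableEq V] (N : V → Prop) (n : V → V) (v p : V)
    (hN : ∀ b, N b → N (n b))
    (hn : ∀ b c, N b → N c → Relation.ReflTransGen (fun x y => y = n x) b c)
    (hv : ¬ N v) (hp : N p ∨ (p = v ∧ ∀ b, ¬ N b)) (b c : V) (hb : N b ∨ b = v)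
    (hc : N c ∨ c = v) :
    Relation.ReflTransGen
      (fun x y => y = if x = p then v else if x = v then n p else n x) b c := by
  rcases hp with hp | ⟨rfl, hempty⟩
  · have hpv : v ≠ p := fun h => hv (h ▸ hp)
    have hvp : Relation.ReflTransGen
        (fun x y => y = if x = p then v else if x = v then n p else n x) v (n p) :=
      .single (by simp [hpv])
    have hpv' : Relation.ReflTransGen
        (fun x y => y = if x = p then v else if x = v then n p else n x) p v :=
      .single (by simp)
    have key : ∀ b c, N b → N c → Relation.ReflTransGen
        (fun x y => y = if x = p then v else if x = v then n p else n x) b c := by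
      intro b c hb hc
      have h := hn b c hb hc
      suffices N c ∧ Relation.ReflTransGen
        (fun x y => y = if x = p then v else if x = v then n p else n x) b c from this.2
      clear hc
      induction h with
      | refl => exact ⟨hb, .refl⟩
      | @tail x y _ hxy ih =>
        obtain ⟨hx, ih⟩ := ih
        subst hxy
        refine ⟨hN _ hx, ih.trans ?_⟩
        by_cases hxp : x = p
        · subst hxp
          exact hpv'.trans hvp
        · refine .single ?_
          have : x ≠ v := fun h => hv (h ▸ hx)
          simp [hxp, this]
    rcases hb with hb | rfl <;> rcases hc with hc | rfl
    · exact key b c hb hc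
    · exact (key b p hb hp).trans hpv'
    · exact hvp.trans (key _ _ (hN _ hp) hc)
    · exact .refl
  · have hb' : b = p := hb.resolve_left (hempty b)
    have hc' : c = p := hc.resolve_left (hempty c)
    rw [hb', hc']

namespace RotationSystem

variable {V : Type u} {G : SimpleGraph V}

theorem sum_next [Fintype V] [DecidableRel G.Adj] (R : RotationSystem G) (v : V)
    (h : V → ZMod 2) : ∑ w with G.Adj v w, h (R.next v w) = ∑ w with G.Adj v w, h w := by
  classical
  have hinj : Set.InjOn (R.next v) (Finset.univ.filter fun w => G.Adj v w : Finset V) := by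
    intro a ha b hb e
    exact R.next_injective (by simpa using ha) (by simpa using hb) e
  have hmaps : ∀ a ∈ Finset.univ.filter fun w => G.Adj v w,
      R.next v a ∈ Finset.univ.filter fun w => G.Adj v w := by
    intro a ha
    simp only [Finset.mem_filter, Finset.mem_univ, true_and] at ha ⊢
    exact R.adj_next ha
  exact Finset.sum_nbij (R.next v) hmaps hinj
    (Finset.surjOn_of_injOn_of_card_le _ hmaps hinj le_rfl) fun _ _ => rfl

/-- The edges between two faces that differ under a face function form a cycle. -/
theorem IsFaceFunction.isEvenCycle [Fintype V] [DecidableRel G.Adj] {R : RotationSystem G}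
    {f : V → V → ZMod 2} (hf : R.IsFaceFunction f) :
    IsEvenCycle G (fun a b => if G.Adj a b then f a b + f b a else 0) where
  symm := by
    intro v w
    simp only [G.adj_comm v w, add_comm]
  supp := by intro v w h; simp [h]
  sum := by
    classical
    intro v
    rw [← Finset.sum_filter, Finset.sum_add_distrib]
    have h2 : ∑ w with G.Adj v w, f w v = ∑ w with G.Adj v w, f v w := by
      rw [← R.sum_next v (f v)]
      exact Finset.sum_congr rfl fun w hw => (hf v w (Finset.mem_filter.mp hw).2).symm
    rw [h2]
    exact CharTwo.add_self_eq_zero _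

theorem IsFaceFunction.eq_of_sameCycle {R : RotationSystem G} {f : V → V → ZMod 2}
    (hf : R.IsFaceFunction f) {d e : G.Dart} (h : R.faceNext.SameCycle d e) :
    f d.fst d.snd = f e.fst e.snd := by
  obtain ⟨g, hg⟩ := R.exists_comp_faceOf (fun d => f d.fst d.snd) (by
    rintro ⟨⟨v, w⟩, hvw⟩
    rw [faceNext_mk]
    exact hf w v hvw.symm)
  rw [← hg, ← hg, (R.faceOf_eq_iff d e).mpr h]

theorem IsFaceFunction.add {R : RotationSystem G} {f g : V → V → ZMod 2}
    (hf : R.IsFaceFunction f) (hg : R.IsFaceFunction g) :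
    R.IsFaceFunction fun a b => f a b + g a b :=
  fun v w h => congrArg₂ (· + ·) (hf v w h) (hg v w h)

end RotationSystem

section Insert

variable {V : Type u} {G : SimpleGraph V}

theorem sup_edge_adj {u v : V} (huv : u ≠ v) (a b : V) :
    (G ⊔ SimpleGraph.edge u v).Adj a b ↔ G.Adj a b ∨ (a = u ∧ b = v) ∨ (a = v ∧ b = u) := by
  simp only [SimpleGraph.sup_adj, SimpleGraph.edge_adj]
  constructor
  · rintro (h | ⟨h, -⟩)
    · exact .inl h
    · tauto
  · rintro (h | ⟨rfl, rfl⟩ | ⟨rfl, rfl⟩)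
    · exact .inl h
    · exact .inr ⟨.inl ⟨rfl, rfl⟩, huv⟩
    · exact .inr ⟨.inr ⟨rfl, rfl⟩, huv.symm⟩

/-- `p` is a place in the rotation at `u` after which the new neighbour `v` can be inserted. At an
isolated vertex, the only place is after `v` itself. -/
def IsSlot (G : SimpleGraph V) (u v p : V) : Prop :=
  G.Adj u p ∨ (p = v ∧ ∀ b, ¬ G.Adj u b)

theorem exists_isSlot (G : SimpleGraph V) (u v : V) : ∃ p, IsSlot G u v p := by
  by_cases h : ∃ b, G.Adj u b
  · obtain ⟨b, hb⟩ := h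
    exact ⟨b, .inl hb⟩
  · push Not at h
    exact ⟨v, .inr ⟨rfl, h⟩⟩

open Classical in
/-- The rotations after insertion of an edge `uv`, at `u` after `p` and at `v` after `q`. -/
noncomputable def insertNext (n : V → V → V) (u v p q a b : V) : V :=
  if a = u then (if b = p then v else if b = v then n u p else n u b)
  else if a = v then (if b = q then u else if b = u then n v q else n v b)
  else n a b

theorem exists_insert [Finite V] (R : RotationSystem G) {u v p q : V} (huv : u ≠ v)
    (hadj : ¬ G.Adj u v) (hp : IsSlot G u v p) (hq : IsSlot G v u q) :
    ∃ R' : RotationSystem (G ⊔ SimpleGraph.edge u v),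
      ∀ a b, (G ⊔ SimpleGraph.edge u v).Adj a b → R'.next a b = insertNext R.next u v p q a b := by
  classical
  have hreach : ∀ a b c, (G ⊔ SimpleGraph.edge u v).Adj a b → (G ⊔ SimpleGraph.edge u v).Adj a c →
      Relation.ReflTransGen (fun x y => y = insertNext R.next u v p q a x) b c := by
    intro a b c hab hac
    rw [sup_edge_adj huv] at hab hac
    unfold insertNext
    by_cases hau : a = u
    · subst hau
      simp only [if_true]
      refine reaches_insert (G.Adj a) (R.next a) v p (fun _ h => R.adj_next h)
        (fun _ _ h h' => R.reaches_next h h') hadj hp b c ?_ ?_ <;> tauto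
    · by_cases hav : a = v
      · subst hav
        simp only [hau, if_true, if_false]
        refine reaches_insert (G.Adj a) (R.next a) u q (fun _ h => R.adj_next h)
          (fun _ _ h h' => R.reaches_next h h') (fun h => hadj h.symm) hq b c ?_ ?_ <;> tauto
      · simp only [hau, hav, if_false]
        exact R.reaches_next (by tauto) (by tauto)
  refine RotationSystem.exists_of_next _ ?_ hreach
  intro a b hab
  rw [sup_edge_adj huv] at hab ⊢
  unfold insertNext
  rcases hp with hp | ⟨rfl, hp⟩ <;> rcases hq with hq | ⟨rfl, hq⟩ <;> split_ifs <;> subst_vars <;>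
    first
    | exact .inl (R.adj_next hp)
    | exact .inl (R.adj_next hq)
    | (refine .inl (R.adj_next ?_); tauto)
    | tauto

open Classical in
/-- A face function extends to the new edge, with the same value on both sides, if it has that
value on the faces into which the edge is inserted. -/
theorem isFaceFunction_insert {R : RotationSystem G} {u v p q : V} (huv : u ≠ v)
    (hadj : ¬ G.Adj u v) (hp : IsSlot G u v p) (hq : IsSlot G v u q)
    {R' : RotationSystem (G ⊔ SimpleGraph.edge u v)}
    (hR' : ∀ a b, (G ⊔ SimpleGraph.edge u v).Adj a b →
      R'.next a b = insertNext R.next u v p q a b)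
    {f : V → V → ZMod 2} (hf : R.IsFaceFunction f) (c : ZMod 2)
    (hcp : G.Adj u p → f p u = c) (hcq : G.Adj v q → f q v = c) :
    R'.IsFaceFunction fun a b => if (a = u ∧ b = v) ∨ (a = v ∧ b = u) then c else f a b := by
  have hvu : v ≠ u := huv.symm
  have hadj' : ¬ G.Adj v u := fun h => hadj h.symm
  intro a b hab
  rw [hR' a b hab]
  rw [sup_edge_adj huv] at hab
  have hside : ∀ {u v p : V}, u ≠ v → ¬ G.Adj u v → IsSlot G u v p →
      (G.Adj u p → f p u = c) → ∀ b, (G.Adj u b ∨ b = v) →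
      (if (if b = p then v else if b = v then R.next u p else R.next u b) = v then c else
        f u (if b = p then v else if b = v then R.next u p else R.next u b)) =
      if b = v then c else f b u := by
    intro u v p huv hadj hp hcp b hb
    have hnv : ∀ x, G.Adj u x → R.next u x ≠ v := fun x hx e => hadj (e ▸ R.adj_next hx)
    by_cases hbp : b = p
    · subst hbp
      by_cases hbv : b = v
      · simp [hbv]
      · simp [hbv, hcp (hb.resolve_right hbv)]
    · by_cases hbv : b = v
      · subst hbv
        have hp' : G.Adj u p := by
          rcases hp with hp | ⟨rfl, -⟩
          · exact hp
          · exact (hbp rfl).elim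
        simp [hbp, hnv p hp', hf u p hp', hcp hp']
      · have hb' := hb.resolve_right hbv
        simp [hbp, hbv, hnv b hb', hf u b hb']
  by_cases hau : a = u
  · subst hau
    have := hside huv hadj hp hcp b (by tauto)
    simpa [insertNext, huv, hvu] using this
  · by_cases hav : a = v
    · subst hav
      have := hside hvu hadj' hq hcq b (by tauto)
      simpa [insertNext, huv, hvu] using this
    · have hab' : G.Adj a b := by tauto
      simp [insertNext, hau, hav, hf a b hab']

/-- A cycle that does not use the new edge is a cycle of the old graph. -/
theorem IsEvenCycle.of_insert [Fintype V] {u v : V} (huv : u ≠ v) {z : V → V → ZMod 2}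
    (hz : IsEvenCycle (G ⊔ SimpleGraph.edge u v) z) (h0 : z u v = 0) : IsEvenCycle G z where
  symm := hz.symm
  sum := hz.sum
  supp := by
    intro a b hab
    by_cases h : (a = u ∧ b = v) ∨ (a = v ∧ b = u)
    · rcases h with ⟨rfl, rfl⟩ | ⟨rfl, rfl⟩
      · exact h0
      · rw [hz.symm, h0]
    · refine hz.supp a b ?_
      rw [sup_edge_adj huv]
      tauto

open Classical in
theorem exists_faceFunction_insert [Fintype V] {R : RotationSystem G} (hR : R.IsExact)
    {u v p q : V} (huv : u ≠ v)
    (hadj : ¬ G.Adj u v) (hp : IsSlot G u v p) (hq : IsSlot G v u q)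
    {R' : RotationSystem (G ⊔ SimpleGraph.edge u v)}
    (hR' : ∀ a b, (G ⊔ SimpleGraph.edge u v).Adj a b →
      R'.next a b = insertNext R.next u v p q a b)
    (hval : ∀ f, R.IsFaceFunction f → ∃ f', R.IsFaceFunction f' ∧ ∃ c,
      (G.Adj u p → f' p u = c) ∧ (G.Adj v q → f' q v = c) ∧
      ∀ a b, G.Adj a b → f' a b + f' b a = f a b + f b a)
    {z : V → V → ZMod 2} (hz : IsEvenCycle (G ⊔ SimpleGraph.edge u v) z) (h0 : z u v = 0) :
    ∃ f, R'.IsFaceFunction f ∧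
      ∀ a b, (G ⊔ SimpleGraph.edge u v).Adj a b → f a b + f b a = z a b := by
  obtain ⟨f, hf, hfz⟩ := hR z (hz.of_insert huv h0)
  obtain ⟨f', hf', c, hcp, hcq, hff⟩ := hval f hf
  refine ⟨_, isFaceFunction_insert huv hadj hp hq hR' hf' c hcp hcq, ?_⟩
  intro a b hab
  rw [sup_edge_adj huv] at hab
  by_cases h : (a = u ∧ b = v) ∨ (a = v ∧ b = u)
  · have h' : (b = u ∧ a = v) ∨ (b = v ∧ a = u) := by tauto
    simp only [h, h', if_true]
    rw [CharTwo.add_self_eq_zero]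
    rcases h with ⟨rfl, rfl⟩ | ⟨rfl, rfl⟩
    · exact h0.symm
    · rw [hz.symm, h0]
  · have h' : ¬ ((b = u ∧ a = v) ∨ (b = v ∧ a = u)) := by tauto
    simp only [h, h', if_false]
    have hab' : G.Adj a b := by tauto
    rw [hff a b hab', hfz a b hab']

/-- An edge may be inserted between two vertices of a common face: the new edge splits that face,
and the boundary of one of the two parts is a cycle through the new edge. -/
theorem isPlanarGraph_insert_of_sameCycle [Finite V] {R : RotationSystem G} (hR : R.IsPlanar)
    {u v p q : V} (huv : u ≠ v) (hadj : ¬ G.Adj u v) (hp : G.Adj p u) (hq : G.Adj q v)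
    (hcyc : R.faceNext.SameCycle ⟨(p, u), hp⟩ ⟨(q, v), hq⟩) :
    IsPlanarGraph (G ⊔ SimpleGraph.edge u v) := by
  classical
  cases nonempty_fintype V
  rw [R.isPlanar_iff_isExact] at hR
  have hvu : v ≠ u := huv.symm
  have hadj' : ¬ G.Adj v u := fun h => hadj h.symm
  obtain ⟨R', hR'⟩ := exists_insert R huv hadj (.inl hp.symm) (.inl hq.symm)
  refine isPlanarGraph_iff.mpr ⟨R', ?_⟩
  have hzero : ∀ z, IsEvenCycle (G ⊔ SimpleGraph.edge u v) z → z u v = 0 →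
      ∃ f, R'.IsFaceFunction f ∧
        ∀ a b, (G ⊔ SimpleGraph.edge u v).Adj a b → f a b + f b a = z a b := fun z hz h0 =>
    exists_faceFunction_insert hR huv hadj (.inl hp.symm) (.inl hq.symm) hR'
      (fun f hf => ⟨f, hf, f p u, fun _ => rfl, fun _ => (hf.eq_of_sameCycle hcyc).symm,
        fun _ _ _ => rfl⟩) hz h0
  have hcyc' : R.faceNext.SameCycle (R.faceNext ⟨(p, u), hp⟩) (R.faceNext ⟨(q, v), hq⟩) :=
    Equiv.Perm.sameCycle_apply_left.mpr (Equiv.Perm.sameCycle_apply_right.mpr hcyc)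
  obtain ⟨S, hS1, hS2, hS3, hS4, hS5⟩ := exists_arc R.faceNext hcyc' (by
    rw [R.faceNext_mk, R.faceNext_mk]
    intro e
    exact huv (congrArg (fun d : G.Dart => d.fst) e))
  let g : V → V → ZMod 2 := fun a b =>
    if a = v ∧ b = u then 1 else if ∃ h : G.Adj a b, (⟨(a, b), h⟩ : G.Dart) ∈ S then 1 else 0
  have hg1 : g v u = 1 := by simp [g]
  have hg0 : g u v = 0 := by simp [g, huv, hadj]
  have hgS : ∀ a b (h : G.Adj a b), g a b = if (⟨(a, b), h⟩ : G.Dart) ∈ S then 1 else 0 := by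
    intro a b h
    have : ¬ (a = v ∧ b = u) := by
      rintro ⟨rfl, rfl⟩
      exact hadj' h
    simp only [g, this, if_false, h, exists_true_left]
  have hgnext : ∀ a b (h : G.Adj a b), ¬ (a = u ∧ b = p) → ¬ (a = v ∧ b = q) →
      g a (R.next a b) = g b a := by
    intro a b h h1 h2
    rw [hgS _ _ (R.adj_next h), hgS _ _ h.symm]
    have := hS5 ⟨(b, a), h.symm⟩
      (fun e => h1 (by simpa [and_comm] using R.faceNext.injective e))
      (fun e => h2 (by simpa [and_comm] using R.faceNext.injective e))
    rw [R.faceNext_mk] at this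
    simp only [this]
  have hgu : g u (R.next u p) = 1 := by
    rw [hgS _ _ (R.adj_next hp.symm)]
    rw [R.faceNext_mk] at hS1
    simp [hS1]
  have hgp : g p u = 0 := by
    rw [hgS _ _ hp]
    simp [hS3 _ rfl]
  have hgv : g v (R.next v q) = 0 := by
    rw [hgS _ _ (R.adj_next hq.symm)]
    rw [R.faceNext_mk] at hS2
    simp [hS2]
  have hgq : g q v = 1 := by
    rw [hgS _ _ hq]
    simp [hS4 _ rfl]
  have hg : R'.IsFaceFunction g := by
    intro a b hab
    rw [hR' a b hab]
    rw [sup_edge_adj huv] at hab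
    have hpv : v ≠ p := fun h => hadj (h ▸ hp.symm)
    have hqu : u ≠ q := fun h => hadj (h ▸ hq)
    by_cases hau : a = u
    · subst hau
      simp only [insertNext, if_true]
      by_cases hbp : b = p
      · subst hbp; simp [hg0, hgp]
      · by_cases hbv : b = v
        · subst hbv; simp [hpv, hg1, hgu]
        · simp only [hbp, hbv, if_false]
          exact hgnext a b (by tauto) (by tauto) (by tauto)
    · by_cases hav : a = v
      · subst hav
        simp only [insertNext, hau, if_true, if_false]
        by_cases hbp : b = q
        · subst hbp; simp [hg1, hgq]
        · by_cases hbv : b = u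
          · subst hbv; simp [hqu, hg0, hgv]
          · simp only [hbp, hbv, if_false]
            exact hgnext a b (by tauto) (by tauto) (by tauto)
      · simp only [insertNext, hau, hav, if_false]
        exact hgnext a b (by tauto) (by tauto) (by tauto)
  intro z hz
  by_cases h0 : z u v = 0
  · exact hzero z hz h0
  · have h1 : z u v = 1 := by
      have : ∀ x : ZMod 2, x ≠ 0 → x = 1 := by decide
      exact this _ h0
    have hy := hg.isEvenCycle
    have huv' : (G ⊔ SimpleGraph.edge u v).Adj u v := by rw [sup_edge_adj huv]; tauto
    obtain ⟨f, hf, hfz⟩ := hzero (fun a b => z a b +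
        if (G ⊔ SimpleGraph.edge u v).Adj a b then g a b + g b a else 0)
      { symm := fun a b => by rw [hz.symm, hy.symm]
        supp := fun a b hab => by rw [hz.supp a b hab, hy.supp a b hab, add_zero]
        sum := fun a => by rw [Finset.sum_add_distrib, hz.sum, hy.sum, add_zero] }
      (by simp only [huv', if_true, h1, hg0, hg1]; decide)
    refine ⟨_, hf.add hg, ?_⟩
    intro a b hab
    have h2 := hfz a b hab
    simp only [hab, if_true] at h2
    have : f a b + g a b + (f b a + g b a) = (f a b + f b a) + (g a b + g b a) := by ring
    rw [this, h2, add_assoc, CharTwo.add_self_eq_zero, add_zero]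

theorem sum_sum_eq_zero_of_symm {V : Type u} [DecidableEq V] (C : Finset V) (z : V → V → ZMod 2)
    (hsymm : ∀ a b, z a b = z b a) (hdiag : ∀ a, z a a = 0) : ∑ a ∈ C, ∑ b ∈ C, z a b = 0 := by
  rw [← Finset.sum_product']
  refine Finset.sum_involution (fun x _ => x.swap) ?_ ?_ ?_ ?_
  · rintro ⟨a, b⟩ -
    change z a b + z b a = 0
    rw [hsymm a b]
    exact CharTwo.add_self_eq_zero _
  · rintro ⟨a, b⟩ - hab e
    obtain rfl : b = a := congrArg Prod.fst e
    exact hab (hdiag _)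
  · rintro ⟨a, b⟩ h
    simp only [Finset.mem_product, Prod.fst_swap, Prod.snd_swap] at h ⊢
    exact h.symm
  · rintro ⟨a, b⟩ -
    rfl

/-- A bridge lies on no cycle. -/
theorem IsEvenCycle.eq_zero_of_not_reachable [Fintype V] {u v : V} (huv : ¬ G.Reachable u v)
    {z : V → V → ZMod 2} (hz : IsEvenCycle (G ⊔ SimpleGraph.edge u v) z) : z u v = 0 := by
  classical
  have hne : u ≠ v := by rintro rfl; exact huv (SimpleGraph.Reachable.refl _)
  let C : Finset V := Finset.univ.filter fun a => G.Reachable u a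
  have hC : ∀ a, a ∈ C ↔ G.Reachable u a := fun a => by simp [C]
  have h1 : ∑ a ∈ C, ∑ b, z a b = 0 := Finset.sum_eq_zero fun a _ => hz.sum a
  have h2 : ∑ a ∈ C, ∑ b ∈ C, z a b = 0 :=
    sum_sum_eq_zero_of_symm C z hz.symm fun a => hz.supp a a (SimpleGraph.irrefl _)
  have h3 : ∀ a ∈ C, ∑ b, z a b = ∑ b ∈ C, z a b + ∑ b ∈ Cᶜ, z a b := fun a _ =>
    (Finset.sum_add_sum_compl C _).symm
  rw [Finset.sum_congr rfl h3, Finset.sum_add_distrib, h2, zero_add] at h1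
  rw [← h1]
  symm
  have hz0 : ∀ a ∈ C, ∀ b ∈ Cᶜ, ¬ (a = u ∧ b = v) → z a b = 0 := by
    intro a ha b hb hab
    refine hz.supp a b ?_
    rw [sup_edge_adj hne]
    rw [Finset.mem_compl, hC] at hb
    rw [hC] at ha
    rintro (h | h | ⟨rfl, rfl⟩)
    · exact hb (ha.trans h.reachable)
    · exact hab h
    · exact huv ha
  rw [Finset.sum_eq_single u, Finset.sum_eq_single v]
  · intro b hb hbv
    exact hz0 u ((hC u).mpr (SimpleGraph.Reachable.refl _)) b hb (by tauto)
  · intro h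
    exact (h (by rw [Finset.mem_compl, hC]; exact huv)).elim
  · intro a ha hau
    exact Finset.sum_eq_zero fun b hb => hz0 a ha b hb (by tauto)
  · intro h
    exact (h ((hC u).mpr (SimpleGraph.Reachable.refl _))).elim

/-- An edge may be inserted between two components. -/
theorem isPlanarGraph_insert_of_not_reachable [Finite V] (hG : IsPlanarGraph G)
    {u v : V} (huv : ¬ G.Reachable u v) : IsPlanarGraph (G ⊔ SimpleGraph.edge u v) := by
  classical
  cases nonempty_fintype V
  obtain ⟨R, hR⟩ := isPlanarGraph_iff.mp hG
  have hne : u ≠ v := by rintro rfl; exact huv (SimpleGraph.Reachable.refl _)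
  have hadj : ¬ G.Adj u v := fun h => huv h.reachable
  obtain ⟨p, hp⟩ := exists_isSlot G u v
  obtain ⟨q, hq⟩ := exists_isSlot G v u
  obtain ⟨R', hR'⟩ := exists_insert R hne hadj hp hq
  refine isPlanarGraph_iff.mpr ⟨R', fun z hz => ?_⟩
  refine exists_faceFunction_insert hR hne hadj hp hq hR' ?_ hz (hz.eq_zero_of_not_reachable huv)
  intro f hf
  refine ⟨fun a b => f a b + if G.Reachable v a then f q v + f p u else 0, ?_, f p u, ?_, ?_, ?_⟩
  · intro a b hab
    have : G.Reachable v a ↔ G.Reachable v b :=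
      ⟨fun h => h.trans hab.reachable, fun h => h.trans hab.symm.reachable⟩
    simp only [hf a b hab, this]
  · intro h
    have : ¬ G.Reachable v p := fun h' => huv (h'.trans h.symm.reachable).symm
    simp [this]
  · intro h
    simp only [h.reachable, if_true]
    rw [← add_assoc, CharTwo.add_self_eq_zero, zero_add]
  · intro a b hab
    have : G.Reachable v a ↔ G.Reachable v b :=
      ⟨fun h => h.trans hab.reachable, fun h => h.trans hab.symm.reachable⟩
    simp only [this]
    generalize (if G.Reachable v b then f q v + f p u else 0) = t
    have h2 : f a b + t + (f b a + t) = f a b + f b a + (t + t) := by ring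
    rw [h2, CharTwo.add_self_eq_zero, add_zero]

end Insert

/-! ### Faces and edges of planar triangulations -/

section Triangle

variable {V : Type u} {G : SimpleGraph V}

open Classical in
/-- The edges of the triangle on `a`, `b`, `c`, as a function modulo two. -/
noncomputable def triangleCycle (a b c v w : V) : ZMod 2 :=
  if v ≠ w ∧ v ∈ ({a, b, c} : Set V) ∧ w ∈ ({a, b, c} : Set V) then 1 else 0

theorem triangleCycle_eq_zero_left {a b c v : V} (h : v ∉ ({a, b, c} : Set V)) (w : V) :
    triangleCycle a b c v w = 0 := by
  simp [triangleCycle, h]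

theorem triangleCycle_eq_zero_right {a b c w : V} (h : w ∉ ({a, b, c} : Set V)) (v : V) :
    triangleCycle a b c v w = 0 := by
  simp [triangleCycle, h]

theorem triangleCycle_eq_one {a b c v w : V} (hvw : v ≠ w) (hv : v ∈ ({a, b, c} : Set V))
    (hw : w ∈ ({a, b, c} : Set V)) : triangleCycle a b c v w = 1 :=
  if_pos ⟨hvw, hv, hw⟩

theorem isEvenCycle_triangleCycle [Fintype V] {a b c : V} (h : IsTriangle G a b c) :
    IsEvenCycle G (triangleCycle a b c) where
  symm := by
    intro v w
    unfold triangleCycle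
    congr 1
    apply propext
    tauto
  supp := by
    intro v w hvw
    refine if_neg ?_
    obtain ⟨h1, h2, h3⟩ := h
    rintro ⟨hne, rfl | rfl | rfl, rfl | rfl | rfl⟩ <;>
      first
      | exact hne rfl
      | exact hvw ‹_›
      | exact hvw (SimpleGraph.Adj.symm ‹_›)
  sum := by
    classical
    intro v
    obtain ⟨h1, h2, h3⟩ := h
    have h1 := h1.ne
    have h2 := h2.ne
    have h3 := h3.ne
    by_cases hv : v ∈ ({a, b, c} : Set V)
    · unfold triangleCycle
      rw [← Finset.sum_filter]
      have key : ∃ x y, x ≠ y ∧ Finset.univ.filter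
          (fun w => v ≠ w ∧ v ∈ ({a, b, c} : Set V) ∧ w ∈ ({a, b, c} : Set V)) = {x, y} := by
        rcases hv with rfl | rfl | rfl
        · refine ⟨b, c, h2, ?_⟩
          ext w; simp; grind
        · refine ⟨a, c, h3.symm, ?_⟩
          ext w; simp; grind
        · refine ⟨a, b, h1, ?_⟩
          ext w; simp; grind
      obtain ⟨x, y, hxy, e⟩ := key
      rw [e, Finset.sum_pair hxy]
      decide
    · exact Finset.sum_eq_zero fun w _ => triangleCycle_eq_zero_left hv w

end Triangle

section Triangulation

variable {V : Type u} [Finite V] {T : SimpleGraph V}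

theorem IsPlanarTriangulation.adj_of_isPlanarGraph {V : Type u} {T : SimpleGraph V}
    (hT : IsPlanarTriangulation T) {u v : V} (huv : u ≠ v)
    (h : IsPlanarGraph (T ⊔ SimpleGraph.edge u v)) : T.Adj u v := by
  refine hT.2.2 h le_sup_left ?_
  rw [sup_edge_adj huv]
  tauto

theorem IsPlanarTriangulation.reachable (hT : IsPlanarTriangulation T) (u v : V) :
    T.Reachable u v := by
  by_contra h
  have hne : u ≠ v := by rintro rfl; exact h (SimpleGraph.Reachable.refl _)
  exact h (hT.adj_of_isPlanarGraph hne
    (isPlanarGraph_insert_of_not_reachable hT.2.1 h)).reachable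

/-- Two vertices of a common face are adjacent, since the edge could be added. -/
theorem IsPlanarTriangulation.adj_of_sameCycle (hT : IsPlanarTriangulation T)
    {R : RotationSystem T} (hR : R.IsPlanar) {u v p q : V} (huv : u ≠ v) (hp : T.Adj p u)
    (hq : T.Adj q v) (h : R.faceNext.SameCycle ⟨(p, u), hp⟩ ⟨(q, v), hq⟩) : T.Adj u v := by
  by_contra hadj
  exact hadj (hT.adj_of_isPlanarGraph huv
    (isPlanarGraph_insert_of_sameCycle hR huv hadj hp hq h))

theorem RotationSystem.sameCycle_next {V : Type u} {G : SimpleGraph V} (R : RotationSystem G) {u v p q : V}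
    {hp : G.Adj p u} {hq : G.Adj q v} (h : R.faceNext.SameCycle ⟨(p, u), hp⟩ ⟨(q, v), hq⟩) :
    R.faceNext.SameCycle ⟨(p, u), hp⟩ ⟨(v, R.next v q), R.adj_next hq.symm⟩ := by
  rw [← R.faceNext_mk hq]
  exact Equiv.Perm.sameCycle_apply_right.mpr h

theorem eq_of_next_eq_self {G : SimpleGraph V} (R : RotationSystem G) {v w x : V}
    (hw : G.Adj v w) (hx : G.Adj v x) (h : R.next v w = w) : x = w := by
  obtain ⟨k, rfl⟩ := R.exists_iterate_next hw hx
  exact Function.iterate_fixed h k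

/-- There is no vertex of degree one: such a vertex `v` and the second vertex after it on its face
could be joined by an edge. -/
theorem IsPlanarTriangulation.next_ne_self (hT : IsPlanarTriangulation T)
    {R : RotationSystem T} (hR : R.IsPlanar) {v w : V} (h : T.Adj v w) : R.next v w ≠ w := by
  classical
  intro hfix
  have hc1 : R.faceNext.SameCycle ⟨(w, v), h.symm⟩ ⟨(v, w), h⟩ := by
    have := R.sameCycle_next (Equiv.Perm.SameCycle.refl R.faceNext ⟨(w, v), h.symm⟩)
    simpa only [hfix] using this
  have hc2 := R.sameCycle_next hc1
  have hy := R.adj_next h.symm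
  by_cases hyv : R.next w v = v
  · have hclosed : ∀ a b, T.Reachable a b → (a = v ∨ a = w) → (b = v ∨ b = w) := by
      rintro a b ⟨p⟩
      induction p with
      | nil => exact id
      | cons hab _ ih =>
        rintro (rfl | rfl)
        · exact ih (.inr (eq_of_next_eq_self R h hab hfix))
        · exact ih (.inl (eq_of_next_eq_self R h.symm hab hyv))
    cases nonempty_fintype V
    have h3 := hT.1
    rw [Nat.card_eq_fintype_card, ← Finset.card_univ] at h3
    have h4 : (Finset.univ : Finset V) ⊆ {v, w} := by
      intro x _
      simpa using hclosed v x (hT.reachable v x) (.inl rfl)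
    have h5 := Finset.card_le_card h4
    have h6 : ({v, w} : Finset V).card ≤ 2 := Finset.card_le_two
    omega
  · have := hT.adj_of_sameCycle hR (Ne.symm hyv) h.symm hy hc2
    exact hy.ne (eq_of_next_eq_self R h this hfix).symm

/-- The vertices of the face that begins `u`, `v`, `R.next v u` are only these three. If the face
had a fourth vertex `b`, then `b` would be adjacent to `v`; but the triangle on the first three
vertices bounds a set of faces, and it separates the face from the edge `vb`, since it touches
`v` only in the corner of the face. -/
theorem IsPlanarTriangulation.mem_of_sameCycle (hT : IsPlanarTriangulation T)
    {R : RotationSystem T} (hR : R.IsPlanar) {u v a b : V} (h : T.Adj u v) (hab : T.Adj a b)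
    (hc : R.faceNext.SameCycle ⟨(u, v), h⟩ ⟨(a, b), hab⟩) :
    b ∈ ({u, v, R.next v u} : Set V) := by
  cases nonempty_fintype V
  by_contra hb
  have hvw : T.Adj v (R.next v u) := R.adj_next h.symm
  have hwu : R.next v u ≠ u := hT.next_ne_self hR h.symm
  have hcw := R.sameCycle_next (Equiv.Perm.SameCycle.refl R.faceNext ⟨(u, v), h⟩)
  have hx : ∃ p, ∃ hp : T.Adj u p, R.next u p = v := by
    obtain ⟨k, hk⟩ := R.exists_iterate_next (R.adj_next h) h
    refine ⟨(R.next u)^[k] v, R.adj_next_iterate h k, ?_⟩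
    exact (Function.iterate_succ_apply' (R.next u) k v).symm.trans
      ((Function.iterate_succ_apply _ k v).trans hk)
  obtain ⟨p, hp, hpv⟩ := hx
  have hcp : R.faceNext.SameCycle ⟨(p, u), hp.symm⟩ ⟨(u, v), h⟩ := by
    have := R.sameCycle_next (Equiv.Perm.SameCycle.refl R.faceNext ⟨(p, u), hp.symm⟩)
    simpa only [hpv] using this
  have huw : T.Adj u (R.next v u) := hT.adj_of_sameCycle hR hwu.symm hp.symm hvw (hcp.trans hcw)
  set w := R.next v u with hw
  have hbne : b ≠ u ∧ b ≠ v ∧ b ≠ w := by simpa using hb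
  have hvb : T.Adj v b := hT.adj_of_sameCycle hR hbne.2.1.symm h hab hc
  have htri : IsTriangle T u v w := ⟨h, hvw, huw.symm⟩
  obtain ⟨f, hf, hfz⟩ := R.isPlanar_iff_isExact.mp hR _ (isEvenCycle_triangleCycle htri)
  have hcorner : f v w = f u v := hf v u h.symm
  have hat : ∀ k, (R.next v)^[k] w = w ∨ f v ((R.next v)^[k] w) = f u v + 1 := by
    intro k
    induction k with
    | zero => exact .inl rfl
    | succ k ih =>
      have hy := R.adj_next_iterate hvw k
      rw [Function.iterate_succ_apply']
      generalize (R.next v)^[k] w = y at ih hy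
      have hfy : f y v = f v y + triangleCycle u v w v y := by
        rw [← hfz v y hy, ← add_assoc, CharTwo.add_self_eq_zero, zero_add]
      rcases ih with rfl | ih
      · right
        rw [hf v _ hy, hfy, triangleCycle_eq_one hvw.ne (by simp) (by simp), hcorner]
      · by_cases hyu : y = u
        · left
          rw [hyu]
        · by_cases hyw : y = w
          · right
            rw [hyw] at hfy ⊢
            rw [hf v _ hvw, hfy, triangleCycle_eq_one hvw.ne (by simp) (by simp), hcorner]
          · right
            have hy' : y ∉ ({u, v, w} : Set V) := by
              simp [hyu, hyw, hy.ne']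
            rw [hf v y hy, hfy, triangleCycle_eq_zero_right hy', ih, add_zero]
  have hfvb : f v b = f u v + 1 := by
    obtain ⟨k, hk⟩ := R.exists_iterate_next hvw hvb
    have := hat k
    rw [hk] at this
    exact this.resolve_left hbne.2.2
  have hsymm : ∀ y, T.Adj b y → f b y = f y b := by
    intro y hy
    have := hfz b y hy
    rw [triangleCycle_eq_zero_left hb] at this
    exact CharTwo.add_eq_zero.mp this
  have hconst : ∀ k, f b ((R.next b)^[k] v) = f b v := by
    intro k
    induction k with
    | zero => rfl
    | succ k ih =>
      have hy := R.adj_next_iterate hvb.symm k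
      rw [Function.iterate_succ_apply', hf b _ hy, ← hsymm _ hy, ih]
  obtain ⟨k, hk⟩ := R.exists_iterate_next hvb.symm hab.symm
  have h1 := hconst k
  rw [hk, hsymm a hab.symm, hsymm v hvb.symm, hfvb] at h1
  have h2 : f u v = f a b := hf.eq_of_sameCycle hc
  rw [← h2] at h1
  exact absurd (left_eq_add.mp h1) one_ne_zero

/-- All faces of a planar triangulation are triangles. -/
theorem IsPlanarTriangulation.next_next (hT : IsPlanarTriangulation T)
    {R : RotationSystem T} (hR : R.IsPlanar) {u v : V} (h : T.Adj u v) :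
    R.next (R.next v u) v = u ∧ R.next u (R.next v u) = v := by
  have hc1 := R.sameCycle_next (Equiv.Perm.SameCycle.refl R.faceNext ⟨(u, v), h⟩)
  have hc2 := R.sameCycle_next hc1
  have hc3 := R.sameCycle_next hc2
  have hvw : T.Adj v (R.next v u) := R.adj_next h.symm
  have hwx := R.adj_next hvw.symm
  have hx := hT.mem_of_sameCycle hR h _ hc2
  have h1 : R.next (R.next v u) v = u := by
    rcases hx with hx | hx | hx
    · exact hx
    · exact (hT.next_ne_self hR hvw.symm hx).elim
    · rw [hx] at hwx
      exact (SimpleGraph.irrefl _ hwx).elim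
  refine ⟨h1, ?_⟩
  have hwu : T.Adj (R.next v u) u := by simpa only [h1] using hwx
  have hy := hT.mem_of_sameCycle hR h _ hc3
  rw [h1] at hy
  have huy := R.adj_next hwu.symm
  rcases hy with hy | hy | hy
  · rw [hy] at huy
    exact (SimpleGraph.irrefl _ huy).elim
  · exact hy
  · exact (hT.next_ne_self hR hwu.symm hy).elim

theorem IsPlanarTriangulation.boundsFace (hT : IsPlanarTriangulation T)
    {R : RotationSystem T} (hR : R.IsPlanar) {u v : V} (h : T.Adj u v) :
    R.BoundsFace u v (R.next v u) := by
  obtain ⟨h1, h2⟩ := hT.next_next hR h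
  have hvw : T.Adj v (R.next v u) := R.adj_next h.symm
  have hwu : T.Adj (R.next v u) u := by simpa only [h1] using R.adj_next hvw.symm
  refine ⟨h, hvw, hwu, R.faceNext_mk h, ?_, ?_⟩
  · rw [R.faceNext_mk]; simp only [h1]
  · rw [R.faceNext_mk]; simp only [h2]

theorem IsPlanarTriangulation.exists_adj (hT : IsPlanarTriangulation T) (v : V) :
    ∃ w, T.Adj v w := by
  have : Nontrivial V := Finite.one_lt_card_iff_nontrivial.mp (by have := hT.1; omega)
  obtain ⟨x, hx⟩ := exists_ne v
  obtain ⟨p⟩ := hT.reachable v x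
  cases p with
  | nil => exact (hx rfl).elim
  | cons h _ => exact ⟨_, h⟩

theorem RotationSystem.IsFacialTriangle.isTriangle {V : Type u} {G : SimpleGraph V}
    {R : RotationSystem G} {a b c : V} (h : R.IsFacialTriangle a b c) : IsTriangle G a b c := by
  rcases h with ⟨h1, h2, h3, -⟩ | ⟨h1, h2, h3, -⟩
  · exact ⟨h1, h2, h3⟩
  · exact ⟨h3.symm, h2.symm, h1.symm⟩

theorem IsPlanarTriangulation.three_mul_card_face (hT : IsPlanarTriangulation T)
    {R : RotationSystem T} (hR : R.IsPlanar) :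
    3 * Nat.card R.Face = 2 * Nat.card T.edgeSet := by
  classical
  cases nonempty_fintype V
  cases nonempty_fintype R.Face
  let _ : Fintype T.Dart := Fintype.ofFinite _
  have h2 : Fintype.card T.Dart = 2 * Nat.card T.edgeSet := by
    rw [← SimpleGraph.coe_edgeFinset, Nat.card_coe_set_eq, Set.ncard_coe_finset]
    convert T.dart_card_eq_twice_card_edges
  rw [← h2, ← Finset.card_univ, Nat.card_eq_fintype_card,
    Finset.card_eq_sum_card_fiberwise (f := R.faceOf) (t := Finset.univ) (fun _ _ => by simp)]
  have h3 : ∀ F ∈ (Finset.univ : Finset R.Face),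
      (Finset.univ.filter fun d => R.faceOf d = F).card = 3 := by
    intro F _
    obtain ⟨⟨⟨u, v⟩, h⟩, rfl⟩ := R.faceOf_surjective F
    obtain ⟨huv, hvw, hwu, e1, e2, e3⟩ := hT.boundsFace hR h
    have huv : T.Adj u v := h
    generalize R.next v u = w at *
    rw [Finset.card_eq_three]
    refine ⟨⟨(u, v), h⟩, ⟨(v, w), hvw⟩, ⟨(w, u), hwu⟩, ?_, ?_, ?_, ?_⟩
    · intro e; exact huv.ne (congrArg (fun d : T.Dart => d.fst) e)
    · intro e; exact hwu.ne' (congrArg (fun d : T.Dart => d.fst) e)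
    · intro e; exact hvw.ne (congrArg (fun d : T.Dart => d.fst) e)
    · ext d
      simp only [Finset.mem_filter, Finset.mem_univ, true_and, Finset.mem_insert,
        Finset.mem_singleton]
      constructor
      · intro hd
        obtain ⟨k, hk⟩ := ((R.faceOf_eq_iff _ _).mp hd.symm).exists_nat_pow_eq
        rw [← hk]
        clear hk
        induction k with
        | zero => exact .inl rfl
        | succ k ih =>
          rw [pow_succ', Equiv.Perm.mul_apply]
          rcases ih with ih | ih | ih <;> rw [ih]
          · exact .inr (.inl e1)
          · exact .inr (.inr e2)
          · exact .inl e3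
      · rintro (rfl | rfl | rfl)
        · rfl
        · rw [← e1, R.faceOf_faceNext]
        · rw [← e2, R.faceOf_faceNext, ← e1, R.faceOf_faceNext]
  rw [Finset.sum_congr rfl h3, Finset.sum_const, smul_eq_mul, Finset.card_univ, mul_comm]

theorem IsPlanarTriangulation.card_edgeSet (hT : IsPlanarTriangulation T) :
    Nat.card T.edgeSet + 6 = 3 * Nat.card V := by
  obtain ⟨R, hR⟩ := hT.2.1
  have h1 := hT.three_mul_card_face hR
  have h2 : Nat.card {v : V // ∀ w : V, ¬ T.Adj v w} = 0 := by
    have : IsEmpty {v : V // ∀ w : V, ¬ T.Adj v w} := by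
      refine ⟨fun ⟨v, hv⟩ => ?_⟩
      obtain ⟨w, hw⟩ := hT.exists_adj v
      exact hv w hw
    exact Nat.card_of_isEmpty
  have h3 : Nat.card T.ConnectedComponent = 1 := by
    rw [Nat.card_eq_one_iff_unique]
    refine ⟨⟨fun a b => ?_⟩, ?_⟩
    · induction a using SimpleGraph.ConnectedComponent.ind with | _ v =>
      induction b using SimpleGraph.ConnectedComponent.ind with | _ w =>
      exact SimpleGraph.ConnectedComponent.sound (hT.reachable v w)
    · have : Nonempty V := (Nat.card_pos_iff.mp (by have := hT.1; omega)).1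
      exact ⟨T.connectedComponentMk this.some⟩
  unfold RotationSystem.IsPlanar RotationSystem.numFacialWalks at hR
  omega

/-- Every planar graph on at least three vertices is a spanning subgraph of a triangulation. -/
theorem IsPlanarGraph.exists_triangulation {G : SimpleGraph V} (hG : IsPlanarGraph G)
    (h3 : 3 ≤ Nat.card V) : ∃ T : SimpleGraph V, G ≤ T ∧ IsPlanarTriangulation T := by
  obtain ⟨T, hGT, hT⟩ := (Set.toFinite {T : SimpleGraph V | IsPlanarGraph T}).exists_le_maximal hG
  exact ⟨T, hGT, h3, hT⟩

theorem IsPlanarGraph.card_edgeSet_le {G : SimpleGraph V} (hG : IsPlanarGraph G)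
    (h3 : 3 ≤ Nat.card V) : Nat.card G.edgeSet + 6 ≤ 3 * Nat.card V := by
  obtain ⟨T, hGT, hT⟩ := hG.exists_triangulation h3
  have h1 := hT.card_edgeSet
  have h2 : Nat.card G.edgeSet ≤ Nat.card T.edgeSet :=
    Nat.card_mono (Set.toFinite _) (SimpleGraph.edgeSet_mono hGT)
  omega

theorem IsPlanarGraph.isPlanarTriangulation {G : SimpleGraph V} (hG : IsPlanarGraph G)
    (h3 : 3 ≤ Nat.card V) (hcard : 3 * Nat.card V ≤ Nat.card G.edgeSet + 6) :
    IsPlanarTriangulation G := by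
  obtain ⟨T, hGT, hT⟩ := hG.exists_triangulation h3
  have h1 := hT.card_edgeSet
  have h2 : G.edgeSet = T.edgeSet := by
    refine Set.eq_of_subset_of_ncard_le (SimpleGraph.edgeSet_mono hGT) ?_ (Set.toFinite _)
    rw [← Nat.card_coe_set_eq, ← Nat.card_coe_set_eq]
    omega
  rwa [SimpleGraph.edgeSet_inj.mp h2]

end Triangulation

/-! ### Separating triangles -/

/-- The vertex sets `A` and `B` cover the graph `G`, overlap in the triangle on `a`, `b`, `c`, and
no edge joins `A \ B` to `B \ A`. -/
structure IsTriangleSeparation {V : Type u} (G : SimpleGraph V) (A B : Set V) (a b c : V) :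
    Prop where
  isTriangle : IsTriangle G a b c
  cover : A ∪ B = Set.univ
  inter : A ∩ B = {a, b, c}
  edge : ∀ x y, G.Adj x y → (x ∈ A ∧ y ∈ A) ∨ (x ∈ B ∧ y ∈ B)

namespace IsTriangleSeparation

variable {V : Type u} {G : SimpleGraph V} {A B : Set V} {a b c : V}

theorem symm (h : IsTriangleSeparation G A B a b c) : IsTriangleSeparation G B A a b c where
  isTriangle := h.isTriangle
  cover := by rw [Set.union_comm, h.cover]
  inter := by rw [Set.inter_comm, h.inter]
  edge := fun x y hxy => (h.edge x y hxy).symm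

theorem mem_inter (h : IsTriangleSeparation G A B a b c) {x : V}
    (hx : x ∈ ({a, b, c} : Set V)) : x ∈ A ∧ x ∈ B := by
  rwa [← h.inter] at hx

theorem mem_or (h : IsTriangleSeparation G A B a b c) (x : V) : x ∈ A ∨ x ∈ B := by
  rw [← Set.mem_union, h.cover]
  trivial

theorem triangle_mem (h : IsTriangleSeparation G A B a b c) {x y z : V}
    (hxyz : IsTriangle G x y z) : (x ∈ A ∧ y ∈ A ∧ z ∈ A) ∨ (x ∈ B ∧ y ∈ B ∧ z ∈ B) := by
  have h1 := h.edge _ _ hxyz.1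
  have h2 := h.edge _ _ hxyz.2.1
  have h3 := h.edge _ _ hxyz.2.2
  tauto

theorem ncard_inter (h : IsTriangleSeparation G A B a b c) : (A ∩ B).ncard = 3 := by
  rw [h.inter, Set.ncard_eq_three]
  obtain ⟨h1, h2, h3⟩ := h.isTriangle
  exact ⟨a, b, c, h1.ne, h3.ne', h2.ne, rfl⟩

end IsTriangleSeparation

theorem card_edgeSet_induce {V : Type u} (G : SimpleGraph V) (A : Set V) :
    Nat.card (G.induce A).edgeSet = {e ∈ G.edgeSet | ∀ v ∈ e, v ∈ A}.ncard := by
  have : {e ∈ G.edgeSet | ∀ v ∈ e, v ∈ A} =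
      Sym2.map (Subtype.val : A → V) '' (G.induce A).edgeSet := by
    ext e
    induction e with | _ x y =>
    simp only [Set.mem_ofPred_eq, SimpleGraph.mem_edgeSet, Sym2.mem_iff, Set.mem_image]
    constructor
    · rintro ⟨h, hA⟩
      exact ⟨s(⟨x, hA x (.inl rfl)⟩, ⟨y, hA y (.inr rfl)⟩), h, rfl⟩
    · rintro ⟨e, he, h⟩
      induction e with | _ x' y' =>
      rw [Sym2.map_mk, Sym2.eq_iff] at h
      have he' : G.Adj x' y' := he
      rcases h with ⟨rfl, rfl⟩ | ⟨rfl, rfl⟩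
      · exact ⟨he', by rintro v (rfl | rfl); exacts [x'.2, y'.2]⟩
      · exact ⟨he'.symm, by rintro v (rfl | rfl); exacts [y'.2, x'.2]⟩
  rw [this, Set.ncard_image_of_injective _ (Sym2.map.injective Subtype.val_injective),
    Nat.card_coe_set_eq]

/-- Cutting a triangulation along a triangle leaves two triangulations: the bound on the number of
edges of planar graphs has to be attained on both sides. -/
theorem IsTriangleSeparation.isPlanarTriangulation {V : Type u} [Finite V] {T : SimpleGraph V}
    {A B : Set V} {a b c : V} (h : IsTriangleSeparation T A B a b c)
    (hT : IsPlanarTriangulation T) : IsPlanarTriangulation (T.induce A) := by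
  have hpl : ∀ S : Set V, IsPlanarGraph (T.induce S) := fun S =>
    hT.2.1.of_injective Subtype.val Subtype.val_injective fun _ _ h => h
  have h3 : 3 ≤ A.ncard := by
    rw [← h.ncard_inter]; exact Set.ncard_le_ncard Set.inter_subset_left
  have h3' : 3 ≤ B.ncard := by
    rw [← h.ncard_inter]; exact Set.ncard_le_ncard Set.inter_subset_right
  rw [← Nat.card_coe_set_eq] at h3 h3'
  have hv := Set.ncard_union_add_ncard_inter A B
  rw [h.cover, h.ncard_inter, Set.ncard_univ, ← Nat.card_coe_set_eq, ← Nat.card_coe_set_eq] at hv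
  have he := Set.ncard_union_add_ncard_inter
    {e ∈ T.edgeSet | ∀ v ∈ e, v ∈ A} {e ∈ T.edgeSet | ∀ v ∈ e, v ∈ B}
  have e1 : {e ∈ T.edgeSet | ∀ v ∈ e, v ∈ A} ∪ {e ∈ T.edgeSet | ∀ v ∈ e, v ∈ B} = T.edgeSet := by
    ext e
    induction e with | _ x y =>
    have := h.edge x y
    simp only [Set.mem_union, Set.mem_ofPred_eq, SimpleGraph.mem_edgeSet, Sym2.mem_iff,
      forall_eq_or_imp, forall_eq]
    tauto
  have e2 : {e ∈ T.edgeSet | ∀ v ∈ e, v ∈ A} ∩ {e ∈ T.edgeSet | ∀ v ∈ e, v ∈ B}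
      = {s(a, b), s(b, c), s(c, a)} := by
    obtain ⟨h1, h2, h3⟩ := h.isTriangle
    ext e
    induction e with | _ x y =>
    have hx : x ∈ A ∩ B ↔ x ∈ ({a, b, c} : Set V) := by rw [h.inter]
    have hy : y ∈ A ∩ B ↔ y ∈ ({a, b, c} : Set V) := by rw [h.inter]
    simp only [Set.mem_inter_iff, Set.mem_insert_iff, Set.mem_singleton_iff] at hx hy
    simp only [Set.mem_inter_iff, Set.mem_ofPred_eq, SimpleGraph.mem_edgeSet, Sym2.mem_iff,
      forall_eq_or_imp, forall_eq, Set.mem_insert_iff, Set.mem_singleton_iff, Sym2.eq_iff]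
    constructor
    · rintro ⟨⟨hxy, hxA, hyA⟩, -, hxB, hyB⟩
      have hne := hxy.ne
      rcases hx.mp ⟨hxA, hxB⟩ with rfl | rfl | rfl <;> rcases hy.mp ⟨hyA, hyB⟩ with rfl | rfl | rfl <;>
        simp_all
    · rintro ((⟨rfl, rfl⟩ | ⟨rfl, rfl⟩) | (⟨rfl, rfl⟩ | ⟨rfl, rfl⟩) | (⟨rfl, rfl⟩ | ⟨rfl, rfl⟩)) <;>
        simp_all [SimpleGraph.adj_comm]
  have e3 : ({s(a, b), s(b, c), s(c, a)} : Set (Sym2 V)).ncard = 3 := by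
    obtain ⟨h1, h2, h3⟩ := h.isTriangle
    have := h1.ne
    have := h2.ne
    have := h3.ne
    rw [Set.ncard_eq_three]
    refine ⟨_, _, _, ?_, ?_, ?_, rfl⟩ <;> rw [Ne, Sym2.eq_iff] <;> grind
  rw [e1, e2, e3, ← card_edgeSet_induce, ← card_edgeSet_induce, ← Nat.card_coe_set_eq] at he
  have hA := (hpl A).card_edgeSet_le h3
  have hB := (hpl B).card_edgeSet_le h3'
  have hE := hT.card_edgeSet
  exact (hpl A).isPlanarTriangulation h3 (by omega)

/-- A triangle that does not bound a face separates a triangulation. It bounds a set of faces, and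
a vertex off the triangle lies on one of the two sides; a side without such a vertex would be a
single face. -/
theorem IsPlanarTriangulation.exists_separation {V : Type u} [Finite V] {T : SimpleGraph V}
    (hT : IsPlanarTriangulation T) {R : RotationSystem T} (hR : R.IsPlanar) {a b c : V}
    (htri : IsTriangle T a b c) (hnf : ¬ R.IsFacialTriangle a b c) :
    ∃ A B : Set V, IsTriangleSeparation T A B a b c ∧ A.ncard < Nat.card V ∧
      B.ncard < Nat.card V := by
  cases nonempty_fintype V
  obtain ⟨f, hf, hfz⟩ := R.isPlanar_iff_isExact.mp hR _ (isEvenCycle_triangleCycle htri)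
  have hsymm : ∀ v w, T.Adj v w → v ∉ ({a, b, c} : Set V) → f v w = f w v := by
    intro v w hvw hv
    have := hfz v w hvw
    rw [triangleCycle_eq_zero_left hv] at this
    exact CharTwo.add_eq_zero.mp this
  have hconst : ∀ v w w', v ∉ ({a, b, c} : Set V) → T.Adj v w → T.Adj v w' →
      f v w = f v w' := by
    intro v w w' hv hw hw'
    obtain ⟨k, rfl⟩ := R.exists_iterate_next hw hw'
    clear hw'
    induction k with
    | zero => rfl
    | succ k ih =>
      have hy := R.adj_next_iterate hw k
      rw [Function.iterate_succ_apply', hf v _ hy, ih, hsymm v _ hy hv]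
  have hside : ∀ t : ZMod 2, ∃ v, v ∉ ({a, b, c} : Set V) ∧ ∀ w, T.Adj v w → f v w = t := by
    intro t
    have hab := htri.1
    have h1 := hfz a b hab
    rw [triangleCycle_eq_one hab.ne (by simp) (by simp)] at h1
    have h2 : f a b = t ∨ f b a = t := by
      have : ∀ x y t : ZMod 2, x + y = 1 → x = t ∨ y = t := by decide
      exact this _ _ _ h1
    have key : ∀ x y, T.Adj x y → f x y = t → R.next y x ∉ ({a, b, c} : Set V) →
        ∃ v, v ∉ ({a, b, c} : Set V) ∧ ∀ w, T.Adj v w → f v w = t := by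
      intro x y hxy hfxy hw
      have hyw : T.Adj y (R.next y x) := R.adj_next hxy.symm
      refine ⟨R.next y x, hw, fun w' hw' => ?_⟩
      rw [← hconst _ y w' hw hyw.symm hw', hsymm _ _ hyw.symm hw, hf y x hxy.symm, hfxy]
    by_contra hcon
    have h3 : ∀ x y, T.Adj x y → f x y = t → R.next y x ∈ ({a, b, c} : Set V) := by
      intro x y hxy hfxy
      by_contra hw
      exact hcon (key x y hxy hfxy hw)
    rcases h2 with h2 | h2
    · have hb := hT.boundsFace hR hab
      have h4 := h3 a b hab h2
      obtain ⟨-, h5, h6, -⟩ := id hb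
      rcases h4 with h4 | h4 | h4
      · exact h6.ne h4
      · exact h5.ne' h4
      · rw [h4] at hb
        exact hnf (.inl hb)
    · have hb := hT.boundsFace hR hab.symm
      have h4 := h3 b a hab.symm h2
      obtain ⟨-, h5, h6, -⟩ := id hb
      rcases h4 with h4 | h4 | h4
      · exact h5.ne' h4
      · exact h6.ne h4
      · rw [h4] at hb
        obtain ⟨g1, g2, g3, e1, e2, e3⟩ := hb
        exact hnf (.inr ⟨g2, g3, g1, e2, e3, e1⟩)
  let X : ZMod 2 → Set V := fun t =>
    {v | v ∈ ({a, b, c} : Set V) ∨ ∀ w, T.Adj v w → f v w = t}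
  have hcov : ∀ v, v ∈ X 0 ∨ v ∈ X 1 := by
    intro v
    by_cases hv : v ∈ ({a, b, c} : Set V)
    · exact .inl (.inl hv)
    · obtain ⟨w, hw⟩ := hT.exists_adj v
      have : ∀ x : ZMod 2, x = 0 ∨ x = 1 := by decide
      rcases this (f v w) with h | h
      · exact .inl (.inr fun w' hw' => by rw [← hconst v w w' hv hw hw', h])
      · exact .inr (.inr fun w' hw' => by rw [← hconst v w w' hv hw hw', h])
  have hdisj : ∀ v, v ∈ X 0 → v ∈ X 1 → v ∈ ({a, b, c} : Set V) := by
    rintro v (h0 | h0) (h1 | h1)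
    · exact h0
    · exact h0
    · exact h1
    · obtain ⟨w, hw⟩ := hT.exists_adj v
      have h2 := h0 w hw
      rw [h1 w hw] at h2
      exact absurd h2 one_ne_zero
  have hproper : ∀ s t : ZMod 2, s ≠ t → (X s).ncard < Nat.card V := by
    intro s t hst
    rw [← Set.ncard_univ]
    refine Set.ncard_lt_ncard ((Set.ssubset_univ_iff).mpr fun h => ?_)
    obtain ⟨v, hv, hvt⟩ := hside t
    have hvs : v ∈ X s := by rw [h]; trivial
    obtain ⟨w, hw⟩ := hT.exists_adj v
    have h2 := hvs.resolve_left hv w hw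
    rw [hvt w hw] at h2
    exact hst h2.symm
  have hedge : ∀ t x y, T.Adj x y → x ∈ X t → x ∉ ({a, b, c} : Set V) → y ∈ X t := by
    intro t x y hxy hx hx'
    by_cases hy : y ∈ ({a, b, c} : Set V)
    · exact .inl hy
    · refine .inr fun w hw => ?_
      rw [hconst y w x hy hw hxy.symm, ← hsymm x y hxy hx']
      exact hx.resolve_left hx' y hxy
  refine ⟨X 0, X 1, ⟨htri, ?_, ?_, ?_⟩, hproper 0 1 (by decide), hproper 1 0 (by decide)⟩
  · ext v
    simpa using hcov v
  · ext v
    exact ⟨fun h => hdisj v h.1 h.2, fun h => ⟨.inl h, .inl h⟩⟩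
  · intro x y hxy
    by_cases hx : x ∈ ({a, b, c} : Set V)
    · rcases hcov y with hy | hy
      · exact .inl ⟨.inl hx, hy⟩
      · exact .inr ⟨.inl hx, hy⟩
    · rcases hcov x with h | h
      · exact .inl ⟨h, hedge 0 x y hxy h hx⟩
      · exact .inr ⟨h, hedge 1 x y hxy h hx⟩

/-! ### Acyclic colourings of parts and of the whole -/

section Acyclic

variable {V W : Type u}

theorem isOrientation_iff {D : Digraph V} {G : SimpleGraph V} :
    IsOrientation D G ↔ IsSimpleDigraph D ∧ ∀ x y, G.Adj x y ↔ D.Adj x y ∨ D.Adj y x := by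
  unfold IsOrientation
  refine and_congr_right fun hD => ?_
  have hne : ∀ x y, D.Adj x y → x ≠ y := by
    rintro x y h rfl
    exact hD x x h h
  constructor
  · rintro rfl x y
    rw [Digraph.toSimpleGraphInclusive, SimpleGraph.fromRel_adj]
    refine ⟨fun h => h.2, fun h => ⟨?_, h⟩⟩
    rcases h with h | h
    exacts [hne _ _ h, (hne _ _ h).symm]
  · intro h
    ext x y
    rw [Digraph.toSimpleGraphInclusive, SimpleGraph.fromRel_adj, h]
    refine ⟨fun h => h.2, fun h => ⟨?_, h⟩⟩
    rcases h with h | h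
    exacts [hne _ _ h, (hne _ _ h).symm]

/-- The subdigraph induced by a vertex set. -/
def inducedDigraph (D : Digraph V) (A : Set V) : Digraph A where
  Adj x y := D.Adj x y

theorem IsOrientation.induce {D : Digraph V} {G : SimpleGraph V} (h : IsOrientation D G)
    (A : Set V) : IsOrientation (inducedDigraph D A) (G.induce A) := by
  rw [isOrientation_iff] at h ⊢
  exact ⟨fun x y hxy => h.1 _ _ hxy, fun x y => h.2 x y⟩

theorem IsAcyclicColouring.comp {k : ℕ} {D : Digraph V} {D' : Digraph W} {c : V → Fin k}
    (hc : IsAcyclicColouring D c) (ι : W → V) (hι : ∀ x y, D'.Adj x y → D.Adj (ι x) (ι y)) :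
    IsAcyclicColouring D' (c ∘ ι) := by
  intro i x hx
  exact hc i (ι x) (hx.lift ι fun u v h => ⟨h.1, h.2.1, hι _ _ h.2.2⟩)

theorem isAcyclicSet_inter_of_induced {D : Digraph V} {A X : Set V}
    (h : IsAcyclicSet (inducedDigraph D A) (Subtype.val ⁻¹' X)) : IsAcyclicSet D (X ∩ A) := by
  have key : ∀ x y, Relation.TransGen (fun u v => u ∈ X ∩ A ∧ v ∈ X ∩ A ∧ D.Adj u v) x y →
      ∃ (hx : x ∈ A) (hy : y ∈ A), Relation.TransGen (fun u v : A => u ∈ Subtype.val ⁻¹' X ∧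
        v ∈ Subtype.val ⁻¹' X ∧ (inducedDigraph D A).Adj u v) ⟨x, hx⟩ ⟨y, hy⟩ := by
    intro x y hxy
    induction hxy with
    | single h => exact ⟨h.1.2, h.2.1.2, .single ⟨h.1.1, h.2.1.1, h.2.2⟩⟩
    | tail _ h ih =>
      obtain ⟨hx, hy, ih⟩ := ih
      exact ⟨hx, h.2.1.2, ih.tail ⟨h.1.1, h.2.1.1, h.2.2⟩⟩
  intro x hx
  obtain ⟨h1, h2, h3⟩ := key x x hx
  exact h _ h3

/-- A walk from `A` to `A` can be rerouted inside `A`: an excursion to the other side leaves and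
re-enters `A` in two adjacent vertices, and the arc between them points forward, since otherwise
it would close a cycle on the other side. -/
theorem reroute_walk {D : Digraph V} {X A B : Set V}
    (hedge : ∀ x y, D.Adj x y → (x ∈ A ∧ y ∈ A) ∨ (x ∈ B ∧ y ∈ B))
    (hclique : ∀ x y, x ∈ A → x ∈ B → y ∈ A → y ∈ B → x ≠ y → D.Adj x y ∨ D.Adj y x)
    (hB : IsAcyclicSet D (X ∩ B)) {x y : V} (hx : x ∈ A)
    (h : Relation.TransGen (fun u v => u ∈ X ∧ v ∈ X ∧ D.Adj u v) x y) :
    (y ∈ A → Relation.TransGen (fun u v => u ∈ X ∩ A ∧ v ∈ X ∩ A ∧ D.Adj u v) x y) ∧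
    (y ∉ A → ∃ k, k ∈ X ∩ A ∧ k ∈ B ∧
      Relation.ReflTransGen (fun u v => u ∈ X ∩ A ∧ v ∈ X ∩ A ∧ D.Adj u v) x k ∧
      Relation.TransGen (fun u v => u ∈ X ∩ B ∧ v ∈ X ∩ B ∧ D.Adj u v) k y) := by
  induction h with
  | @single y h =>
    refine ⟨fun hy => .single ⟨⟨h.1, hx⟩, ⟨h.2.1, hy⟩, h.2.2⟩, fun hy => ?_⟩
    have h1 : x ∈ B ∧ y ∈ B := (hedge _ _ h.2.2).resolve_left fun h' => hy h'.2
    exact ⟨x, ⟨h.1, hx⟩, h1.1, .refl, .single ⟨⟨h.1, h1.1⟩, ⟨h.2.1, h1.2⟩, h.2.2⟩⟩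
  | @tail y z _ h ih =>
    by_cases hy : y ∈ A
    · refine ⟨fun hz => (ih.1 hy).tail ⟨⟨h.1, hy⟩, ⟨h.2.1, hz⟩, h.2.2⟩, fun hz => ?_⟩
      have h1 : y ∈ B ∧ z ∈ B := (hedge _ _ h.2.2).resolve_left fun h' => hz h'.2
      exact ⟨y, ⟨h.1, hy⟩, h1.1, (ih.1 hy).to_reflTransGen,
        .single ⟨⟨h.1, h1.1⟩, ⟨h.2.1, h1.2⟩, h.2.2⟩⟩
    · obtain ⟨k, hkA, hkB, hxk, hky⟩ := ih.2 hy
      have h1 : y ∈ B ∧ z ∈ B := (hedge _ _ h.2.2).resolve_left fun h' => hy h'.1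
      have hkz := hky.tail ⟨⟨h.1, h1.1⟩, ⟨h.2.1, h1.2⟩, h.2.2⟩
      refine ⟨fun hz => ?_, fun _ => ⟨k, hkA, hkB, hxk, hkz⟩⟩
      have hne : k ≠ z := by
        rintro rfl
        exact hB k hkz
      rcases hclique k z hkA.2 hkB hz h1.2 hne with hkz' | hzk
      · exact Relation.TransGen.tail' hxk ⟨hkA, ⟨h.2.1, hz⟩, hkz'⟩
      · exact (hB k (hkz.tail ⟨⟨h.2.1, h1.2⟩, ⟨hkA.1, hkB⟩, hzk⟩)).elim

theorem isAcyclicSet_of_inter {D : Digraph V} {X A B : Set V} (hcover : ∀ x, x ∈ A ∨ x ∈ B)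
    (hedge : ∀ x y, D.Adj x y → (x ∈ A ∧ y ∈ A) ∨ (x ∈ B ∧ y ∈ B))
    (hclique : ∀ x y, x ∈ A → x ∈ B → y ∈ A → y ∈ B → x ≠ y → D.Adj x y ∨ D.Adj y x)
    (hA : IsAcyclicSet D (X ∩ A)) (hB : IsAcyclicSet D (X ∩ B)) : IsAcyclicSet D X := by
  intro x hx
  rcases hcover x with h | h
  · exact hA x ((reroute_walk hedge hclique hB h hx).1 h)
  · exact hB x ((reroute_walk (fun x y hxy => (hedge x y hxy).symm)
      (fun x y h1 h2 h3 h4 => hclique x y h2 h1 h4 h3) hA h hx).1 h)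

end Acyclic

/-! ### Extension of colourings over separating triangles -/

/-- Every non-monochromatic pre-colouring of a facial triangle of an oriented triangulation extends
to an acyclic 2-colouring without monochromatic facial triangles. The pre-colouring is given by a
colouring `P` of all vertices. -/
def FacialExtension : Prop :=
  ∀ (V : Type u) [Finite V] (T : SimpleGraph V), IsPlanarTriangulation T →
    ∀ R : RotationSystem T, R.IsPlanar → ∀ a₁ a₂ a₃ : V, R.IsFacialTriangle a₁ a₂ a₃ →
    ∀ P : V → Fin 2, ¬ (P a₁ = P a₂ ∧ P a₂ = P a₃) → ∀ D : Digraph V, IsOrientation D T →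
    ∃ c : V → Fin 2, IsAcyclicColouring D c ∧
      (∀ x y z : V, R.IsFacialTriangle x y z → ¬ (c x = c y ∧ c y = c z)) ∧
      c a₁ = P a₁ ∧ c a₂ = P a₂ ∧ c a₃ = P a₃

/-- Every non-monochromatic pre-colouring of a triangle of an oriented triangulation on `n` vertices
extends to an acyclic 2-colouring without monochromatic triangles. The pre-colouring is given by a
colouring `P` of all vertices. -/
def TriangleExtension (n : ℕ) : Prop :=
  ∀ (V : Type u) [Finite V] (T : SimpleGraph V), Nat.card V = n → IsPlanarTriangulation T →
    ∀ a₁ a₂ a₃ : V, IsTriangle T a₁ a₂ a₃ →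
    ∀ P : V → Fin 2, ¬ (P a₁ = P a₂ ∧ P a₂ = P a₃) → ∀ D : Digraph V, IsOrientation D T →
    ∃ c : V → Fin 2, IsAcyclicColouring D c ∧
      (∀ x y z : V, IsTriangle T x y z → ¬ (c x = c y ∧ c y = c z)) ∧
      c a₁ = P a₁ ∧ c a₂ = P a₂ ∧ c a₃ = P a₃

/-- A triangulation is coloured along a separating triangle on `b₁`, `b₂`, `b₃`: the side that
contains the pre-coloured triangle comes first, and its colours on `b₁`, `b₂`, `b₃` are a
pre-colouring of the other side. -/
theorem exists_colouring_of_separation {V : Type u} [Finite V] {T : SimpleGraph V}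
    (ih : ∀ m < Nat.card V, TriangleExtension.{u} m) (hT : IsPlanarTriangulation T)
    {A B : Set V} {b₁ b₂ b₃ : V} (hsep : IsTriangleSeparation T A B b₁ b₂ b₃)
    (hA : A.ncard < Nat.card V) (hB : B.ncard < Nat.card V) {a₁ a₂ a₃ : V}
    (ha : IsTriangle T a₁ a₂ a₃) (ha₁ : a₁ ∈ A) (ha₂ : a₂ ∈ A) (ha₃ : a₃ ∈ A)
    {P : V → Fin 2} (hP : ¬ (P a₁ = P a₂ ∧ P a₂ = P a₃)) {D : Digraph V}
    (hD : IsOrientation D T) :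
    ∃ c : V → Fin 2, IsAcyclicColouring D c ∧
      (∀ x y z : V, IsTriangle T x y z → ¬ (c x = c y ∧ c y = c z)) ∧
      c a₁ = P a₁ ∧ c a₂ = P a₂ ∧ c a₃ = P a₃ := by
  classical
  have hb₁ := hsep.mem_inter (x := b₁) (by simp)
  have hb₂ := hsep.mem_inter (x := b₂) (by simp)
  have hb₃ := hsep.mem_inter (x := b₃) (by simp)
  obtain ⟨p, hp1, hp2, hp3⟩ := ih _ hA A (T.induce A) (Nat.card_coe_set_eq A)
    (hsep.isPlanarTriangulation hT) ⟨a₁, ha₁⟩ ⟨a₂, ha₂⟩ ⟨a₃, ha₃⟩ ha (fun x => P x) hP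
    (inducedDigraph D A) (hD.induce A)
  have hpb : ¬ (p ⟨b₁, hb₁.1⟩ = p ⟨b₂, hb₂.1⟩ ∧ p ⟨b₂, hb₂.1⟩ = p ⟨b₃, hb₃.1⟩) :=
    hp2 _ _ _ hsep.isTriangle
  obtain ⟨q, hq1, hq2, hq3⟩ := ih _ hB B (T.induce B) (Nat.card_coe_set_eq B)
    (hsep.symm.isPlanarTriangulation hT) ⟨b₁, hb₁.2⟩ ⟨b₂, hb₂.2⟩ ⟨b₃, hb₃.2⟩ hsep.isTriangle
    (fun x => if h : x.1 ∈ A then p ⟨x, h⟩ else 0)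
    (by simpa only [hb₁.1, hb₂.1, hb₃.1, dite_true] using hpb)
    (inducedDigraph D B) (hD.induce B)
  simp only [hb₁.1, hb₂.1, hb₃.1, dite_true] at hq3
  let c : V → Fin 2 := fun x =>
    if h : x ∈ A then p ⟨x, h⟩ else q ⟨x, (hsep.mem_or x).resolve_left h⟩
  have hcA : ∀ x (h : x ∈ A), c x = p ⟨x, h⟩ := fun x h => by simp only [c, h, dite_true]
  have hcB : ∀ x (h : x ∈ B), c x = q ⟨x, h⟩ := by
    intro x h
    by_cases hx : x ∈ A
    · rw [hcA x hx]
      have hx' : x ∈ ({b₁, b₂, b₃} : Set V) := by rw [← hsep.inter]; exact ⟨hx, h⟩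
      rcases hx' with rfl | rfl | rfl
      exacts [hq3.1.symm, hq3.2.1.symm, hq3.2.2.symm]
    · simp only [c, hx, dite_false]
  have hD' := (isOrientation_iff.mp hD).2
  refine ⟨c, ?_, ?_, ?_, ?_, ?_⟩
  · intro i
    refine isAcyclicSet_of_inter hsep.mem_or
      (fun x y hxy => hsep.edge x y ((hD' x y).mpr (.inl hxy))) ?_ ?_ ?_
    · intro x y hxA hxB hyA hyB hxy
      rw [← hD']
      have hx : x ∈ ({b₁, b₂, b₃} : Set V) := by rw [← hsep.inter]; exact ⟨hxA, hxB⟩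
      have hy : y ∈ ({b₁, b₂, b₃} : Set V) := by rw [← hsep.inter]; exact ⟨hyA, hyB⟩
      obtain ⟨h1, h2, h3⟩ := hsep.isTriangle
      have h1' := h1.symm
      have h2' := h2.symm
      have h3' := h3.symm
      rcases hx with rfl | rfl | rfl <;> rcases hy with rfl | rfl | rfl <;>
        first
        | assumption
        | exact (hxy rfl).elim
    · refine isAcyclicSet_inter_of_induced ?_
      convert hp1 i using 1
      ext x
      simp [hcA x x.2]
    · refine isAcyclicSet_inter_of_induced ?_
      convert hq1 i using 1
      ext x
      simp [hcB x x.2]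
  · intro x y z hxyz
    rcases hsep.triangle_mem hxyz with ⟨hx, hy, hz⟩ | ⟨hx, hy, hz⟩
    · rw [hcA x hx, hcA y hy, hcA z hz]
      exact hp2 _ _ _ hxyz
    · rw [hcB x hx, hcB y hy, hcB z hz]
      exact hq2 _ _ _ hxyz
  · rw [hcA _ ha₁]; exact hp3.1
  · rw [hcA _ ha₂]; exact hp3.2.1
  · rw [hcA _ ha₃]; exact hp3.2.2

theorem FacialExtension.triangleExtension (h : FacialExtension.{u}) (n : ℕ) :
    TriangleExtension.{u} n := by
  induction n using Nat.strong_induction_on with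
  | _ n ih =>
    rintro V _ T rfl hT a₁ a₂ a₃ ha P hP D hD
    obtain ⟨R, hR⟩ := hT.2.1
    by_cases hall : ∀ x y z, IsTriangle T x y z → R.IsFacialTriangle x y z
    · obtain ⟨c, h1, h2, h3⟩ := h V T hT R hR a₁ a₂ a₃ (hall _ _ _ ha) P hP D hD
      exact ⟨c, h1, fun x y z hxyz => h2 x y z (hall _ _ _ hxyz), h3⟩
    · push Not at hall
      obtain ⟨b₁, b₂, b₃, hb, hnf⟩ := hall
      obtain ⟨A, B, hsep, hA, hB⟩ := hT.exists_separation hR hb hnf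
      rcases hsep.triangle_mem ha with ⟨h1, h2, h3⟩ | ⟨h1, h2, h3⟩
      · exact exists_colouring_of_separation ih hT hsep hA hB ha h1 h2 h3 hP hD
      · exact exists_colouring_of_separation ih hT hsep.symm hB hA ha h1 h2 h3 hP hD

/-! ### A gadget that forbids monochromatic facial triangles -/

section Gadget

variable {V : Type u}

/-- Adjacency in `gadgetGraph`. -/
def gadgetAdj (T : SimpleGraph V) (n : V → V → V) : V ⊕ V × V → V ⊕ V × V → Prop
  | .inl a, .inl b => T.Adj a b
  | .inl v, .inr d => T.Adj d.1 d.2 ∧ (v = d.1 ∨ v = d.2)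
  | .inr d, .inl v => T.Adj d.1 d.2 ∧ (v = d.1 ∨ v = d.2)
  | .inr d, .inr e => T.Adj d.1 d.2 ∧ T.Adj e.1 e.2 ∧
      ((e.1 = d.2 ∧ e.2 = n d.2 d.1) ∨ (d.1 = e.2 ∧ d.2 = n e.2 e.1))

/-- The triangulation `T`, with an octahedron completed inside every face: a dart `d = (a, b)` has
a new vertex `Sum.inr d` in the face on its side, joined to `a`, to `b` and to the new vertices of
the other darts of this face. Here `n` is the successor map of the rotation system of `T`. The
pairs that are not darts give isolated vertices. -/
def gadgetGraph (T : SimpleGraph V) (n : V → V → V) : SimpleGraph (V ⊕ V × V) where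
  Adj := gadgetAdj T n
  symm := ⟨by
    rintro (a | ⟨a, b⟩) (c | ⟨c, d⟩) h
    · exact SimpleGraph.Adj.symm (G := T) h
    · exact h
    · exact h
    · exact ⟨h.2.1, h.1, h.2.2.symm⟩⟩
  loopless := ⟨by
    rintro (a | ⟨a, b⟩) h
    · exact T.irrefl h
    · rcases h.2.2 with h' | h'
      · exact h.1.ne h'.1
      · exact h.1.ne h'.1⟩

/-- The orientation `D` of `T`, extended to the gadget: the triangle on a dart `d` and its new
vertex is directed, and so is the triangle of the new vertices in a face. -/
def gadgetDigraph (D : Digraph V) (T : SimpleGraph V) (n : V → V → V) : Digraph (V ⊕ V × V) where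
  Adj
  | .inl a, .inl b => D.Adj a b
  | .inl v, .inr d => T.Adj d.1 d.2 ∧ ((D.Adj d.1 d.2 ∧ v = d.2) ∨ (D.Adj d.2 d.1 ∧ v = d.1))
  | .inr d, .inl v => T.Adj d.1 d.2 ∧ ((D.Adj d.1 d.2 ∧ v = d.1) ∨ (D.Adj d.2 d.1 ∧ v = d.2))
  | .inr d, .inr e => T.Adj d.1 d.2 ∧ T.Adj e.1 e.2 ∧ e.1 = d.2 ∧ e.2 = n d.2 d.1

/-- All facial walks of the rotation system have length three. -/
def RotationSystem.IsTriangular {T : SimpleGraph V} (R : RotationSystem T) : Prop :=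
  ∀ u v, T.Adj u v → R.next (R.next v u) v = u ∧ R.next u (R.next v u) = v

variable {T : SimpleGraph V} {R : RotationSystem T}

theorem RotationSystem.IsTriangular.adj (hR : R.IsTriangular) {u v : V} (h : T.Adj u v) :
    T.Adj (R.next v u) u := by
  have := R.adj_next (R.adj_next h.symm).symm
  rwa [(hR u v h).1] at this

theorem RotationSystem.IsTriangular.eq_next (hR : R.IsTriangular) {a b c : V} (h : T.Adj c a)
    (hb : b = R.next a c) : c = R.next b a := by
  rw [hb, (hR c a h).1]

theorem isOrientation_gadget (hR : R.IsTriangular) {D : Digraph V} (hD : IsOrientation D T) :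
    IsOrientation (gadgetDigraph D T R.next) (gadgetGraph T R.next) := by
  rw [isOrientation_iff] at hD ⊢
  obtain ⟨h1, h2⟩ := hD
  constructor
  · rintro (a | ⟨a, b⟩) (c | ⟨c, d⟩) h h'
    · exact h1 _ _ h h'
    · obtain ⟨g, ⟨e1, e2⟩ | ⟨e1, e2⟩⟩ := h <;> obtain ⟨g', ⟨e1', e2'⟩ | ⟨e1', e2'⟩⟩ := h' <;>
        first
        | exact h1 _ _ e1 e1'
        | exact g.ne (e2'.symm.trans e2)
        | exact g.ne (e2.symm.trans e2')
    · obtain ⟨g, ⟨e1, e2⟩ | ⟨e1, e2⟩⟩ := h <;> obtain ⟨g', ⟨e1', e2'⟩ | ⟨e1', e2'⟩⟩ := h' <;>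
        first
        | exact h1 _ _ e1 e1'
        | exact g.ne (e2'.symm.trans e2)
        | exact g.ne (e2.symm.trans e2')
    · obtain ⟨g, g', e1, e2⟩ := h
      obtain ⟨-, -, e1', e2'⟩ := h'
      dsimp only at g g' e1 e2 e1' e2'
      have := hR.adj g
      rw [← e2, e1'] at this
      exact T.irrefl this
  · rintro (a | ⟨a, b⟩) (c | ⟨c, d⟩)
    · exact h2 a c
    · change T.Adj c d ∧ (a = c ∨ a = d) ↔
        (T.Adj c d ∧ ((D.Adj c d ∧ a = d) ∨ (D.Adj d c ∧ a = c))) ∨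
        (T.Adj c d ∧ ((D.Adj c d ∧ a = c) ∨ (D.Adj d c ∧ a = d)))
      have := h2 c d
      tauto
    · change T.Adj a b ∧ (c = a ∨ c = b) ↔
        (T.Adj a b ∧ ((D.Adj a b ∧ c = a) ∨ (D.Adj b a ∧ c = b))) ∨
        (T.Adj a b ∧ ((D.Adj a b ∧ c = b) ∨ (D.Adj b a ∧ c = a)))
      have := h2 a b
      tauto
    · change T.Adj a b ∧ T.Adj c d ∧ ((c = b ∧ d = R.next b a) ∨ (a = d ∧ b = R.next d c)) ↔
        (T.Adj a b ∧ T.Adj c d ∧ c = b ∧ d = R.next b a) ∨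
        (T.Adj c d ∧ T.Adj a b ∧ a = d ∧ b = R.next d c)
      tauto

theorem IsAcyclicColouring.not_triangle {k : ℕ} {D : Digraph V} {c : V → Fin k}
    (hc : IsAcyclicColouring D c) {x y z : V} (hxy : D.Adj x y) (hyz : D.Adj y z)
    (hzx : D.Adj z x) : ¬ (c x = c y ∧ c y = c z) := by
  rintro ⟨h1, h2⟩
  exact hc (c x) x (((Relation.TransGen.single ⟨rfl, h1.symm, hxy⟩).tail
    ⟨h1.symm, (h1.trans h2).symm, hyz⟩).tail ⟨(h1.trans h2).symm, rfl, hzx⟩)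

/-- If a facial triangle were monochromatic, then each of its three new vertices would have the
other colour, being in a directed triangle with two vertices of the face; but the new vertices
form a directed triangle themselves. -/
theorem not_monochromatic_of_gadget {D : Digraph V} (hD : IsOrientation D T)
    {c : V ⊕ V × V → Fin 2} (hc : IsAcyclicColouring (gadgetDigraph D T R.next) c) {x y z : V}
    (hxyz : R.IsFacialTriangle x y z) :
    ¬ (c (.inl x) = c (.inl y) ∧ c (.inl y) = c (.inl z)) := by
  have hD' := (isOrientation_iff.mp hD).2
  have hnew : ∀ a b, T.Adj a b → c (.inl a) = c (.inl b) → c (.inr (a, b)) ≠ c (.inl a) := by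
    intro a b hab e e'
    rcases (hD' a b).mp hab with h | h
    · exact hc.not_triangle (x := .inl a) (y := .inl b) (z := .inr (a, b)) h
        ⟨hab, .inl ⟨h, rfl⟩⟩ ⟨hab, .inl ⟨h, rfl⟩⟩ ⟨e, e.symm.trans e'.symm⟩
    · exact hc.not_triangle (x := .inl b) (y := .inl a) (z := .inr (a, b)) h
        ⟨hab, .inr ⟨h, rfl⟩⟩ ⟨hab, .inr ⟨h, rfl⟩⟩ ⟨e.symm, e'.symm⟩
  have key : ∀ x y z, R.BoundsFace x y z →
      ¬ (c (.inl x) = c (.inl y) ∧ c (.inl y) = c (.inl z)) := by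
    rintro x y z ⟨hxy, hyz, hzx, e1, e2, e3⟩ ⟨h1, h2⟩
    rw [R.faceNext_mk] at e1 e2 e3
    have f1 : z = R.next y x := congrArg (fun d : T.Dart => d.snd) e1.symm
    have f2 : x = R.next z y := congrArg (fun d : T.Dart => d.snd) e2.symm
    have f3 : y = R.next x z := congrArg (fun d : T.Dart => d.snd) e3.symm
    have g1 := hnew x y hxy h1
    have g2 := hnew y z hyz h2
    have g3 := hnew z x hzx (h1.trans h2).symm
    rw [← h1] at g2
    rw [← h2, ← h1] at g3
    have hfin : ∀ i j k : Fin 2, j ≠ i → k ≠ i → j = k := by decide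
    exact hc.not_triangle (x := .inr (x, y)) (y := .inr (y, z)) (z := .inr (z, x))
      ⟨hxy, hyz, rfl, f1⟩ ⟨hyz, hzx, rfl, f2⟩ ⟨hzx, hxy, rfl, f3⟩
      ⟨hfin _ _ _ g1 g2, hfin _ _ _ g2 g3⟩
  rcases hxyz with h | h
  · exact key _ _ _ h
  · rintro ⟨h1, h2⟩
    exact key _ _ _ h ⟨h1.trans h2, h2.symm⟩

open Classical in
/-- The rotations of the gadget graph. Around an old vertex `v`, the new vertices of the darts
`(w, v)` and `(v, n v w)` come between the old neighbours `w` and `n v w`. -/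
noncomputable def gadgetNext (n : V → V → V) : V ⊕ V × V → V ⊕ V × V → V ⊕ V × V
  | .inl v, .inl w => .inr (w, v)
  | .inl v, .inr d => if d.2 = v then .inr (v, n v d.1) else .inl d.2
  | .inr d, .inl v => if v = d.2 then .inl d.1 else .inr (n d.2 d.1, d.1)
  | .inr d, .inr e => if e.1 = d.2 then .inl d.2 else .inr (d.2, n d.2 d.1)

theorem gadgetNext_reaches [Finite V] (hR : R.IsTriangular) (x y z : V ⊕ V × V)
    (hy : (gadgetGraph T R.next).Adj x y) (hz : (gadgetGraph T R.next).Adj x z) :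
    Relation.ReflTransGen (fun a b => b = gadgetNext R.next x a) y z := by
  rcases x with v | ⟨a, b⟩
  · have hstep : ∀ w, T.Adj v w → Relation.ReflTransGen
        (fun a b => b = gadgetNext R.next (.inl v) a) (.inr (w, v)) (.inl (R.next v w)) := by
      intro w hw
      have h1 := (R.adj_next hw).ne'
      exact (Relation.ReflTransGen.single (b := Sum.inr (v, R.next v w))
        (by simp [gadgetNext])).tail (by simp [gadgetNext, h1])
    have hold : ∀ w w', T.Adj v w → T.Adj v w' → Relation.ReflTransGen
        (fun a b => b = gadgetNext R.next (.inl v) a) (.inl w) (.inl w') := by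
      intro w w' hw hw'
      obtain ⟨k, rfl⟩ := R.exists_iterate_next hw hw'
      clear hw'
      induction k with
      | zero => exact .refl
      | succ k ih =>
        rw [Function.iterate_succ_apply']
        exact (ih.tail rfl).trans (hstep _ (R.adj_next_iterate hw k))
    have hfrom : ∃ w, T.Adj v w ∧ Relation.ReflTransGen
        (fun a b => b = gadgetNext R.next (.inl v) a) y (.inl w) := by
      rcases y with w | ⟨c, d⟩
      · exact ⟨w, hy, .refl⟩
      · obtain ⟨hcd, h⟩ := hy
        dsimp only at hcd h
        by_cases hdv : d = v
        · subst hdv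
          exact ⟨_, R.adj_next hcd.symm, hstep c hcd.symm⟩
        · obtain rfl := h.resolve_right (Ne.symm hdv)
          exact ⟨d, hcd, .single (by simp [gadgetNext, hdv])⟩
    have hto : ∃ w, T.Adj v w ∧ Relation.ReflTransGen
        (fun a b => b = gadgetNext R.next (.inl v) a) (.inl w) z := by
      rcases z with w | ⟨c, d⟩
      · exact ⟨w, hz, .refl⟩
      · obtain ⟨hcd, h⟩ := hz
        dsimp only at hcd h
        rcases h with rfl | rfl
        · have h1 := hR.adj hcd
          refine ⟨R.next d v, h1.symm, Relation.ReflTransGen.head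
            (b := Sum.inr (R.next d v, v)) rfl (.single ?_)⟩
          have h2 := (hR v d hcd).2
          simp [gadgetNext, h2]
        · exact ⟨c, hcd.symm, .single rfl⟩
    obtain ⟨w, hw, h1⟩ := hfrom
    obtain ⟨w', hw', h2⟩ := hto
    exact h1.trans ((hold w w' hw hw').trans h2)
  · have hab : T.Adj a b := by
      rcases y with w | ⟨c, d⟩ <;> exact hy.1
    have hba := hab.ne
    have hw1 := (R.adj_next hab.symm).ne'
    have s1 : gadgetNext R.next (.inr (a, b)) (.inl b) = .inl a := by simp [gadgetNext]
    have s2 : gadgetNext R.next (.inr (a, b)) (.inl a) = .inr (R.next b a, a) := by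
      simp [gadgetNext, hba]
    have s3 : gadgetNext R.next (.inr (a, b)) (.inr (R.next b a, a)) = .inr (b, R.next b a) := by
      simp [gadgetNext, hw1]
    have s4 : gadgetNext R.next (.inr (a, b)) (.inr (b, R.next b a)) = .inl b := by
      simp [gadgetNext]
    have hcases : ∀ y, (gadgetGraph T R.next).Adj (.inr (a, b)) y →
        y = .inl a ∨ y = .inl b ∨ y = .inr (R.next b a, a) ∨ y = .inr (b, R.next b a) := by
      rintro (w | ⟨c, d⟩) h
      · rcases h.2 with h | h
        · exact .inl (congrArg Sum.inl h)
        · exact .inr (.inl (congrArg Sum.inl h))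
      · obtain ⟨h0, h1, ⟨e1, e2⟩ | ⟨e1, e2⟩⟩ := h <;> dsimp only at h0 h1 e1 e2
        · right; right; right; rw [e1, e2]
        · right; right; left
          subst e1
          rw [hR.eq_next h1 e2]
    have t1 : Relation.ReflTransGen (fun x y => y = gadgetNext R.next (.inr (a, b)) x)
      (.inl b) (.inl a) := .single s1.symm
    have t2 := t1.tail s2.symm
    have t3 := t2.tail s3.symm
    have u4 : Relation.ReflTransGen (fun x y => y = gadgetNext R.next (.inr (a, b)) x)
      (.inr (b, R.next b a)) (.inl b) := .single s4.symm
    have u3 : Relation.ReflTransGen (fun x y => y = gadgetNext R.next (.inr (a, b)) x)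
      (.inr (R.next b a, a)) (.inl b) := .head s3.symm u4
    have u2 : Relation.ReflTransGen (fun x y => y = gadgetNext R.next (.inr (a, b)) x)
      (.inl a) (.inl b) := .head s2.symm u3
    refine Relation.ReflTransGen.trans (b := Sum.inl b) ?_ ?_
    · rcases hcases y hy with rfl | rfl | rfl | rfl
      exacts [u2, .refl, u3, u4]
    · rcases hcases z hz with rfl | rfl | rfl | rfl
      exacts [t1, .refl, t2, t3]

/-- A cycle of the gadget graph, pushed onto `T` across the faces at the new vertices, is a cycle
of `T`. -/
theorem isEvenCycle_pushed [Fintype V] [DecidableRel T.Adj] (hR : R.IsTriangular)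
    {z : V ⊕ V × V → V ⊕ V × V → ZMod 2}
    (hz : IsEvenCycle (gadgetGraph T R.next) z)
    (hnew : ∀ a b, T.Adj a b → z (.inr (a, b)) (.inr (b, R.next b a)) + z (.inl b) (.inr (a, b))
      = z (.inl a) (.inr (a, b)) + z (.inr (R.next b a, a)) (.inr (a, b)))
    (q : V → V → ZMod 2)
    (hq : ∀ a b, q a b = z (.inr (a, b)) (.inr (b, R.next b a)) + z (.inl b) (.inr (a, b))) :
    IsEvenCycle T fun a b => if T.Adj a b then z (.inl a) (.inl b) + q a b + q b a else 0 where
  symm := by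
    intro a b
    simp only [T.adj_comm a b]
    by_cases h : T.Adj b a
    · simp only [h, if_true]
      rw [hz.symm (.inl a)]
      ring
    · simp only [h, if_false]
  supp := by intro a b h; simp [h]
  sum := by
    classical
    intro v
    have h0 := hz.sum (.inl v)
    rw [Fintype.sum_sum_type, Fintype.sum_prod_type] at h0
    have h1 : ∑ a, ∑ b, z (.inl v) (.inr (a, b)) =
        ∑ b, z (.inl v) (.inr (v, b)) + ∑ a, z (.inl v) (.inr (a, v)) := by
      have : ∀ a b, z (.inl v) (.inr (a, b)) = (if a = v then z (.inl v) (.inr (v, b)) else 0) +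
          (if b = v then z (.inl v) (.inr (a, v)) else 0) := by
        intro a b
        by_cases ha : a = v
        · subst ha
          by_cases hb : b = a
          · subst hb
            rw [hz.supp (.inl b) (.inr (b, b)) fun h => T.irrefl h.1]
            simp
          · simp [hb]
        · by_cases hb : b = v
          · subst hb; simp [ha]
          · simp only [ha, hb, if_false, add_zero]
            refine hz.supp _ _ fun h => ?_
            rcases h.2 with h | h
            exacts [ha h.symm, hb h.symm]
      rw [Finset.sum_congr rfl fun a _ => Finset.sum_congr rfl fun b _ => this a b]
      simp only [Finset.sum_add_distrib, Finset.sum_ite_eq', Finset.mem_univ, if_true]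
      congr 1
      rw [Finset.sum_comm]
      simp only [Finset.sum_ite_eq', Finset.mem_univ, if_true]
    have hfil : ∀ g : V → ZMod 2, (∀ w, ¬ T.Adj v w → g w = 0) →
        ∑ w, g w = ∑ w with T.Adj v w, g w := fun g hg =>
      (Finset.sum_filter_of_ne fun w _ hw => by
        by_contra h
        exact hw (hg w h)).symm
    rw [h1, hfil (fun w => z (.inl v) (.inl w)) (fun w hw => hz.supp (.inl v) (.inl w) hw),
      hfil (fun b => z (.inl v) (.inr (v, b))) (fun w hw => hz.supp _ _ fun h => hw h.1),
      hfil (fun b => z (.inl v) (.inr (b, v)))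
        (fun w hw => hz.supp _ _ fun h => hw h.1.symm)] at h0
    rw [← Finset.sum_filter]
    let h : V → ZMod 2 := fun w => z (.inr (R.next w v, v)) (.inr (v, w))
    have h2 := R.sum_next v h
    have h3 : ∑ w with T.Adj v w, (z (.inl v) (.inl w) + q v w + q w v) =
        ∑ w with T.Adj v w, ((z (.inl v) (.inl w) + (z (.inl v) (.inr (v, w)) +
          z (.inl v) (.inr (w, v)))) + (h (R.next v w) + h w)) := by
      refine Finset.sum_congr rfl fun w hw => ?_
      have hvw : T.Adj v w := (Finset.mem_filter.mp hw).2
      rw [hq v w, hnew v w hvw, hq w v]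
      simp only [h]
      rw [(hR w v hvw.symm).1]
      ring
    rw [h3, Finset.sum_add_distrib, Finset.sum_add_distrib, Finset.sum_add_distrib,
      Finset.sum_add_distrib, h0, h2, zero_add]
    exact CharTwo.add_self_eq_zero _

/-- The gadget graph is planar. -/
theorem isPlanarGraph_gadget [Finite V] (hR : R.IsTriangular) (hpl : R.IsPlanar) :
    IsPlanarGraph (gadgetGraph T R.next) := by
  classical
  cases nonempty_fintype V
  rw [R.isPlanar_iff_isExact] at hpl
  have hnextadj : ∀ x y, (gadgetGraph T R.next).Adj x y →
      (gadgetGraph T R.next).Adj x (gadgetNext R.next x y) := by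
    rintro (v | ⟨a, b⟩) (w | ⟨c, d⟩) h
    · exact ⟨SimpleGraph.Adj.symm (G := T) h, .inr rfl⟩
    · obtain ⟨h1, h2⟩ := h
      dsimp only at h1 h2
      by_cases hd : d = v
      · subst hd
        simp only [gadgetNext, if_true]
        exact ⟨R.adj_next h1.symm, .inl rfl⟩
      · obtain rfl := h2.resolve_right (Ne.symm hd)
        simp only [gadgetNext, hd, if_false]
        exact h1
    · obtain ⟨h1, h2⟩ := h
      dsimp only at h1 h2
      by_cases hd : w = b
      · simp only [gadgetNext, hd, if_true]
        exact ⟨h1, .inl rfl⟩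
      · simp only [gadgetNext, hd, if_false]
        exact ⟨h1, hR.adj h1, .inr ⟨rfl, (hR a b h1).2.symm⟩⟩
    · have h1 : T.Adj a b := h.1
      by_cases hd : c = b
      · simp only [gadgetNext, hd, if_true]
        exact ⟨h1, .inr rfl⟩
      · simp only [gadgetNext, hd, if_false]
        exact ⟨h1, R.adj_next h1.symm, .inl ⟨rfl, rfl⟩⟩
  obtain ⟨S, hS⟩ := RotationSystem.exists_of_next (G := gadgetGraph T R.next) (gadgetNext R.next)
    hnextadj (gadgetNext_reaches hR)
  refine isPlanarGraph_iff.mpr ⟨S, fun z hz => ?_⟩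
  have hnew : ∀ a b, T.Adj a b →
      z (.inr (a, b)) (.inr (b, R.next b a)) + z (.inl b) (.inr (a, b))
      = z (.inl a) (.inr (a, b)) + z (.inr (R.next b a, a)) (.inr (a, b)) := by
    intro a b hab
    have hw1 := (R.adj_next hab.symm).ne'
    have h0 := hz.sum (.inr (a, b))
    rw [Fintype.sum_sum_type, Fintype.sum_eq_add a b hab.ne, Fintype.sum_eq_add
      (R.next b a, a) (b, R.next b a) (fun e => hw1 (congrArg Prod.fst e))] at h0
    · rw [hz.symm (.inl b), hz.symm (.inl a), hz.symm (.inr (R.next b a, a))]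
      have : ∀ p q r s : ZMod 2, p + q + (r + s) = 0 → s + q = p + r := by decide
      exact this _ _ _ _ h0
    · rintro ⟨c, d⟩ ⟨h1, h2⟩
      refine hz.supp _ _ fun h => ?_
      obtain ⟨h0, h1', ⟨e1, e2⟩ | ⟨e1, e2⟩⟩ := h <;> dsimp only at h0 h1' e1 e2
      · exact h2 (by rw [e1, e2])
      · subst e1
        exact h1 (by rw [hR.eq_next h1' e2])
    · rintro v ⟨h1, h2⟩
      refine hz.supp _ _ fun h => ?_
      rcases h.2 with h | h
      exacts [h1 h, h2 h]
  let q : V → V → ZMod 2 := fun a b =>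
    z (.inr (a, b)) (.inr (b, R.next b a)) + z (.inl b) (.inr (a, b))
  obtain ⟨g, hg, hgz⟩ := hpl _ (isEvenCycle_pushed hR hz hnew q fun _ _ => rfl)
  -- `s` and `t` are the values on the faces `(d, b, φ d)` and `(a, b, d)` for a dart `d = (a, b)`
  let s : V → V → ZMod 2 := fun a b => g a b + z (.inr (a, b)) (.inr (b, R.next b a))
  let t : V → V → ZMod 2 := fun a b => s a b + z (.inl b) (.inr (a, b))
  let f : V ⊕ V × V → V ⊕ V × V → ZMod 2
    | .inl v, .inl w => t v w
    | .inl v, .inr d => if v = d.2 then t d.1 d.2 else s (R.next d.2 d.1) d.1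
    | .inr d, .inl v => if v = d.2 then s d.1 d.2 else t d.1 d.2
    | .inr d, .inr e => if e.1 = d.2 then g d.1 d.2 else s e.1 e.2
  have hdouble : ∀ x : ZMod 2, x + x = 0 := fun x => CharTwo.add_self_eq_zero x
  have hring : ∀ a b (h : T.Adj a b), f (.inr (a, b)) (.inr (b, R.next b a)) +
      f (.inr (b, R.next b a)) (.inr (a, b)) = z (.inr (a, b)) (.inr (b, R.next b a)) := by
    intro a b h
    have h1 := (hR.adj h).ne'
    simp only [f, if_true, h1, if_false, s]
    rw [← add_assoc, hdouble, zero_add]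
  have hspoke : ∀ v a b, T.Adj a b → (v = a ∨ v = b) →
      f (.inl v) (.inr (a, b)) + f (.inr (a, b)) (.inl v) = z (.inl v) (.inr (a, b)) := by
    intro v a b h hv
    by_cases hb : v = b
    · subst hb
      simp only [f, if_true, t]
      have : ∀ x y : ZMod 2, x + y + x = y := by decide
      exact this _ _
    · obtain rfl := hv.resolve_right hb
      simp only [f, hb, if_false, t, s]
      have hwa := hR.adj h
      have h1 : g (R.next b v) v = g v b := by
        have := hg v (R.next b v) hwa.symm
        rw [(hR v b h).2] at this
        exact this.symm
      have h2 := hnew v b h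
      rw [(hR v b h).2, h1]
      have : ∀ x y p r s : ZMod 2, r + s = x + y → p + y + (p + r + s) = x := by decide
      exact this _ _ _ _ _ h2
  refine ⟨f, ?_, ?_⟩
  · intro x y hxy
    rw [hS x y hxy]
    rcases x with v | ⟨a, b⟩ <;> rcases y with w | ⟨c, d⟩
    · simp [f, gadgetNext]
    · obtain ⟨h1, h2⟩ := hxy
      dsimp only at h1 h2
      by_cases hd : d = v
      · subst hd
        have h3 := (R.adj_next h1.symm).ne
        simp [f, gadgetNext, h3, (hR c d h1).1]
      · obtain rfl := h2.resolve_right (Ne.symm hd)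
        simp [f, gadgetNext, hd, Ne.symm hd]
    · obtain ⟨h1, h2⟩ := hxy
      dsimp only at h1 h2
      by_cases hd : w = b
      · subst hd
        simp [f, gadgetNext, h1.ne]
      · obtain rfl := h2.resolve_right hd
        have h3 := (R.adj_next h1.symm).ne'
        simp [f, gadgetNext, hd, h3]
    · obtain ⟨h0, h1, ⟨e1, e2⟩ | ⟨e1, e2⟩⟩ := hxy <;> dsimp only at h0 h1 e1 e2
      · subst e1
        subst e2
        have h3 := (hR.adj h0).ne'
        simp [f, gadgetNext, h3]
      · subst e1
        have e3 := hR.eq_next h1 e2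
        have hcb : c ≠ b := by
          rw [e3]
          exact (R.adj_next h0.symm).ne'
        have h4 := hg a c h1.symm
        rw [← e2] at h4
        simp [f, gadgetNext, hcb, h4]
  · intro x y hxy
    rcases x with v | ⟨a, b⟩ <;> rcases y with w | ⟨c, d⟩
    · have hvw : T.Adj v w := hxy
      have h1 := hgz v w hvw
      simp only [hvw, if_true] at h1
      have h2 : ∀ a b, t a b = g a b + q a b := fun a b => by
        simp only [t, s, q]; ring
      simp only [f]
      rw [h2, h2]
      have : ∀ x y p r s : ZMod 2, x + y = p + r + s → x + r + (y + s) = p := by decide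
      exact this _ _ _ _ _ h1
    · exact hspoke v c d hxy.1 hxy.2
    · rw [hz.symm, add_comm]
      exact hspoke w a b hxy.1 hxy.2
    · obtain ⟨h0, h1, ⟨e1, e2⟩ | ⟨e1, e2⟩⟩ := hxy <;> dsimp only at h0 h1 e1 e2
      · subst e1
        subst e2
        exact hring a c h0
      · subst e1
        subst e2
        rw [hz.symm, add_comm]
        exact hring c a h1

end Gadget

/-! ### Planar graphs that share an edge -/

theorem reaches_congr {V : Type u} (N : V → Prop) {n n' : V → V} (hN : ∀ x, N x → N (n x))
    (h : ∀ x, N x → n' x = n x) {b c : V} (hb : N b)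
    (hbc : Relation.ReflTransGen (fun x y => y = n x) b c) :
    Relation.ReflTransGen (fun x y => y = n' x) b c := by
  suffices N c ∧ Relation.ReflTransGen (fun x y => y = n' x) b c from this.2
  induction hbc with
  | refl => exact ⟨hb, .refl⟩
  | @tail x y _ hxy ih =>
    subst hxy
    exact ⟨hN _ ih.1, ih.2.tail (h x ih.1).symm⟩

/-- Two cyclic orders that share the single element `v` are joined into one: the first order is run
through from `v` on, then the second one. -/
theorem reaches_join {V : Type u} (N₁ N₂ : V → Prop) [DecidablePred N₁] [DecidableEq V]
    (n₁ n₂ : V → V) (v : V)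
    (h₁ : ∀ b, N₁ b → N₁ (n₁ b)) (h₂ : ∀ b, N₂ b → N₂ (n₂ b))
    (r₁ : ∀ b c, N₁ b → N₁ c → Relation.ReflTransGen (fun x y => y = n₁ x) b c)
    (r₂ : ∀ b c, N₂ b → N₂ c → Relation.ReflTransGen (fun x y => y = n₂ x) b c)
    (hv₁ : N₁ v) (hv₂ : N₂ v) (hv : ∀ x, N₁ x → N₂ x → x = v) (b c : V)
    (hb : N₁ b ∨ N₂ b) (hc : N₁ c ∨ N₂ c) :
    Relation.ReflTransGen
      (fun x y => y = if N₁ x then (if n₁ x = v then n₂ v else n₁ x) else n₂ x) b c := by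
  set r : V → V → Prop :=
    fun x y => y = if N₁ x then (if n₁ x = v then n₂ v else n₁ x) else n₂ x with hr
  have step₁ : ∀ x, N₁ x → n₁ x ≠ v → r x (n₁ x) := fun x hx h => by simp [hr, hx, h]
  have stepv : ∀ x, N₁ x → n₁ x = v → r x (n₂ v) := fun x hx h => by simp [hr, hx, h]
  have step₂ : ∀ x, N₂ x → x ≠ v → r x (n₂ x) := fun x hx h => by
    have : ¬ N₁ x := fun h' => h (hv x h' hx)
    simp [hr, this]
  have from₁ : ∀ b, N₁ b → Relation.ReflTransGen r v b := by
    intro b hb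
    suffices N₁ b ∧ Relation.ReflTransGen r v b from this.2
    have h := r₁ v b hv₁ hb
    clear hb
    induction h with
    | refl => exact ⟨hv₁, .refl⟩
    | @tail x y _ hxy ih =>
      subst hxy
      refine ⟨h₁ _ ih.1, ?_⟩
      by_cases h : n₁ x = v
      · rw [h]
      · exact ih.2.tail (step₁ x ih.1 h)
  have to₂ : ∀ b, N₂ b → Relation.ReflTransGen r b v := by
    intro b hb
    have h := r₂ b v hb hv₂
    revert hb
    induction h using Relation.ReflTransGen.head_induction_on with
    | refl => exact fun _ => .refl
    | @head x y hxy _ ih =>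
      intro hx
      subst hxy
      by_cases h : x = v
      · rw [h]
      · exact .head (step₂ x hx h) (ih (h₂ x hx))
  have to₁ : ∀ b, N₁ b → Relation.ReflTransGen r b v := by
    intro b hb
    have h := r₁ b v hb hv₁
    revert hb
    induction h using Relation.ReflTransGen.head_induction_on with
    | refl => exact fun _ => .refl
    | @head x y hxy _ ih =>
      intro hx
      subst hxy
      by_cases h : n₁ x = v
      · exact .head (stepv x hx h) (to₂ _ (h₂ v hv₂))
      · exact .head (step₁ x hx h) (ih (h₁ x hx))
  have hlast : ∃ p, N₁ p ∧ n₁ p = v := by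
    have h := r₁ (n₁ v) v (h₁ v hv₁) hv₁
    have hp : ∀ p, Relation.ReflTransGen (fun x y => y = n₁ x) (n₁ v) p → N₁ p := by
      intro p h
      induction h with
      | refl => exact h₁ v hv₁
      | tail _ hxy ih => rw [hxy]; exact h₁ _ ih
    rcases Relation.ReflTransGen.cases_tail h with h | ⟨p, h, e⟩
    · exact ⟨v, hv₁, h.symm⟩
    · exact ⟨p, hp p h, e.symm⟩
  have from₂ : ∀ b, N₂ b → Relation.ReflTransGen r v b := by
    intro b hb
    obtain ⟨p, hp, hpv⟩ := hlast
    have h0 : Relation.ReflTransGen r v (n₂ v) := (from₁ p hp).tail (stepv p hp hpv)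
    suffices N₂ b ∧ Relation.ReflTransGen r v b from this.2
    have h := r₂ (n₂ v) b (h₂ v hv₂) hb
    clear hb
    induction h with
    | refl => exact ⟨h₂ v hv₂, h0⟩
    | @tail x y _ hxy ih =>
      subst hxy
      refine ⟨h₂ _ ih.1, ?_⟩
      by_cases h : x = v
      · rw [h]; exact h0
      · exact ih.2.tail (step₂ x ih.1 h)
  exact (hb.elim (to₁ b) (to₂ b)).trans (hc.elim (from₁ c) (from₂ c))

section EdgeSum

variable {V : Type u} {G₁ G₂ : SimpleGraph V} {u v : V}

/-- A cycle of the union of two graphs that share only an edge `uv` is the sum of cycles of the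
two graphs, both corrected on `uv`. -/
theorem IsEvenCycle.exists_add [Fintype V] (h₁ : G₁.Adj u v) (h₂ : G₂.Adj u v)
    (hinter : ∀ x y y', G₁.Adj x y → G₂.Adj x y' → x = u ∨ x = v)
    {z : V → V → ZMod 2} (hz : IsEvenCycle (G₁ ⊔ G₂) z) :
    ∃ z₁ z₂, IsEvenCycle G₁ z₁ ∧ IsEvenCycle G₂ z₂ ∧ (∀ a b, z₁ a b + z₂ a b = z a b) := by
  classical
  have huv : u ≠ v := h₁.ne
  let e : ZMod 2 := ∑ b, if G₁.Adj u b ∧ b ≠ v then z u b else 0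
  let z₁ : V → V → ZMod 2 := fun a b =>
    if (a = u ∧ b = v) ∨ (a = v ∧ b = u) then e else if G₁.Adj a b then z a b else 0
  have hsymm : ∀ a b, z₁ a b = z₁ b a := by
    intro a b
    have : ((a = u ∧ b = v) ∨ (a = v ∧ b = u)) ↔ ((b = u ∧ a = v) ∨ (b = v ∧ a = u)) := by tauto
    simp only [z₁, this, G₁.adj_comm a b, hz.symm a b]
  have hsupp : ∀ a b, ¬ G₁.Adj a b → z₁ a b = 0 := by
    intro a b hab
    have : ¬ ((a = u ∧ b = v) ∨ (a = v ∧ b = u)) := by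
      rintro (⟨rfl, rfl⟩ | ⟨rfl, rfl⟩)
      exacts [hab h₁, hab h₁.symm]
    simp only [z₁, this, hab, if_false]
  have hsumu : ∑ b, z₁ u b = 0 := by
    have h : ∀ b, z₁ u b = (if b = v then e else 0) +
        if G₁.Adj u b ∧ b ≠ v then z u b else 0 := by
      intro b
      by_cases hb : b = v
      · simp [z₁, hb]
      · simp [z₁, hb, huv]
    simp only [h, Finset.sum_add_distrib, Finset.sum_ite_eq', Finset.mem_univ, if_true]
    exact CharTwo.add_self_eq_zero _
  have hsum' : ∀ a, a ≠ u → a ≠ v → ∑ b, z₁ a b = 0 := by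
    intro a hau hav
    by_cases ha : ∃ b, G₁.Adj a b
    · obtain ⟨b₀, hb₀⟩ := ha
      rw [← hz.sum a]
      refine Finset.sum_congr rfl fun b _ => ?_
      by_cases hab : G₁.Adj a b
      · simp [z₁, hau, hav, hab]
      · rw [hsupp a b hab, hz.supp a b]
        rintro (h | h)
        · exact hab h
        · rcases hinter a b₀ b hb₀ h with h | h
          exacts [hau h, hav h]
    · exact Finset.sum_eq_zero fun b _ => hsupp a b fun h => ha ⟨b, h⟩
  have hsumv : ∑ b, z₁ v b = 0 := by
    have h := sum_sum_eq_zero_of_symm Finset.univ z₁ hsymm fun a => hsupp a a G₁.irrefl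
    rwa [Finset.sum_eq_single v (fun a _ hav => ?_) (by simp)] at h
    by_cases hau : a = u
    · rw [hau, hsumu]
    · exact hsum' a hau hav
  have hsum : ∀ a, ∑ b, z₁ a b = 0 := by
    intro a
    by_cases hau : a = u
    · rw [hau, hsumu]
    · by_cases hav : a = v
      · rw [hav, hsumv]
      · exact hsum' a hau hav
  refine ⟨z₁, fun a b => z a b + z₁ a b, ⟨hsymm, hsupp, hsum⟩, ⟨?_, ?_, ?_⟩, ?_⟩
  · intro a b
    rw [hz.symm, hsymm]
  · intro a b hab
    by_cases h : G₁.Adj a b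
    · have : ¬ ((a = u ∧ b = v) ∨ (a = v ∧ b = u)) := by
        rintro (⟨rfl, rfl⟩ | ⟨rfl, rfl⟩)
        exacts [hab h₂, hab h₂.symm]
      simp only [z₁, this, h, if_true, if_false]
      exact CharTwo.add_self_eq_zero _
    · rw [hsupp a b h, hz.supp a b, add_zero]
      rintro (h' | h')
      exacts [h h', hab h']
  · intro a
    rw [Finset.sum_add_distrib, hz.sum, hsum, add_zero]
  · intro a b
    have : ∀ x y : ZMod 2, x + (y + x) = y := by decide
    exact this _ _

open Classical in
/-- The rotations of the union of two graphs that share only the edge `uv`. The orders in which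
the rotations are joined are opposite at `u` and at `v`, so that the second graph lies on one side
of the edge. -/
noncomputable def joinNext (G₁ G₂ : SimpleGraph V) (n₁ n₂ : V → V → V) (u v a b : V) : V :=
  if a = u then (if G₁.Adj a b then (if n₁ a b = v then n₂ a v else n₁ a b) else n₂ a b)
  else if a = v then (if G₂.Adj a b then (if n₂ a b = u then n₁ a u else n₂ a b) else n₁ a b)
  else if G₁.Adj a b then n₁ a b else n₂ a b

/-- The union of two planar graphs that share only an edge and its ends is planar. -/
theorem IsPlanarGraph.sup_of_edge [Finite V] (hG₁ : IsPlanarGraph G₁) (hG₂ : IsPlanarGraph G₂)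
    (h₁ : G₁.Adj u v) (h₂ : G₂.Adj u v)
    (hinter : ∀ x y y', G₁.Adj x y → G₂.Adj x y' → x = u ∨ x = v) :
    IsPlanarGraph (G₁ ⊔ G₂) := by
  classical
  cases nonempty_fintype V
  obtain ⟨R₁, hR₁⟩ := isPlanarGraph_iff.mp hG₁
  obtain ⟨R₂, hR₂⟩ := isPlanarGraph_iff.mp hG₂
  have huv : u ≠ v := h₁.ne
  have hvu : v ≠ u := huv.symm
  have hu : ∀ b, G₁.Adj u b → G₂.Adj u b → b = v := fun b hb hb' =>
    (hinter b u u hb.symm hb'.symm).resolve_left hb.ne'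
  have hv : ∀ b, G₂.Adj v b → G₁.Adj v b → b = u := fun b hb hb' =>
    (hinter b v v hb'.symm hb.symm).resolve_right hb.ne'
  have ho : ∀ a b b', a ≠ u → a ≠ v → G₁.Adj a b → ¬ G₂.Adj a b' := fun a b b' hau hav hb hb' =>
    (hinter a b b' hb hb').elim hau hav
  obtain ⟨R, hR⟩ := RotationSystem.exists_of_next (G := G₁ ⊔ G₂)
    (joinNext G₁ G₂ R₁.next R₂.next u v) (by
      intro a b hab
      rw [SimpleGraph.sup_adj] at hab ⊢
      unfold joinNext
      split_ifs with h1 h2 h3 h4 h5 h6 h7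
      · subst h1; exact .inr (R₂.adj_next h₂)
      · exact .inl (R₁.adj_next h2)
      · exact .inr (R₂.adj_next (hab.resolve_left h2))
      · subst h4; exact .inl (R₁.adj_next h₁.symm)
      · exact .inr (R₂.adj_next h5)
      · exact .inl (R₁.adj_next (hab.resolve_right h5))
      · exact .inl (R₁.adj_next h7)
      · exact .inr (R₂.adj_next (hab.resolve_left h7))) (by
      intro a b c hab hac
      rw [SimpleGraph.sup_adj] at hab hac
      unfold joinNext
      by_cases hau : a = u
      · subst hau
        simp only [if_true]
        exact reaches_join (G₁.Adj a) (G₂.Adj a) (R₁.next a) (R₂.next a) v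
          (fun _ h => R₁.adj_next h) (fun _ h => R₂.adj_next h) (fun _ _ h h' => R₁.reaches_next h h')
          (fun _ _ h h' => R₂.reaches_next h h') h₁ h₂ hu b c hab hac
      · by_cases hav : a = v
        · subst hav
          simp only [hau, if_true, if_false]
          exact reaches_join (G₂.Adj a) (G₁.Adj a) (R₂.next a) (R₁.next a) u
            (fun _ h => R₂.adj_next h) (fun _ h => R₁.adj_next h)
            (fun _ _ h h' => R₂.reaches_next h h')
            (fun _ _ h h' => R₁.reaches_next h h') h₂.symm h₁.symm hv b c hab.symm hac.symm
        · simp only [hau, hav, if_false]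
          rcases hab with hb | hb
          · have hc := hac.resolve_right (ho a b c hau hav hb)
            exact reaches_congr (G₁.Adj a) (fun _ h => R₁.adj_next h) (fun x hx => if_pos hx) hb
              (R₁.reaches_next hb hc)
          · have hn : ∀ x, G₂.Adj a x → ¬ G₁.Adj a x := fun x h h' => ho a x x hau hav h' h
            have hc := hac.resolve_left fun h => ho a c b hau hav h hb
            exact reaches_congr (G₂.Adj a) (fun _ h => R₂.adj_next h)
              (fun x hx => if_neg (hn x hx)) hb (R₂.reaches_next hb hc))
  refine isPlanarGraph_iff.mpr ⟨R, fun z hz => ?_⟩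
  obtain ⟨z₁, z₂, hz₁, hz₂, hzz⟩ := hz.exists_add h₁ h₂ hinter
  obtain ⟨f₁, hf₁, hfz₁⟩ := hR₁ z₁ hz₁
  obtain ⟨g, hg, hgz⟩ := hR₂ z₂ hz₂
  -- A constant is added so that the faces on the two sides that merge have the same value.
  obtain ⟨f₂, hf₂, hfz₂, hmerge⟩ : ∃ f₂, R₂.IsFaceFunction f₂ ∧
      (∀ a b, G₂.Adj a b → f₂ a b + f₂ b a = z₂ a b) ∧ f₂ v u = f₁ u v := by
    refine ⟨fun a b => g a b + (g v u + f₁ u v), fun a b hab => ?_, fun a b hab => ?_, ?_⟩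
    · simp only [hg a b hab]
    · rw [← hgz a b hab]
      have : ∀ x y t : ZMod 2, x + t + (y + t) = x + y := by decide
      exact this _ _ _
    · have : ∀ x y : ZMod 2, x + (x + y) = y := by decide
      exact this _ _
  let f : V → V → ZMod 2 := fun a b => if G₁.Adj a b ∧ ¬ (a = u ∧ b = v) then f₁ a b else f₂ a b
  have hfa : ∀ a b, G₁.Adj a b → ¬ (a = u ∧ b = v) → f a b = f₁ a b := fun a b h h' =>
    if_pos ⟨h, h'⟩
  have hfb : ∀ a b, ¬ G₁.Adj a b → f a b = f₂ a b := fun a b h => if_neg fun h' => h h'.1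
  have hfuv : f u v = f₂ u v := if_neg fun h => h.2 ⟨rfl, rfl⟩
  have hfu : ∀ b, G₂.Adj u b → f u b = f₂ u b := by
    intro b hb
    by_cases h : G₁.Adj u b
    · rw [hu b h hb, hfuv]
    · exact hfb u b h
  have hfv : ∀ b, G₂.Adj v b → f b v = f₂ b v := by
    intro b hb
    by_cases h : G₁.Adj v b
    · rw [hv b hb h, hfuv]
    · exact hfb b v fun h' => h h'.symm
  refine ⟨f, ?_, ?_⟩
  · intro a b hab
    rw [hR a b hab]
    rw [SimpleGraph.sup_adj] at hab
    unfold joinNext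
    split_ifs with h1 h2 h3 h4 h5 h6 h7
    · subst h1
      rw [hfu _ (R₂.adj_next h₂), hf₂ a v h₂, hmerge, ← h3, hf₁ a b h2,
        hfa b a h2.symm (by tauto)]
    · subst h1
      rw [hfa _ _ (R₁.adj_next h2) (by tauto), hf₁ a b h2, hfa b a h2.symm (by tauto)]
    · subst h1
      have hb := hab.resolve_left h2
      rw [hfu _ (R₂.adj_next hb), hf₂ a b hb, hfb b a fun h => h2 h.symm]
    · subst h4
      rw [hfa _ _ (R₁.adj_next h₁.symm) (by tauto), hf₁ a u h₁.symm, ← hmerge, ← h6, hf₂ a b h5,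
        hfv b h5]
    · subst h4
      have h8 := R₂.adj_next h5
      rw [hfb _ _ fun h => h6 (hv _ h8 h), hf₂ a b h5, hfv b h5]
    · subst h4
      have hb := hab.resolve_right h5
      rw [hfa _ _ (R₁.adj_next hb) (by tauto), hf₁ a b hb, hfa b a hb.symm]
      rintro ⟨rfl, -⟩
      exact h5 h₂.symm
    · rw [hfa _ _ (R₁.adj_next h7) (by tauto), hf₁ a b h7, hfa b a h7.symm (by tauto)]
    · have hb := hab.resolve_left h7
      rw [hfb _ _ fun h => ho a _ b h1 h4 h hb, hf₂ a b hb, hfb b a fun h => h7 h.symm]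
  · intro a b hab
    rw [SimpleGraph.sup_adj] at hab
    have hsum : f₂ u v + f₁ v u = z u v := by
      rw [← hzz, ← hfz₁ u v h₁, ← hfz₂ u v h₂, hmerge]
      have : ∀ x y t : ZMod 2, x + y = t + y + (x + t) := by decide
      exact this _ _ _
    by_cases h : a = u ∧ b = v
    · obtain ⟨rfl, rfl⟩ := h
      rw [hfuv, hfa b a h₁.symm (by tauto), hsum]
    · by_cases h' : a = v ∧ b = u
      · obtain ⟨rfl, rfl⟩ := h'
        rw [hfuv, hfa a b h₁.symm (by tauto), hz.symm, ← hsum, add_comm]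
      · by_cases h1 : G₁.Adj a b
        · have h2 : ¬ G₂.Adj a b := by
            intro h2
            have e1 := hinter a b b h1 h2
            have e2 := hinter b a a h1.symm h2.symm
            rcases e1 with rfl | rfl <;> rcases e2 with rfl | rfl <;>
              first
              | exact G₁.irrefl h1
              | exact h ⟨rfl, rfl⟩
              | exact h' ⟨rfl, rfl⟩
          rw [hfa a b h1 h, hfa b a h1.symm (by tauto), hfz₁ a b h1, ← hzz, hz₂.supp a b h2, add_zero]
        · have h2 := hab.resolve_left h1
          rw [hfb a b h1, hfb b a fun h => h1 h.symm, hfz₂ a b h2, ← hzz, hz₁.supp a b h1, zero_add]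

end EdgeSum

/-! ### Three copies of a digraph along a directed triangle -/

section ThreeCopies

theorem isPlanarGraph_bot {V : Type u} [Finite V] : IsPlanarGraph (⊥ : SimpleGraph V) := by
  cases nonempty_fintype V
  obtain ⟨R, -⟩ := RotationSystem.exists_of_next (G := (⊥ : SimpleGraph V)) (fun _ w => w)
    (fun _ _ h => h) (fun _ _ _ h => h.elim)
  exact isPlanarGraph_iff.mpr ⟨R, fun _ _ => ⟨0, fun _ _ h => h.elim, fun _ _ h => h.elim⟩⟩

theorem isPlanarGraph_top_three : IsPlanarGraph (⊤ : SimpleGraph (ULift.{u} (ZMod 3))) := by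
  have hcard : Nat.card (ULift.{u} (ZMod 3)) = 3 := by simp
  obtain ⟨T, -, hT⟩ := (isPlanarGraph_bot (V := ULift.{u} (ZMod 3))).exists_triangulation hcard.ge
  obtain ⟨R, hR⟩ := hT.2.1
  obtain ⟨w, hw⟩ := hT.exists_adj ⟨0⟩
  obtain ⟨h1, h2, h3, -⟩ := hT.boundsFace hR hw
  let ι : ULift.{u} (ZMod 3) → ULift.{u} (ZMod 3) := fun i => ![⟨0⟩, w, R.next w ⟨0⟩] i.down
  have hadj : ∀ i j : ZMod 3, i ≠ j → T.Adj (ι ⟨i⟩) (ι ⟨j⟩) := by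
    intro i j hij
    fin_cases i <;> fin_cases j <;>
      first
      | exact (hij rfl).elim
      | exact h1
      | exact h2
      | exact h3
      | exact h1.symm
      | exact h2.symm
      | exact h3.symm
  refine hT.2.1.of_injective ι ?_ ?_
  · rintro ⟨i⟩ ⟨j⟩ e
    by_contra hij
    exact (hadj i j fun h => hij (congrArg ULift.up h)).ne e
  · rintro ⟨i⟩ ⟨j⟩ h
    exact hadj i j fun e => h (congrArg ULift.up e)

variable {W : Type u}

/-- The vertices of three copies of `W`, where `q` in the copy `i` is identified with `p` in the
copy `i + 1`. The latter name is used for these vertices. -/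
abbrev ThreeCopies (q : W) : Type u := {w : W // w ≠ q} × ZMod 3

variable {p q : W}

open Classical in
/-- The map onto the copy `i`. -/
noncomputable def toCopy (hpq : p ≠ q) (i : ZMod 3) (w : W) : ThreeCopies q :=
  if h : w = q then (⟨p, hpq⟩, i + 1) else (⟨w, h⟩, i)

variable (hpq : p ≠ q)

theorem toCopy_right (i : ZMod 3) : toCopy hpq i q = (⟨p, hpq⟩, i + 1) := by simp [toCopy]

theorem toCopy_of_ne (i : ZMod 3) {w : W} (h : w ≠ q) : toCopy hpq i w = (⟨w, h⟩, i) := by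
  simp [toCopy, h]

theorem toCopy_eq_iff {i j : ZMod 3} {w w' : W} :
    toCopy hpq i w = toCopy hpq j w' ↔ (i = j ∧ w = w') ∨ (j = i + 1 ∧ w = q ∧ w' = p) ∨
      (i = j + 1 ∧ w = p ∧ w' = q) := by
  have h3 : ∀ i : ZMod 3, i + 1 ≠ i := by decide
  by_cases h : w = q <;> by_cases h' : w' = q
  · subst h
    subst h'
    simp [toCopy_right, hpq.symm]
  · subst h
    rw [toCopy_right, toCopy_of_ne hpq j h']
    simp only [Prod.mk.injEq, Subtype.mk.injEq]
    constructor
    · rintro ⟨rfl, rfl⟩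
      tauto
    · rintro (⟨-, rfl⟩ | ⟨rfl, -, rfl⟩ | ⟨-, rfl, -⟩)
      exacts [(h' rfl).elim, ⟨rfl, rfl⟩, (hpq rfl).elim]
  · subst h'
    rw [toCopy_right, toCopy_of_ne hpq i h]
    simp only [Prod.mk.injEq, Subtype.mk.injEq]
    constructor
    · rintro ⟨rfl, rfl⟩
      tauto
    · rintro (⟨-, rfl⟩ | ⟨-, rfl, -⟩ | ⟨rfl, rfl, -⟩)
      exacts [(h rfl).elim, (h rfl).elim, ⟨rfl, rfl⟩]
  · rw [toCopy_of_ne hpq i h, toCopy_of_ne hpq j h']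
    simp only [Prod.mk.injEq, Subtype.mk.injEq]
    tauto

/-- The map onto a copy, as an embedding. -/
noncomputable def copyEmbedding (i : ZMod 3) : W ↪ ThreeCopies q where
  toFun := toCopy hpq i
  inj' := by
    intro a b h
    have h3 : ∀ i : ZMod 3, i ≠ i + 1 := by decide
    rcases (toCopy_eq_iff hpq).mp h with h | h | h
    exacts [h.2, (h3 _ h.1).elim, (h3 _ h.1).elim]

/-- Three copies of the digraph `D`, glued in such a way that the three copies of an arc `pq` form
a directed triangle. -/
def threeCopies (D : Digraph W) : Digraph (ThreeCopies q) where
  Adj x y := ∃ i a b, D.Adj a b ∧ toCopy hpq i a = x ∧ toCopy hpq i b = y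

theorem isSimpleDigraph_threeCopies {D : Digraph W} (hD : IsSimpleDigraph D) :
    IsSimpleDigraph (threeCopies hpq D) := by
  have h3 : ∀ i : ZMod 3, i ≠ i + 1 + 1 := by decide
  have hirr : ∀ a, ¬ D.Adj a a := fun a h => hD a a h h
  rintro x y ⟨i, a, b, hab, rfl, rfl⟩ ⟨j, a', b', hab', e1, e2⟩
  rcases (toCopy_eq_iff hpq).mp e1 with ⟨rfl, rfl⟩ | ⟨rfl, rfl, rfl⟩ | ⟨rfl, rfl, rfl⟩ <;>
    rcases (toCopy_eq_iff hpq).mp e2 with ⟨h, rfl⟩ | ⟨h, rfl, h'⟩ | ⟨h, rfl, h'⟩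
  · exact hD _ _ hab hab'
  · exact (by decide : ∀ i : ZMod 3, i ≠ i + 1) _ h
  · exact (by decide : ∀ i : ZMod 3, i ≠ i + 1) _ h
  · exact (by decide : ∀ i : ZMod 3, i + 1 ≠ i) _ h.symm
  · exact hirr _ hab'
  · exact h3 _ h
  · exact (by decide : ∀ i : ZMod 3, i + 1 ≠ i) _ h
  · exact h3 _ h
  · exact hirr _ hab'

/-- One of the three copies is added to a graph that meets it only in an edge. -/
theorem isPlanarGraph_sup_copy [Finite W] {G : SimpleGraph W} (hG : IsPlanarGraph G)
    (h : G.Adj p q) {H : SimpleGraph (ThreeCopies q)} (hH : IsPlanarGraph H) (k : ZMod 3)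
    (hk : H.Adj (⟨p, hpq⟩, k) (⟨p, hpq⟩, k + 1))
    (hsupp : ∀ x y, H.Adj x y → x.1 = ⟨p, hpq⟩ ∨ ∃ i ≠ k, ∃ a, x = toCopy hpq i a) :
    IsPlanarGraph (H ⊔ G.map (copyEmbedding hpq k)) := by
  have hp := toCopy_of_ne hpq k hpq
  have hq := toCopy_right hpq k
  refine hH.sup_of_edge (hG.map _) hk ⟨hk.ne, p, q, h, hp, hq⟩ ?_
  rintro x y y' hxy ⟨-, a, b, -, e, -⟩
  have e : toCopy hpq k a = x := e
  rcases hsupp x y hxy with hx | ⟨i, hik, c, hc⟩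
  · by_cases ha : a = q
    · right; rw [← e, ha, hq]
    · left
      rw [toCopy_of_ne hpq k ha] at e
      rw [← e] at hx ⊢
      exact Prod.ext hx rfl
  · rw [hc] at e
    rcases (toCopy_eq_iff hpq).mp e with ⟨rfl, -⟩ | ⟨rfl, rfl, rfl⟩ | ⟨rfl, rfl, rfl⟩
    · exact (hik rfl).elim
    · right; rw [hc, toCopy_of_ne hpq _ hpq]
    · left; rw [hc, toCopy_right]

theorem isPlanarGraph_threeCopies [Finite W] {D : Digraph W}
    (hG : IsPlanarGraph D.toSimpleGraphInclusive) (h : D.Adj p q) :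
    IsPlanarGraph (threeCopies hpq D).toSimpleGraphInclusive := by
  let G := D.toSimpleGraphInclusive
  have hGpq : G.Adj p q := ⟨hpq, .inl h⟩
  let X : ULift.{u} (ZMod 3) ↪ ThreeCopies q :=
    ⟨fun i => (⟨p, hpq⟩, i.down), fun i j e => ULift.ext _ _ (congrArg Prod.snd e)⟩
  let Δ : SimpleGraph (ThreeCopies q) := (⊤ : SimpleGraph (ULift.{u} (ZMod 3))).map X
  have hΔ : IsPlanarGraph Δ := isPlanarGraph_top_three.map X
  have hΔadj : ∀ k : ZMod 3, Δ.Adj (⟨p, hpq⟩, k) (⟨p, hpq⟩, k + 1) := by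
    intro k
    have h3 : k ≠ k + 1 := (by decide : ∀ i : ZMod 3, i ≠ i + 1) k
    exact ⟨fun e => h3 (congrArg Prod.snd e), ⟨k⟩, ⟨k + 1⟩,
      fun e => h3 (congrArg ULift.down e), rfl, rfl⟩
  have hΔsupp : ∀ x y, Δ.Adj x y → x.1 = ⟨p, hpq⟩ := by
    rintro _ _ ⟨-, i, j, -, rfl, -⟩
    rfl
  have hcopy : ∀ i x y, (G.map (copyEmbedding hpq i)).Adj x y → ∃ a, x = toCopy hpq i a := by
    rintro i x y ⟨-, a, b, -, e, -⟩
    exact ⟨a, e.symm⟩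
  have h0 := isPlanarGraph_sup_copy hpq hG hGpq hΔ 0 (hΔadj 0)
    fun x y hxy => .inl (hΔsupp x y hxy)
  have h1 := isPlanarGraph_sup_copy hpq hG hGpq h0 1 (.inl (hΔadj 1)) (by
    rintro x y (hxy | hxy)
    · exact .inl (hΔsupp x y hxy)
    · exact .inr ⟨0, by decide, hcopy _ _ _ hxy⟩)
  have h2 := isPlanarGraph_sup_copy hpq hG hGpq h1 2 (.inl (.inl (hΔadj 2))) (by
    rintro x y ((hxy | hxy) | hxy)
    · exact .inl (hΔsupp x y hxy)
    · exact .inr ⟨0, by decide, hcopy _ _ _ hxy⟩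
    · exact .inr ⟨1, by decide, hcopy _ _ _ hxy⟩)
  refine h2.mono ?_
  have hle : ∀ i x y, (G.map (copyEmbedding hpq i)).Adj x y →
      (((Δ ⊔ G.map (copyEmbedding hpq 0)) ⊔ G.map (copyEmbedding hpq 1)) ⊔
        G.map (copyEmbedding hpq 2)).Adj x y := by
    intro i x y hxy
    have : ∀ i : ZMod 3, i = 0 ∨ i = 1 ∨ i = 2 := by decide
    rcases this i with rfl | rfl | rfl
    exacts [.inl (.inl (.inr hxy)), .inl (.inr hxy), .inr hxy]
  rintro x y ⟨hne, ⟨i, a, b, hab, rfl, rfl⟩ | ⟨i, a, b, hab, rfl, rfl⟩⟩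
  · exact hle i _ _ ⟨hne, a, b, ⟨fun e => hne (by rw [e]), .inl hab⟩, rfl, rfl⟩
  · exact hle i _ _ ⟨hne, b, a, ⟨fun e => hne (by rw [e]), .inr hab⟩, rfl, rfl⟩

end ThreeCopies

/-- Every planar digraph has an acyclic 2-colouring. -/
def PlanarColouring : Prop :=
  ∀ (V : Type u) [Finite V] (D : Digraph V), IsSimpleDigraph D →
    IsPlanarGraph D.toSimpleGraphInclusive → ∃ c : V → Fin 2, IsAcyclicColouring D c

/-- If planar digraphs have acyclic 2-colourings, then the ends of any given arc may be required
to have the same colour: otherwise three copies of the digraph, glued along a directed triangle,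
would give a proper 2-colouring of that triangle. -/
theorem PlanarColouring.exists_eq (h : PlanarColouring.{u}) {W : Type u} [Finite W]
    {D : Digraph W} (hD : IsSimpleDigraph D) (hpl : IsPlanarGraph D.toSimpleGraphInclusive)
    {p q : W} (hpq : D.Adj p q) : ∃ c : W → Fin 2, IsAcyclicColouring D c ∧ c p = c q := by
  have hne : p ≠ q := by
    rintro rfl
    exact hD _ _ hpq hpq
  obtain ⟨c, hc⟩ := h _ (threeCopies hne D) (isSimpleDigraph_threeCopies hne hD)
    (isPlanarGraph_threeCopies hne hpl hpq)
  by_contra hcon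
  have hdiff : ∀ i : ZMod 3, c (⟨p, hne⟩, i) ≠ c (⟨p, hne⟩, i + 1) := by
    intro i e
    refine hcon ⟨c ∘ toCopy hne i, hc.comp _ fun x y hxy => ⟨i, x, y, hxy, rfl, rfl⟩, ?_⟩
    rw [Function.comp_apply, Function.comp_apply, toCopy_right, toCopy_of_ne hne i hne]
    exact e
  have hfin : ∀ x y z : Fin 2, x ≠ y → y ≠ z → z ≠ x → False := by decide
  exact hfin _ _ _ (hdiff 0) (hdiff 1) (hdiff 2)

theorem IsAcyclicColouring.perm {k : ℕ} {V : Type u} {D : Digraph V} {c : V → Fin k}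
    (hc : IsAcyclicColouring D c) (σ : Equiv.Perm (Fin k)) : IsAcyclicColouring D (σ ∘ c) := by
  intro i
  have h := hc (σ.symm i)
  have e : (σ ∘ c) ⁻¹' {i} = c ⁻¹' {σ.symm i} := by
    ext x
    simp [Equiv.eq_symm_apply]
  rwa [e]

theorem PlanarColouring.exists_eq_of_triangulation (h : PlanarColouring.{u}) {V : Type u}
    [Finite V] {T : SimpleGraph V} (hT : IsPlanarTriangulation T) {R : RotationSystem T}
    (hR : R.IsPlanar) {D : Digraph V} (hD : IsOrientation D T) {a b : V} (hab : T.Adj a b) :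
    ∃ c : V → Fin 2, IsAcyclicColouring D c ∧
      (∀ x y z : V, R.IsFacialTriangle x y z → ¬ (c x = c y ∧ c y = c z)) ∧ c a = c b := by
  have htri : R.IsTriangular := fun u v huv => hT.next_next hR huv
  have hor := isOrientation_gadget htri hD
  have hpl : IsPlanarGraph (gadgetDigraph D T R.next).toSimpleGraphInclusive := by
    rw [hor.2]
    exact isPlanarGraph_gadget htri hR
  have key : ∀ a b, D.Adj a b → ∃ c : V → Fin 2, IsAcyclicColouring D c ∧
      (∀ x y z : V, R.IsFacialTriangle x y z → ¬ (c x = c y ∧ c y = c z)) ∧ c a = c b := by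
    intro a b hab
    obtain ⟨c, hc, e⟩ := h.exists_eq hor.1 hpl (p := .inl a) (q := .inl b) hab
    exact ⟨c ∘ Sum.inl, hc.comp _ fun _ _ hxy => hxy,
      fun x y z hxyz => not_monochromatic_of_gadget hD hc hxyz, e⟩
  rcases ((isOrientation_iff.mp hD).2 a b).mp hab with hab | hba
  · exact key a b hab
  · obtain ⟨c, h1, h2, h3⟩ := key b a hba
    exact ⟨c, h1, h2, h3.symm⟩

/-- Up to exchange of the colours, a non-monochromatic 2-colouring of three vertices is given by
the two vertices that have the same colour. -/
theorem PlanarColouring.facialExtension (h : PlanarColouring.{u}) : FacialExtension.{u} := by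
  intro V _ T hT R hR a₁ a₂ a₃ ha P hP D hD
  obtain ⟨h12, h23, h31⟩ := ha.isTriangle
  have hc : ∃ c : V → Fin 2, IsAcyclicColouring D c ∧
      (∀ x y z : V, R.IsFacialTriangle x y z → ¬ (c x = c y ∧ c y = c z)) ∧
      ((P a₁ = P a₂ ∧ c a₁ = c a₂) ∨ (P a₂ = P a₃ ∧ c a₂ = c a₃) ∨
        (P a₃ = P a₁ ∧ c a₃ = c a₁)) := by
    have hfin : ∀ x y z : Fin 2, x = y ∨ y = z ∨ z = x := by decide
    rcases hfin (P a₁) (P a₂) (P a₃) with e | e | e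
    · obtain ⟨c, h1, h2, h3⟩ := h.exists_eq_of_triangulation hT hR hD h12
      exact ⟨c, h1, h2, .inl ⟨e, h3⟩⟩
    · obtain ⟨c, h1, h2, h3⟩ := h.exists_eq_of_triangulation hT hR hD h23
      exact ⟨c, h1, h2, .inr (.inl ⟨e, h3⟩)⟩
    · obtain ⟨c, h1, h2, h3⟩ := h.exists_eq_of_triangulation hT hR hD h31
      exact ⟨c, h1, h2, .inr (.inr ⟨e, h3⟩)⟩
  obtain ⟨c, h1, h2, h3⟩ := hc
  have hswap : ∀ x x' : Fin 2, x' ≠ x → Equiv.swap 0 1 x' = x := by decide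
  have hfin : ∀ x y z x' y' z' : Fin 2, ¬ (x = y ∧ y = z) → ¬ (x' = y' ∧ y' = z') →
      ((x = y ∧ x' = y') ∨ (y = z ∧ y' = z') ∨ (z = x ∧ z' = x')) →
      (x' = x ∧ y' = y ∧ z' = z) ∨ (x' ≠ x ∧ y' ≠ y ∧ z' ≠ z) := by
    intro x y z x' y' z'
    omega
  rcases hfin _ _ _ _ _ _ hP (h2 _ _ _ ha) h3 with h4 | h4
  · exact ⟨c, h1, h2, h4⟩
  · refine ⟨Equiv.swap 0 1 ∘ c, h1.perm _, fun x y z hxyz => ?_, hswap _ _ h4.1,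
      hswap _ _ h4.2.1, hswap _ _ h4.2.2⟩
    simpa only [Function.comp_apply, EmbeddingLike.apply_eq_iff_eq] using h2 x y z hxyz

/-! ### The four statements -/

theorem exists_isAcyclicColouring_of_card_lt {V : Type u} [Finite V] (h : Nat.card V < 3)
    {D : Digraph V} (hD : IsSimpleDigraph D) : ∃ c : V → Fin 2, IsAcyclicColouring D c := by
  let e : V → Fin 2 := fun x => Fin.castLE (by omega) (Finite.equivFin V x)
  have he : Function.Injective e := (Fin.castLE_injective _).comp (Finite.equivFin V).injective
  refine ⟨e, fun i x hx => ?_⟩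
  obtain ⟨y, ⟨h1, h2, h3⟩, -⟩ := Relation.TransGen.head'_iff.mp hx
  obtain rfl : x = y := he (h1.trans h2.symm)
  exact hD _ _ h3 h3

/-- A digraph whose underlying graph is contained in `T` extends to an orientation of `T`. -/
theorem exists_isOrientation {V : Type u} [Finite V] {D : Digraph V} (hD : IsSimpleDigraph D)
    {T : SimpleGraph V} (h : D.toSimpleGraphInclusive ≤ T) :
    ∃ D' : Digraph V, IsOrientation D' T ∧ ∀ x y, D.Adj x y → D'.Adj x y := by
  let e := Finite.equivFin V
  refine ⟨⟨fun x y => D.Adj x y ∨ (T.Adj x y ∧ ¬ D.Adj y x ∧ e x < e y)⟩, ?_, fun _ _ => .inl⟩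
  rw [isOrientation_iff]
  constructor
  · rintro x y (h1 | h1) (h2 | h2)
    · exact hD _ _ h1 h2
    · exact h2.2.1 h1
    · exact h1.2.1 h2
    · exact lt_asymm h1.2.2 h2.2.2
  · intro x y
    have hne : ∀ x y, D.Adj x y → T.Adj x y := by
      intro x y hxy
      refine h ⟨?_, .inl hxy⟩
      rintro rfl
      exact hD _ _ hxy hxy
    constructor
    · intro hxy
      by_cases h1 : D.Adj x y
      · exact .inl (.inl h1)
      · by_cases h2 : D.Adj y x
        · exact .inr (.inl h2)
        · rcases lt_or_gt_of_ne (e.injective.ne hxy.ne) with h3 | h3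
          · exact .inl (.inr ⟨hxy, h2, h3⟩)
          · exact .inr (.inr ⟨hxy.symm, h1, h3⟩)
    · rintro ((h1 | h1) | (h1 | h1))
      exacts [hne _ _ h1, h1.1, (hne _ _ h1).symm, h1.1.symm]

theorem planarColouring_of_triangulations
    (h : ∀ (V : Type u) [Finite V] (T : SimpleGraph V), IsPlanarTriangulation T →
      ∀ D : Digraph V, IsOrientation D T → ∃ c : V → Fin 2, IsAcyclicColouring D c) :
    PlanarColouring.{u} := by
  intro V _ D hD hpl
  rcases Nat.lt_or_ge (Nat.card V) 3 with h3 | h3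
  · exact exists_isAcyclicColouring_of_card_lt h3 hD
  · obtain ⟨T, hDT, hT⟩ := hpl.exists_triangulation h3
    obtain ⟨D', hD', hDD'⟩ := exists_isOrientation hD hDT
    obtain ⟨c, hc⟩ := h V T hT D' hD'
    exact ⟨c, hc.comp id hDD'⟩

/-- A colouring of three vertices that is not constant extends to all vertices. -/
theorem exists_extension_precolouring {V : Type u} {a b c : V} (p : ({a, b, c} : Set V) → Fin 2)
    (hp : ¬ ∃ i : Fin 2, ∀ x, p x = i) :
    ∃ P : V → Fin 2, (∀ x : ({a, b, c} : Set V), P x = p x) ∧ ¬ (P a = P b ∧ P b = P c) := by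
  classical
  refine ⟨fun x => if h : x ∈ ({a, b, c} : Set V) then p ⟨x, h⟩ else 0, ?_, ?_⟩
  · rintro ⟨x, hx⟩
    simp only [hx, dite_true]
  · rintro ⟨h1, h2⟩
    have ha : a ∈ ({a, b, c} : Set V) := by simp
    have hb : b ∈ ({a, b, c} : Set V) := by simp
    have hc : c ∈ ({a, b, c} : Set V) := by simp
    simp only [ha, hb, hc, dite_true] at h1 h2
    refine hp ⟨p ⟨b, hb⟩, ?_⟩
    rintro ⟨x, rfl | rfl | rfl⟩
    exacts [h1, rfl, h2.symm]

end PlanarDichromatic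

theorem proposition2p2 :
    List.TFAE [
      -- (i) every planar digraph has an acyclic 2-colouring
      ∀ (V : Type u) [Finite V] (D : Digraph V),
        PlanarDichromatic.IsSimpleDigraph D →
        PlanarDichromatic.IsPlanarGraph D.toSimpleGraphInclusive →
        ∃ c : V → Fin 2, PlanarDichromatic.IsAcyclicColouring D c,
      -- (ii) no monochromatic facial triangle
      ∀ (V : Type u) [Finite V] (T : SimpleGraph V),
        PlanarDichromatic.IsPlanarTriangulation T →
        ∀ R : PlanarDichromatic.RotationSystem T, R.IsPlanar →
        ∀ D : Digraph V, PlanarDichromatic.IsOrientation D T →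
        ∃ c : V → Fin 2, PlanarDichromatic.IsAcyclicColouring D c ∧
          (∀ x y z : V, R.IsFacialTriangle x y z → ¬ (c x = c y ∧ c y = c z)),
      -- (iii) moreover extending a pre-colouring of a facial triangle
      ∀ (V : Type u) [Finite V] (T : SimpleGraph V),
        PlanarDichromatic.IsPlanarTriangulation T →
        ∀ R : PlanarDichromatic.RotationSystem T, R.IsPlanar →
        ∀ a₁ a₂ a₃ : V, R.IsFacialTriangle a₁ a₂ a₃ →
        ∀ p : ({a₁, a₂, a₃} : Set V) → Fin 2, (¬ ∃ i : Fin 2, ∀ x, p x = i) →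
        ∀ D : Digraph V, PlanarDichromatic.IsOrientation D T →
        ∃ c : V → Fin 2, PlanarDichromatic.IsAcyclicColouring D c ∧
          (∀ x y z : V, R.IsFacialTriangle x y z → ¬ (c x = c y ∧ c y = c z)) ∧
          (∀ x : ({a₁, a₂, a₃} : Set V), c x = p x),
      -- (iv) no monochromatic triangle at all, extending a pre-colouring of any triangle
      ∀ (V : Type u) [Finite V] (T : SimpleGraph V),
        PlanarDichromatic.IsPlanarTriangulation T →
        ∀ a₁ a₂ a₃ : V, PlanarDichromatic.IsTriangle T a₁ a₂ a₃ →
        ∀ p : ({a₁, a₂, a₃} : Set V) → Fin 2, (¬ ∃ i : Fin 2, ∀ x, p x = i) →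
        ∀ D : Digraph V, PlanarDichromatic.IsOrientation D T →
        ∃ c : V → Fin 2, PlanarDichromatic.IsAcyclicColouring D c ∧
          (∀ x y z : V, PlanarDichromatic.IsTriangle T x y z → ¬ (c x = c y ∧ c y = c z)) ∧
          (∀ x : ({a₁, a₂, a₃} : Set V), c x = p x)] := by
  tfae_have 4 → 3 := by
    intro h V _ T hT R hR a₁ a₂ a₃ ha p hp D hD
    obtain ⟨c, h1, h2, h3⟩ := h V T hT a₁ a₂ a₃ ha.isTriangle p hp D hD
    exact ⟨c, h1, fun x y z hxyz => h2 x y z hxyz.isTriangle, h3⟩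
  tfae_have 3 → 2 := by
    classical
    intro h V _ T hT R hR D hD
    have hne : Nonempty V := (Nat.card_pos_iff.mp (by have := hT.1; omega)).1
    obtain ⟨v⟩ := hne
    obtain ⟨w, hw⟩ := hT.exists_adj v
    obtain ⟨c, h1, h2, -⟩ := h V T hT R hR v w _ (.inl (hT.boundsFace hR hw))
      (fun x => if x.1 = v then 0 else 1) (by
        rintro ⟨i, hi⟩
        have h1 := hi ⟨v, by simp⟩
        have h2 := hi ⟨w, by simp⟩
        rw [← h1] at h2
        simp [hw.ne'] at h2) D hD
    exact ⟨c, h1, h2⟩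
  tfae_have 2 → 1 := by
    intro h
    refine PlanarDichromatic.planarColouring_of_triangulations fun V _ T hT D hD => ?_
    obtain ⟨R, hR⟩ := hT.2.1
    obtain ⟨c, hc, -⟩ := h V T hT R hR D hD
    exact ⟨c, hc⟩
  tfae_have 1 → 4 := by
    intro h V _ T hT a₁ a₂ a₃ ha p hp D hD
    obtain ⟨P, hPp, hP⟩ := PlanarDichromatic.exists_extension_precolouring p hp
    obtain ⟨c, h1, h2, h3, h4, h5⟩ :=
      (PlanarDichromatic.PlanarColouring.facialExtension h).triangleExtension _ V T rfl hT
        a₁ a₂ a₃ ha P hP D hD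
    refine ⟨c, h1, h2, ?_⟩
    rintro ⟨x, hx⟩
    rw [← hPp]
    rcases hx with rfl | rfl | rfl
    exacts [h3, h4, h5]
  tfae_finish
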